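/- **Setting.** An association scheme of size $d$ on a nonempty finite set $X$ is a partition $S=\{R_0,\dots,R_d\}$ of $X\times X$ into nonempty parts such that $R_0$ is the diagonal, each $R_{i'}:=\{(x,y):(y,x)\in R_i\}$ is again a part, and for $(x,y)\in R_\ell$ the number $p_{ij}^{\ell}=|\{z:(x,z)\in R_i,(z,y)\in R_j\}|$ depends only on $i,j,\ell$. Put $k_i=p_{ii'}^0$ and $|R_iR_j|=|\{\ell: p_{ij}^\ell>0\}|$. $S$ is quasi-thin if all $k_i\le 2$. Let $\mathcal A_2=\{i:k_i=2\}$. A pair $(a,b)$ is bad if $|R_{a'}R_b|=1$ and there are $n\ge 0$ and indices $i_m,j_m,\ell_m$ $(0\le m\le n)$ with $i_0=a$, $\ell_n=b$, $k_{i_m}=k_{\ell_m}=2$, $p_{i_mj_m}^{\ell_m}=1$ for all $m\le n$, and $\ell_m=i_{m+1}$ for $m<n$. For $i,j\in\mathcal A_2$ write $i\sim j$ if $|R_{i'}R_j|=2$ or $(i,j)$ is bad. For $x\in X$ and a field $R$, the Terwilliger algebra $\mathcal T=\mathcal T_R(x)$ is the $R$-subalgebra of $M_X(R)$ generated by the adjacency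 matrices $A_i$ of the $R_i$ and the diagonal matrices $E_i^*(x)=\sum_{(x,y)\in R_i}E_{yy}$ $(0\le i\le d)$. A cell datum $(I,M,C,t)$ of an $R$-algebra $A$ (Graham–Lehrer) consists of a finite poset $I$, finite sets $M(\lambda)$ $(\lambda\in I)$, an $R$-basis $C^\lambda_{P,Q}$ $(\lambda\in I;\ P,Q\in M(\lambda))$ of $A$ and an $R$-linear anti-automorphism $t$ with $t^2=1$ and $t(C^\lambda_{P,Q})=C^\lambda_{Q,P}$, such that for all $a\in A$, $\lambda\in I$ and $P\in M(\lambda)$ there are scalars $r_a(U,P)$, independent of $Q$, with $aC^\lambda_{P,Q}-\sum_U r_a(U,P)C^\lambda_{U,Q}\in\operatorname{span}_R\{C^\mu_{V,W}:\mu<\lambda\}$ for all $Q\in M(\lambda)$. A chain $0=J_0\subset J_1\subset\dots\subset J_n=A$ of two-sided ideals is a heredity chain if, for every $j$, the ideal $J=J_j/J_{j-1}$ of $B=A/J_{j-1}$ satisfies $J^2=J$, $J\,\mathrm{rad}(B)\,J=0$ and is projective as a left $B$-module; a finite-dimensional algebra with such a chain is quasi-hereditary. The basic algebra of $A$ is the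 endomorphism algebra of $P_1\oplus\dots\oplus P_n$, where $P_1,\dots,P_n$ is a complete set of pairwise non-isomorphic indecomposable finitely generated projective left $A$-modules, and endomorphisms are written on the right. **Theorem.** Let $R$ be a field, $S$ a quasi-thin association scheme of size $d$ on a finite set $X$, and $x\in X$. Then $\sim$ is an equivalence relation on $\mathcal A_2$. Let $\mathcal C_1,\dots,\mathcal C_r$ $(r\ge 0)$ be its classes, in any order, and put $\mathcal C_0=\{0,1,\dots,d\}$. (1) $\mathcal T$ has a cell datum $(I,M,C,t)$ in which $t$ is the matrix transpose, $I=\{0,1,\dots,r\}$ is ordered so that its only strict relations are $0<\ell$ for $1\le\ell\le r$, and $M(\ell)=\mathcal C_\ell$; moreover its cell chain $0=J_0\subset J_1\subset\dots\subset J_{r+1}=\mathcal T$, where $J_i$ is the $R$-span of all $C^\ell_{p,q}$ with $\ell<i$ as integers, is a heredity chain. In particular $\mathcal T$ is cellular with respect to the transpose and quasi-hereditary. (2) If $R$ has characteristic $2$, the basic algebra of $\mathcal T$ is isomorphic to the $R$-algebra $\Lambda$ given by the quiver with vertices $0,1,\dots,r$ and arrows $\alpha_i:i\to 0$, $\beta_i:0\to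 i$ $(1\le i\le r)$, with relations $\alpha_i\beta_i=0$ $(1\le i\le r)$, where paths are composed from right to left; this is the dual extension of the star with $r$ arrows pointing to its centre $0$. Moreover $\Lambda$ and $\mathcal T$ have global dimension at most $2$. -/

import Mathlib

open scoped Matrix

universe u v w

noncomputable section

/-! ## Association schemes -/

/-- An association scheme of size `d` on `X`: a partition of `X × X` into nonempty parts
`rel 0, …, rel d`, where `rel 0` is the diagonal, the set of parts is closed under transposition,
and the number of `z` with `(x, z) ∈ rel i`, `(z, y) ∈ rel j` depends only on `i`, `j` and on the
part containing `(x, y)`. -/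
structure AssociationScheme (X : Type u) where
  d : ℕ
  rel : Fin (d + 1) → X → X → Prop
  nonempty : ∀ i, ∃ x y, rel i x y
  partition : ∀ x y, ∃! i, rel i x y
  diag : ∀ x y, rel 0 x y ↔ x = y
  symm : ∀ i, ∃ i', ∀ x y, rel i' x y ↔ rel i y x
  regular : ∀ i j l x y u v, rel l x y → rel l u v →
    {z | rel i x z ∧ rel j z y}.ncard = {w | rel i u w ∧ rel j w v}.ncard

namespace AssociationScheme

variable {X : Type u} (S : AssociationScheme X)

/-- The index `i'` of the transposed relation. -/
def inv (i : Fin (S.d + 1)) : Fin (S.d + 1) := (S.symm i).choose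

theorem rel_inv (i : Fin (S.d + 1)) (x y : X) : S.rel (S.inv i) x y ↔ S.rel i y x :=
  (S.symm i).choose_spec x y

/-- The intersection number `p_{ij}^l`, computed at one pair of `rel l`. -/
def interNum (i j l : Fin (S.d + 1)) : ℕ :=
  {z | S.rel i (S.nonempty l).choose z ∧
    S.rel j z (S.nonempty l).choose_spec.choose}.ncard

/-- The intersection number may be computed at any pair of `rel l`. -/
theorem interNum_eq (i j : Fin (S.d + 1)) {l : Fin (S.d + 1)} {x y : X} (h : S.rel l x y) :
    S.interNum i j l = {z | S.rel i x z ∧ S.rel j z y}.ncard :=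
  S.regular i j l _ _ x y (S.nonempty l).choose_spec.choose_spec h

/-- The valency `k_i = p_{ii'}^0`. -/
def valency (i : Fin (S.d + 1)) : ℕ := S.interNum i (S.inv i) 0

/-- All valencies are at most two. -/
def IsQuasiThin : Prop := ∀ i, S.valency i ≤ 2

/-- The complex product `R_i R_j`, as a set of indices of relations. -/
def complexProduct (i j : Fin (S.d + 1)) : Set (Fin (S.d + 1)) := {l | 0 < S.interNum i j l}

/-- `(a, b)` is a bad pair: there are `i_0, …, i_n`, `j_0, …, j_n`, `l_0, …, l_n` with `i_0 = a`,
`l_n = b`, `k_{i_m} = k_{l_m} = 2` and `p_{i_m j_m}^{l_m} = 1` for `m ≤ n`, `l_m = i_{m+1}` for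
`m < n`, and `|R_{a'} R_b| = 1`. -/
def IsBadPair (a b : Fin (S.d + 1)) : Prop :=
  ∃ (n : ℕ) (i j l : ℕ → Fin (S.d + 1)),
    i 0 = a ∧ l n = b ∧
    (∀ m ≤ n, S.valency (i m) = 2 ∧ S.valency (l m) = 2 ∧ S.interNum (i m) (j m) (l m) = 1) ∧
    (S.complexProduct (S.inv a) b).ncard = 1 ∧
    ∀ m < n, l m = i (m + 1)

open Classical in
/-- The set of indices of relations of valency two. -/
def valencyTwo : Finset (Fin (S.d + 1)) := Finset.univ.filter fun i => S.valency i = 2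

/-- The relation `∼` on the indices of valency two: `i ∼ j` if `|R_{i'} R_j| = 2` or `(i, j)` is a
bad pair. -/
def Sim (i j : S.valencyTwo) : Prop :=
  (S.complexProduct (S.inv i) j).ncard = 2 ∨ S.IsBadPair i j

open Classical in
/-- The set of `∼`-classes. -/
def simClasses : Finset (Finset (Fin (S.d + 1))) :=
  Finset.univ.image fun i : S.valencyTwo =>
    (Finset.univ.filter fun j : S.valencyTwo => S.Sim i j).map (Function.Embedding.subtype _)

/-! ## Terwilliger algebras -/

section Terwilliger

variable (R : Type v) [CommRing R]

open Classical in
/-- The adjacency matrix `A_i`. -/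
def adjMatrix (i : Fin (S.d + 1)) : Matrix X X R :=
  Matrix.of fun y z => if S.rel i y z then 1 else 0

open Classical in
/-- The dual idempotent `E_i^*(x)`, the sum of the matrix units `E_{yy}` with `(x, y) ∈ rel i`. -/
def dualIdempotent (x : X) (i : Fin (S.d + 1)) : Matrix X X R :=
  Matrix.of fun y z => if y = z ∧ S.rel i x y then 1 else 0

variable [Fintype X] [DecidableEq X]

/-- The Terwilliger algebra of `S` with respect to `x`. -/
def terwilligerAlgebra (x : X) : Subalgebra R (Matrix X X R) :=
  Algebra.adjoin R (Set.range (S.adjMatrix R) ∪ Set.range (S.dualIdempotent R x))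

theorem transpose_mem_terwilligerAlgebra (x : X) {a : Matrix X X R}
    (ha : a ∈ S.terwilligerAlgebra R x) : aᵀ ∈ S.terwilligerAlgebra R x := by
  induction ha using Algebra.adjoin_induction with
  | mem a ha =>
    apply Algebra.subset_adjoin
    rcases ha with ⟨i, rfl⟩ | ⟨i, rfl⟩
    · refine Or.inl ⟨S.inv i, ?_⟩
      ext y z
      have h := S.rel_inv i y z
      simp only [adjMatrix, Matrix.of_apply, Matrix.transpose_apply]
      grind
    · refine Or.inr ⟨i, ?_⟩
      ext y z
      simp only [dualIdempotent, Matrix.of_apply, Matrix.transpose_apply]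
      grind
  | algebraMap r =>
    rw [Matrix.algebraMap_eq_diagonal, Matrix.diagonal_transpose]
    rw [← Matrix.algebraMap_eq_diagonal]
    exact Subalgebra.algebraMap_mem _ r
  | add a b _ _ ha hb => rw [Matrix.transpose_add]; exact add_mem ha hb
  | mul a b _ _ ha hb => rw [Matrix.transpose_mul]; exact mul_mem hb ha

/-- Matrix transposition on the Terwilliger algebra. -/
def terwilligerTranspose (x : X) : S.terwilligerAlgebra R x →ₗ[R] S.terwilligerAlgebra R x where
  toFun a := ⟨(a : Matrix X X R)ᵀ, S.transpose_mem_terwilligerAlgebra R x a.2⟩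
  map_add' _ _ := rfl
  map_smul' _ _ := rfl

end Terwilliger

end AssociationScheme

/-! ## Cellular and quasi-hereditary algebras -/

/-- `(I, M, C, t)` is a cell datum of the `R`-algebra `A`, in the sense of Graham and Lehrer. -/
structure IsCellDatum (R : Type u) {A : Type v} [CommRing R] [Ring A] [Algebra R A]
    {I : Type*} [Finite I] [PartialOrder I] {M : I → Type*} [∀ l, Fintype (M l)]
    (C : ∀ l, M l → M l → A) (t : A →ₗ[R] A) : Prop where
  linearIndependent : LinearIndependent R fun s : Σ l, M l × M l => C s.1 s.2.1 s.2.2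
  span_eq_top :
    Submodule.span R (Set.range fun s : Σ l, M l × M l => C s.1 s.2.1 s.2.2) = ⊤
  map_mul : ∀ a b, t (a * b) = t b * t a
  involutive : ∀ a, t (t a) = a
  map_basis : ∀ l p q, t (C l p q) = C l q p
  mul_basis : ∀ (a : A) (l : I) (p : M l), ∃ c : M l → R, ∀ q : M l,
    a * C l p q - ∑ s, c s • C l s q ∈
      Submodule.span R {b | ∃ m < l, ∃ p' q' : M m, b = C m p' q'}

/-- A two-sided ideal `J` with `J² = J`, `J rad(A) J = 0` and `J` projective as a left module. -/
structure IsHeredityIdeal {A : Type v} [Ring A] (J : Ideal A) : Prop where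
  isTwoSided : J.IsTwoSided
  idempotent : J * J = J
  mul_radical_mul : J * Ring.jacobson A * J = ⊥
  projective : Module.Projective A J

/-- `0 = J_0 ⊂ J_1 ⊂ … ⊂ J_n = A` is a heredity chain of two-sided ideals of `A`. -/
structure IsHeredityChain {A : Type v} [Ring A] {n : ℕ} (J : Fin (n + 1) → Ideal A) : Prop where
  isTwoSided : ∀ i, (J i).IsTwoSided
  zero : J 0 = ⊥
  last : J (Fin.last n) = ⊤
  strictMono : StrictMono J
  heredity : ∀ i : Fin n,
    haveI := isTwoSided i.castSucc
    IsHeredityIdeal ((J i.succ).map (Ideal.Quotient.mk (J i.castSucc)))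

/-- A quasi-hereditary algebra, in the sense of Cline, Parshall and Scott. -/
def IsQuasiHereditary (R : Type u) (A : Type v) [Field R] [Ring A] [Algebra R A] : Prop :=
  Module.Finite R A ∧ ∃ (n : ℕ) (J : Fin (n + 1) → Ideal A), IsHeredityChain J

/-- The poset `{0} ∪ κ` whose only strict relations are `0 < k` for `k : κ`; here `0` is `none`. -/
def StarPoset (κ : Type u) : Type u := Option κ

instance (κ : Type u) [Finite κ] : Finite (StarPoset κ) := inferInstanceAs (Finite (Option κ))

instance (κ : Type u) : PartialOrder (StarPoset κ) where
  le a b := a = (none : Option κ) ∨ a = b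
  le_refl _ := Or.inr rfl
  le_trans a b c := by rintro (h | rfl) h'; exacts [Or.inl h, h']
  le_antisymm a b := by
    rintro (h | h) (h' | h')
    exacts [h.trans h'.symm, h'.symm, h, h]

/-- The position of an element in the enumeration `0, 1, …, r` of the star poset. -/
def StarPoset.pos {r : ℕ} (a : StarPoset (Fin r)) : Fin (r + 1) :=
  Option.elim a 0 Fin.succ

namespace AssociationScheme

/-- For an enumeration `C_1, …, C_r` of the `∼`-classes: `C_0` is the set of all indices of
relations, and `C_l` is the `l`-th class. -/
def cells {X : Type u} (S : AssociationScheme X) {r : ℕ} (e : Fin r ≃ S.simClasses)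
    (l : StarPoset (Fin r)) : Finset (Fin (S.d + 1)) :=
  Option.elim l Finset.univ fun k => (e k : Finset (Fin (S.d + 1)))

end AssociationScheme

/-! ## Basic algebras and global dimension -/

/-- A nonzero module that is not a direct sum of two nonzero submodules. -/
def IsIndecomposableModule (A : Type v) (P : Type w) [Ring A] [AddCommGroup P] [Module A P] :
    Prop :=
  Nontrivial P ∧ ∀ N N' : Submodule A P, IsCompl N N' → N = ⊥ ∨ N' = ⊥

/-- `P_1, …, P_n` is a complete set of pairwise non-isomorphic indecomposable (finitely generated)
projective `A`-modules. -/
structure IsCompleteProjectiveFamily (A : Type v) [Ring A] {n : ℕ} (P : Fin n → Type v)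
    [∀ i, AddCommGroup (P i)] [∀ i, Module A (P i)] : Prop where
  finite : ∀ i, Module.Finite A (P i)
  projective : ∀ i, Module.Projective A (P i)
  indecomposable : ∀ i, IsIndecomposableModule A (P i)
  not_iso : ∀ i j, i ≠ j → IsEmpty (P i ≃ₗ[A] P j)
  complete : ∀ (Q : Type v) [AddCommGroup Q] [Module A Q], Module.Finite A Q →
    Module.Projective A Q → IsIndecomposableModule A Q → ∃ i, Nonempty (Q ≃ₗ[A] P i)

/-- `Γ` is (isomorphic to) the basic algebra of `A`: the endomorphism algebra of the direct sum of
a complete set of non-isomorphic indecomposable projective left `A`-modules. Endomorphisms are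
written on the right of their arguments, whence the opposite of `Module.End`. -/
def IsBasicAlgebra (R : Type u) (A : Type v) (Γ : Type w) [Field R] [Ring A] [Algebra R A]
    [Ring Γ] [Algebra R Γ] : Prop :=
  ∃ (n : ℕ) (P : Fin n → Type v) (_ : ∀ i, AddCommGroup (P i)) (_ : ∀ i, Module R (P i))
    (_ : ∀ i, Module A (P i)) (_ : ∀ i, IsScalarTower R A (P i)),
    IsCompleteProjectiveFamily A P ∧
      Nonempty (Γ ≃ₐ[R] (Module.End A (∀ i, P i))ᵐᵒᵖ)

/-- The (left) global dimension: the supremum of the projective dimensions of all left modules. -/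
def globalDimension (A : Type v) [Ring A] : WithBot ℕ∞ :=
  ⨆ M : ModuleCat.{v} A, CategoryTheory.projectiveDimension M

/-! ## Quivers with relations and dual extensions -/

section Quiver

variable (R : Type u) [CommRing R] {V E : Type} [Fintype V] (src tgt : E → V)

/-- The relations that present the path algebra of the quiver with vertices `V`, arrows `E`,
sources `src` and targets `tgt` (products of arrows are composed from right to left), together with
the relations `a * b = 0` for `ρ a b`. -/
inductive PathAlgebraRel (ρ : E → E → Prop) :
    FreeAlgebra R (V ⊕ E) → FreeAlgebra R (V ⊕ E) → Prop
  | idem (x : V) : PathAlgebraRel ρ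
      (FreeAlgebra.ι R (Sum.inl x) * FreeAlgebra.ι R (Sum.inl x)) (FreeAlgebra.ι R (Sum.inl x))
  | orth (x y : V) (h : x ≠ y) : PathAlgebraRel ρ
      (FreeAlgebra.ι R (Sum.inl x) * FreeAlgebra.ι R (Sum.inl y)) 0
  | sum : PathAlgebraRel ρ (∑ x : V, FreeAlgebra.ι R (Sum.inl x)) 1
  | target (a : E) : PathAlgebraRel ρ
      (FreeAlgebra.ι R (Sum.inl (tgt a)) * FreeAlgebra.ι R (Sum.inr a)) (FreeAlgebra.ι R (Sum.inr a))
  | source (a : E) : PathAlgebraRel ρ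
      (FreeAlgebra.ι R (Sum.inr a) * FreeAlgebra.ι R (Sum.inl (src a))) (FreeAlgebra.ι R (Sum.inr a))
  | zero (a b : E) (h : ρ a b) : PathAlgebraRel ρ
      (FreeAlgebra.ι R (Sum.inr a) * FreeAlgebra.ι R (Sum.inr b)) 0

/-- The `R`-algebra given by a quiver and the relations `a * b = 0` for `ρ a b`. -/
abbrev BoundPathAlgebra (ρ : E → E → Prop) : Type u := RingQuot (PathAlgebraRel R src tgt ρ)

/-- The zero relations of a dual extension: going along an opposite arrow `b'` and then along an
original arrow `a` starting at the end point of `b'` gives zero. -/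
inductive DualExtensionRel : E ⊕ E → E ⊕ E → Prop
  | mk (a b : E) (h : src a = src b) : DualExtensionRel (Sum.inl a) (Sum.inr b)

/-- The dual extension of the path algebra of a quiver: for each arrow `a : i → j` an opposite
arrow `a' : j → i` is added, and the paths that consist of an opposite arrow followed by an
original arrow are zero. -/
abbrev DualExtension : Type u :=
  BoundPathAlgebra R (Sum.elim src tgt) (Sum.elim tgt src) (DualExtensionRel src)

/-- The dual extension of the star with centre `none` and `r` arrows `α_i : some i → none`. With
`β_i` the arrow opposite to `α_i`, the zero relations are `α_i β_i = 0`. -/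
abbrev StarDualExtension (r : ℕ) : Type u :=
  DualExtension R (V := Option (Fin r)) (E := Fin r) some fun _ => none

end Quiver

end

noncomputable section

/-! ## Heredity ideals -/

/-! Seen from `x`, the set `X` splits into the sets `xR_i`, each with one or two points. Matrices
over `X` therefore split into blocks with at most two rows and two columns. Regularity forces the
colours of a 2 × 2 block into the pattern `[[a, b], [b, a]]` (`color_snd_snd_and`). If `a = b`, the
block contributes only its all-one matrix `J_ij`. If `a ≠ b` (`Split`), it also contributes the
diagonal `D_ij`, and the swap is `J_ij - D_ij`, so no compatible labelling of the points is needed.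
Products of such `D`'s are again `D`'s, so `D_ij` lies in `𝒯` whenever `i` and `j` are joined by a
chain of split blocks (`Link`). The condition `|R_{i'}R_j| = 2` says that the block is split, and
bad pairs are the linked pairs whose block is not split. Hence `∼` is the transitive closure of
`Split` (`sim_iff_link`).

The `J_ij` and the `D_ij` with `i ∼ j` form a basis of `𝒯`, with `J_ij J_jl = k_j J_il`, `J D = J`,
`D J = J`, `D D = D` for matching inner indices, and zero otherwise (`starBasis`). This is a cell
basis: the `J`'s span the bottom cell, and modulo them each class spans a full matrix algebra. Since
`k_0 = 1`, the element `J_00` is an idempotent that generates the bottom ideal, so the cell chain is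
a heredity chain over every field (`IsCellDatum.isHeredityChain`). The first ideal is `AeA` with `e
= J_00` and `eAe = Re`, it is projective, and the quotient by it is semisimple. This gives global
dimension at most two (`IsHeredityFamily.globalDimension_le`).

In characteristic two, `k_j = 0` for indices of valency two. The corner at such an index is then
`R[f]/(f²)`, and representatives of the classes together with `0` give the indecomposable
projectives. With `ε` the sum of their idempotents, `ε𝒯ε` is spanned by the paths of the quiver:
`α_k` is `J_{0,b_k}`, `β_k` is `J_{b_k,0}`, and `α_k β_k = 2 J_00 = 0` (`StarBasis.isBasicAlgebra`).
-/

theorem IsIdempotentElem.eq_zero_of_mem_jacobson {A : Type*} [Ring A] {e : A}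
    (he : e * e = e) (h : e ∈ Ring.jacobson A) : e = 0 := by
  rw [← Ideal.jacobson_bot] at h
  obtain ⟨z, hz⟩ := Ideal.mem_jacobson_iff.1 h (-1)
  rw [Ideal.mem_bot] at hz
  have h1 : z * (1 - e) = 1 := by
    rw [← sub_eq_zero, ← hz]; noncomm_ring
  calc e = z * (1 - e) * e := by rw [h1, one_mul]
    _ = 0 := by rw [mul_assoc, sub_mul, one_mul, he, sub_self, mul_zero]

/-- A family `c p q` that spans a cell ideal whose form is not zero: the multiplication by `a` on
the left acts on the first index, on the right on the second index, and `c o o` is an idempotent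
through which the family factors. -/
structure IsHeredityFamily (R : Type*) {A M : Type*} [Field R] [Ring A] [Algebra R A] [Fintype M]
    (c : M → M → A) (o : M) : Prop where
  linearIndependent : LinearIndependent R fun s : M × M => c s.1 s.2
  mul_left : ∀ a p, ∃ r : M → R, ∀ q, a * c p q = ∑ s, r s • c s q
  mul_right : ∀ a q, ∃ r : M → R, ∀ p, c p q * a = ∑ s, r s • c p s
  mul_base : ∀ p q, c p o * c o q = c p q
  base_mul : ∀ p q, ∃ r : R, c o p * c q o = r • c o o

namespace IsHeredityFamily

variable {R : Type*} {A M : Type*} [Field R] [Ring A] [Algebra R A] [Fintype M]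
  {c : M → M → A} {o : M} (hc : IsHeredityFamily R c o) {J : Ideal A}
  (hJ : ∀ a, a ∈ J ↔ a ∈ Submodule.span R (Set.range fun s : M × M => c s.1 s.2))

include hc

/-- With `e = c o o` this says `eAe = Re`. The radical condition and the computation of kernels in
the bound on the global dimension both rest on it. -/
theorem base_mul_base (a : A) : ∃ r : R, c o o * a * c o o = r • c o o := by
  obtain ⟨r, hr⟩ := hc.mul_right a o
  choose t ht using fun s => hc.base_mul s o
  refine ⟨∑ s, r s * t s, ?_⟩
  simp only [hr, Finset.sum_mul, smul_mul_assoc, ht, Finset.sum_smul, smul_smul]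

/-- One scalar, the value of the bilinear form of the cell, governs both products, because every
member of the family factors through `c o o`. -/
theorem mul_mul (p q p' q' : M) (a : A) :
    ∃ r : R, c o q * a * c p' o = r • c o o ∧ c p q * a * c p' q' = r • c p q' := by
  obtain ⟨r, hr⟩ := hc.base_mul_base (c o q * a * c p' o)
  have h1 : c o q * a * c p' o = r • c o o := by
    rw [← hr]
    rw [show c o o * (c o q * a * c p' o) * c o o = (c o o * c o q) * a * (c p' o * c o o) by
      noncomm_ring]
    rw [hc.mul_base, hc.mul_base]
  refine ⟨r, h1, ?_⟩
  rw [← hc.mul_base p q, ← hc.mul_base p' q']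
  rw [show c p o * c o q * a * (c p' o * c o q') = c p o * (c o q * a * c p' o) * c o q' by
    noncomm_ring]
  rw [h1, mul_smul_comm, smul_mul_assoc, hc.mul_base, hc.mul_base]

include hJ

theorem mem (p q : M) : c p q ∈ J := (hJ _).2 (Submodule.subset_span ⟨(p, q), rfl⟩)

theorem le_of_mem {N : Submodule R A} (h : ∀ p q, c p q ∈ N) {a : A} (ha : a ∈ J) : a ∈ N :=
  (Submodule.span_le (p := N)).2 (by rintro _ ⟨s, rfl⟩; exact h _ _) ((hJ a).1 ha)

/-- The factorisation `c p q = c p o * c o o * c o q` exhibits `J` as `AeA` with `e = c o o`, so it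
suffices to control the action of `e`. -/
theorem smul_mem {N : Type*} [AddCommGroup N] [Module A N] {N' : Submodule A N}
    (h : ∀ n, c o o • n ∈ N') {a : A} (ha : a ∈ J) (n : N) : a • n ∈ N' := by
  refine hc.le_of_mem hJ (N := (N'.comap (LinearMap.toSpanSingleton A N n)).restrictScalars R)
    (fun p q => ?_) ha
  change c p q • n ∈ N'
  rw [← hc.mul_base, ← hc.mul_base p o, mul_assoc, mul_smul, mul_smul]
  exact N'.smul_mem _ (h _)

theorem isTwoSided : J.IsTwoSided := by
  refine ⟨fun {a} b ha => ?_⟩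
  refine hc.le_of_mem hJ (N := (J.restrictScalars R).comap (LinearMap.mulRight R b)) ?_ ha
  intro p q
  obtain ⟨r, hr⟩ := hc.mul_right b q
  change c p q * b ∈ J
  rw [hr]
  exact Submodule.sum_mem _ fun s _ => Submodule.smul_of_tower_mem _ _ (hc.mem hJ _ _)

/-- The columns of the family are isomorphic left modules. Sending `c p q` to `c p o` in coordinate
`q` embeds `J` in the free module `A^M`, and multiplying coordinate `q` by `c o q` on the right is a
retraction. -/
theorem projective : Module.Projective A J := by
  classical
  let v : M × M → J := fun s => ⟨c s.1 s.2, hc.mem hJ _ _⟩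
  have hv : LinearIndependent R v :=
    LinearIndependent.of_comp (J.subtype.restrictScalars R) hc.linearIndependent
  have hv' : ⊤ ≤ Submodule.span R (Set.range v) := by
    rintro ⟨a, ha⟩ -
    have h1 : Submodule.map (J.subtype.restrictScalars R) (Submodule.span R (Set.range v)) =
        Submodule.span R (Set.range fun s : M × M => c s.1 s.2) := by
      rw [Submodule.map_span, ← Set.range_comp]; rfl
    have h2 := (hJ a).1 ha
    rw [← h1] at h2
    obtain ⟨y, hy, hya⟩ := h2
    have : y = ⟨a, ha⟩ := Subtype.ext hya
    exact this ▸ hy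
  let b := Module.Basis.mk hv hv'
  have hb : ∀ s, b s = v s := fun s => by simp [b]
  let f0 : J →ₗ[R] (M → A) := b.constr R fun s => Pi.single s.2 (c s.1 o)
  have hf0 : ∀ s, f0 (v s) = Pi.single s.2 (c s.1 o) := fun s => by
    rw [← hb]; exact b.constr_basis _ _ _
  have hlin : ∀ (a : A) (y : J), f0 (a • y) = a • f0 y := by
    intro a
    have : f0 ∘ₗ (Algebra.lsmul R R J a) = (Algebra.lsmul R R (M → A) a) ∘ₗ f0 := by
      refine b.ext fun s => ?_
      obtain ⟨r, hr⟩ := hc.mul_left a s.1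
      have h1 : a • v s = ∑ t, r t • v (t, s.2) := by
        apply Subtype.ext
        simp only [Submodule.coe_smul, smul_eq_mul, AddSubmonoidClass.coe_finsetSum,
          Submodule.coe_smul_of_tower, v]
        exact hr s.2
      simp only [LinearMap.comp_apply, Algebra.lsmul_coe, hb, h1, map_sum, map_smul, hf0]
      ext t
      simp only [Finset.sum_apply, Pi.smul_apply, smul_eq_mul]
      by_cases ht : t = s.2
      · subst ht; simp [hr]
      · simp [Pi.single_eq_of_ne ht]
    exact fun y => LinearMap.congr_fun this y
  let f : J →ₗ[A] (M → A) := { f0 with map_smul' := hlin }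
  let g : (M → A) →ₗ[A] J := Fintype.linearCombination A fun q => v (o, q)
  refine Module.Projective.of_split f g ?_
  have : (g ∘ₗ f).restrictScalars R = LinearMap.id := by
    refine b.ext fun s => ?_
    change g (f0 (b s)) = b s
    rw [hb, hf0]
    simp only [g, Fintype.linearCombination_apply_single]
    exact Subtype.ext (hc.mul_base _ _)
  exact LinearMap.ext fun y => LinearMap.congr_fun this y

theorem isHeredityIdeal : IsHeredityIdeal J where
  isTwoSided := hc.isTwoSided hJ
  projective := hc.projective hJ
  idempotent := by
    refine le_antisymm Ideal.mul_le_right fun a ha => ?_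
    refine hc.le_of_mem hJ (N := (J * J).restrictScalars R) (fun p q => ?_) ha
    rw [← hc.mul_base]
    exact Ideal.mul_mem_mul (hc.mem hJ _ _) (hc.mem hJ _ _)
  mul_radical_mul := by
    rw [eq_bot_iff, Ideal.mul_le]
    intro y hy b hb
    rw [Ideal.mem_bot]
    have key : ∀ a ∈ Ring.jacobson A, ∀ x ∈ J, x * a * b = 0 := by
      intro a ha x hx
      have h1 : ∀ p q, c p q * a * b = 0 := by
        intro p q
        refine hc.le_of_mem hJ (N := LinearMap.ker (LinearMap.mulLeft R (c p q * a)))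
          (fun p' q' => ?_) hb
        rw [LinearMap.mem_ker, LinearMap.mulLeft_apply]
        obtain ⟨r, hr, hr'⟩ := hc.mul_mul p q p' q' a
        rw [hr']
        -- If `r ≠ 0`, the idempotent `c o o` would lie in the radical and hence vanish, and the
        -- whole family with it.
        by_cases h0 : r = 0
        · rw [h0, zero_smul]
        have h2 : c o q * a * c p' o ∈ Ring.jacobson A :=
          Ideal.mul_mem_right _ _ (Ideal.mul_mem_left _ _ ha)
        rw [hr] at h2
        have h3 : c o o ∈ Ring.jacobson A := by
          simpa [smul_smul, inv_mul_cancel₀ h0] using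
            Submodule.smul_of_tower_mem (Ring.jacobson A) r⁻¹ h2
        have h4 := IsIdempotentElem.eq_zero_of_mem_jacobson (hc.mul_base o o) h3
        rw [← hc.mul_base p q', ← hc.mul_base p o, h4, mul_zero, zero_mul, smul_zero]
      have := hc.le_of_mem hJ
        (N := LinearMap.ker (LinearMap.mulRight R (a * b))) (fun p q => by
          rw [LinearMap.mem_ker, LinearMap.mulRight_apply, ← mul_assoc, h1]) hx
      rw [LinearMap.mem_ker, LinearMap.mulRight_apply, ← mul_assoc] at this
      exact this
    refine Submodule.smul_induction_on hy (fun x hx a ha => key a ha x hx) ?_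
    intro x y hx hy
    rw [add_mul, hx, hy, add_zero]

end IsHeredityFamily

/-! ## Global dimension -/

section GlobalDimension

open CategoryTheory

variable {A : Type v} [Ring A]

theorem ModuleCat.shortExact_of {X Y Z : Type v} [AddCommGroup X] [Module A X] [AddCommGroup Y]
    [Module A Y] [AddCommGroup Z] [Module A Z] (f : X →ₗ[A] Y) (g : Y →ₗ[A] Z)
    (hf : Function.Injective f) (hg : Function.Surjective g) (hfg : Function.Exact f g) :
    (ShortComplex.moduleCatMk f g hfg.linearMap_comp_eq_zero).ShortExact where
  exact := (ShortComplex.moduleCat_exact_iff _).2 fun x hx => (hfg x).1 hx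
  mono_f := (ModuleCat.mono_iff_injective _).2 hf
  epi_g := (ModuleCat.epi_iff_surjective _).2 hg

theorem Module.Projective.finsupp {ι : Type v} {P : Type v} [AddCommGroup P] [Module A P]
    [Module.Projective A P] : Module.Projective A (ι →₀ P) := by
  classical
  exact Module.Projective.of_equiv (finsuppLequivDFinsupp A (ι := ι) (M := P)).symm

/-- A direct sum of copies of `0 → J → A → A/J → 0` is a projective resolution of length one. -/
theorem hasProjectiveDimensionLT_finsupp_quotient (J : Ideal A) [Module.Projective A J]
    (ι : Type v) : HasProjectiveDimensionLT (ModuleCat.of A (ι →₀ A ⧸ J)) 2 := by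
  classical
  have := Module.Projective.finsupp (A := A) (ι := ι) (P := J)
  have h := ModuleCat.shortExact_of (Finsupp.mapRange.linearMap (α := ι) J.subtype)
    (Finsupp.mapRange.linearMap (α := ι) J.mkQ)
    (Finsupp.mapRange_injective _ (map_zero _) Subtype.val_injective)
    (Finsupp.mapRange_surjective _ (map_zero _) J.mkQ_surjective) (by
      intro y
      constructor
      · intro hy
        have hy' : ∀ i, y i ∈ J := fun i => by
          have := DFunLike.congr_fun hy i
          simpa using this
        refine ⟨y.mapRange (fun a => if h : a ∈ J then ⟨a, h⟩ else 0) (by simp), ?_⟩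
        ext i
        simp [hy']
      · rintro ⟨y, rfl⟩
        ext i
        simp)
  refine h.hasProjectiveDimensionLT_X₃ 1 ?_ ?_
  · change HasProjectiveDimensionLT (ModuleCat.of A (ι →₀ J)) 1
    infer_instance
  · change HasProjectiveDimensionLT (ModuleCat.of A (ι →₀ A)) 2
    infer_instance

/-- A module killed by `J` is a module over the semisimple ring `A/J`, hence a direct summand of a
free `A/J`-module. -/
theorem hasProjectiveDimensionLT_of_isTorsionBySet (J : Ideal A) [J.IsTwoSided]
    [Module.Projective A J] [IsSemisimpleRing (A ⧸ J)] (N : Type v) [AddCommGroup N] [Module A N]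
    (hN : Module.IsTorsionBySet A N J) : HasProjectiveDimensionLT (ModuleCat.of A N) 2 := by
  let := hN.module
  have : IsScalarTower A (A ⧸ J) N := hN.isScalarTower
  have : Module.Projective (A ⧸ J) N := Module.projective_of_isSemisimpleRing _ _
  obtain ⟨s, hs⟩ := Module.projective_def'.1 this
  have := hasProjectiveDimensionLT_finsupp_quotient J N
  let ret : Retract (ModuleCat.of A N) (ModuleCat.of A (N →₀ A ⧸ J)) :=
    { i := ModuleCat.ofHom (s.restrictScalars A)
      r := ModuleCat.ofHom ((Finsupp.linearCombination (A ⧸ J) id).restrictScalars A)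
      retract := by
        ext y
        exact LinearMap.congr_fun hs y }
  exact ret.hasProjectiveDimensionLT 2

end GlobalDimension

-- Any module `N` is compared with the projective module `Ae ⊗ eN`, where `e = c o o`. Because `eAe
-- = Re`, the comparison map is an isomorphism after multiplication by `e`, so its kernel and
-- cokernel are killed by `J = AeA` and have projective dimension at most one.
open CategoryTheory in
theorem IsHeredityFamily.globalDimension_le {R : Type*} {A : Type v} {M : Type*} [Field R] [Ring A]
    [Algebra R A] [Fintype M] {c : M → M → A} {o : M} (hc : IsHeredityFamily R c o) {J : Ideal A}
    (hJ : ∀ a, a ∈ J ↔ a ∈ Submodule.span R (Set.range fun s : M × M => c s.1 s.2))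
    [J.IsTwoSided] [IsSemisimpleRing (A ⧸ J)] : globalDimension A ≤ 2 := by
  have := hc.projective hJ
  refine iSup_le fun N => (projectiveDimension_le_iff N 2).2 ?_
  let : Module R N := Module.compHom N (algebraMap R A)
  have : IsScalarTower R A N := ⟨fun r a n => by
    rw [Algebra.smul_def, mul_smul]; rfl⟩
  set e := c o o with he
  have hee : e * e = e := hc.mul_base o o
  -- the left ideal generated by `e`
  let P : Ideal A := Ideal.span {e}
  have hPe : ∀ y ∈ P, y * e = y := by
    intro y hy
    obtain ⟨z, rfl⟩ := Ideal.mem_span_singleton'.1 hy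
    rw [mul_assoc, hee]
  have heP : e ∈ P := Ideal.subset_span rfl
  have hP : Module.Projective A P := by
    refine Module.Projective.of_split P.subtype
      ((LinearMap.toSpanSingleton A A e).codRestrict P fun a => P.mul_mem_left a heP) ?_
    ext y
    exact hPe y y.2
  let W : Submodule R N := LinearMap.range (Algebra.lsmul R R N e)
  have hW : ∀ y ∈ W, e • y = y := by
    rintro _ ⟨y, rfl⟩
    simp [smul_smul, hee]
  let b := Module.Basis.ofVectorSpace R W
  let ι := Module.Basis.ofVectorSpaceIndex R W
  have := Module.Projective.finsupp (A := A) (ι := ι) (P := P)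
  -- One copy of `Ae` for each vector of an `R`-basis of `eN`, its generator being sent to that
  -- vector.
  let g : (ι →₀ P) →ₗ[A] N := Finsupp.lsum ℕ fun i =>
    (LinearMap.toSpanSingleton A N (b i : N)) ∘ₗ P.subtype
  have hg : ∀ i y, g (Finsupp.single i y) = (y : A) • (b i : N) := by
    intro i y; simp [g]
  -- the kernel and the cokernel of `g` are annihilated by `J`
  have hker : HasProjectiveDimensionLT (ModuleCat.of A (LinearMap.ker g)) 2 := by
    refine hasProjectiveDimensionLT_of_isTorsionBySet J _ ?_
    -- Every component of `e • y` is a multiple `t i • e`. The map `g` sends `e • y` to the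
    -- combination of the basis vectors with coefficients `t i`, which must then vanish.
    have h0 : ∀ y ∈ LinearMap.ker g, e • y = 0 := by
      intro y hy
      choose t ht using fun i => hc.base_mul_base (y i : A)
      have h1 : ∀ i, e * (y i : A) = t i • e := fun i => by
        rw [← ht, mul_assoc, ← he, hPe _ (y i).2]
      have h2 : g (e • y) = 0 := by rw [map_smul, LinearMap.mem_ker.1 hy, smul_zero]
      have h3 : e • y = ∑ i ∈ y.support, Finsupp.single i (t i • (⟨e, heP⟩ : P)) := by
        conv_lhs => rw [← Finsupp.sum_single y]
        rw [Finsupp.smul_sum]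
        refine Finset.sum_congr rfl fun i _ => ?_
        simp only
        rw [Finsupp.smul_single]
        congr 1
        exact Subtype.ext (h1 i)
      rw [h3, map_sum] at h2
      have h4 : ∑ i ∈ y.support, t i • b i = 0 := by
        apply Subtype.ext
        rw [← Submodule.subtype_apply, map_sum, Submodule.coe_zero, ← h2]
        refine Finset.sum_congr rfl fun i _ => ?_
        rw [hg, map_smul]
        change t i • (b i : N) = (t i • e) • (b i : N)
        rw [smul_assoc, hW _ (b i).2]
      have h5 := linearIndependent_iff'.1 b.linearIndependent y.support t h4
      rw [h3]
      refine Finset.sum_eq_zero fun i hi => ?_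
      rw [h5 i hi, zero_smul, Finsupp.single_zero]
    rintro y ⟨a, ha⟩
    rw [← Submodule.mem_bot A]
    exact hc.smul_mem hJ (fun z => (Submodule.mem_bot A).2 (Subtype.ext (h0 z z.2))) ha y
  have hcoker : HasProjectiveDimensionLT (ModuleCat.of A (N ⧸ LinearMap.range g)) 2 := by
    refine hasProjectiveDimensionLT_of_isTorsionBySet J _ ?_
    rintro y ⟨a, ha⟩
    obtain ⟨n, rfl⟩ := Submodule.Quotient.mk_surjective _ y
    change a • Submodule.Quotient.mk n = _
    rw [← Submodule.Quotient.mk_smul, Submodule.Quotient.mk_eq_zero]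
    refine hc.smul_mem hJ (fun n => ?_) ha n
    have h1 := b.mem_span ⟨e • n, n, rfl⟩
    have h2 : Submodule.span R (Set.range b) ≤
        ((LinearMap.range g).restrictScalars R).comap W.subtype := by
      refine Submodule.span_le.2 ?_
      rintro _ ⟨i, rfl⟩
      exact ⟨Finsupp.single i ⟨e, heP⟩, (hg _ _).trans (hW _ (b i).2)⟩
    exact h2 h1
  -- The kernel has dimension at most one, so the image, a quotient of a projective module, has
  -- dimension at most two; extending it by the cokernel does not raise this bound.
  have hrange : HasProjectiveDimensionLT (ModuleCat.of A (LinearMap.range g)) 3 :=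
    (ModuleCat.shortExact_of (LinearMap.ker g).subtype g.rangeRestrict Subtype.val_injective
      g.surjective_rangeRestrict (fun y => by
        simp [Subtype.ext_iff])).hasProjectiveDimensionLT_X₃ 2 hker
      (by change HasProjectiveDimensionLT (ModuleCat.of A (ι →₀ P)) (1 + 2); infer_instance)
  exact (ModuleCat.shortExact_of (LinearMap.range g).subtype (LinearMap.range g).mkQ
    Subtype.val_injective (LinearMap.range g).mkQ_surjective
    (LinearMap.exact_subtype_mkQ _)).hasProjectiveDimensionLT_X₂ 3 hrange
    (hasProjectiveDimensionLT_of_ge (ModuleCat.of A (N ⧸ LinearMap.range g)) 2 3 (by norm_num))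

/-! ## Projective modules generated by idempotents -/

section Idempotents

variable {A : Type v} [Ring A]

theorem mem_span_idempotent {e : A} (he : e * e = e) {y : A} :
    y ∈ Ideal.span {e} ↔ y * e = y := by
  rw [Ideal.mem_span_singleton']
  constructor
  · rintro ⟨z, rfl⟩
    rw [mul_assoc, he]
  · exact fun h => ⟨y, h⟩

theorem self_mem_span_singleton (e : A) : e ∈ Ideal.span {e} := Ideal.subset_span rfl

theorem projective_span_idempotent {e : A} (he : e * e = e) :
    Module.Projective A (Ideal.span {e}) := by
  refine Module.Projective.of_split (Ideal.span {e}).subtype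
    ((LinearMap.toSpanSingleton A A e).codRestrict _ fun a =>
      Ideal.mul_mem_left _ a (self_mem_span_singleton e)) ?_
  ext y
  exact (mem_span_idempotent he).1 y.2

theorem map_span_idempotent {e : A} (he : e * e = e) {N : Type*} [AddCommGroup N] [Module A N]
    (f : Ideal.span {e} →ₗ[A] N) (y : Ideal.span {e}) :
    f y = (y : A) • f ⟨e, self_mem_span_singleton e⟩ := by
  rw [← map_smul]
  exact congrArg f (Subtype.ext ((mem_span_idempotent he).1 y.2).symm)

/-- A decomposition of `Ae` splits `e` into two components, and the component in `N` is an
idempotent of `eAe`. By hypothesis it is `0` or `e`, so one summand contains the generator. -/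
theorem indecomposable_span_idempotent {e : A} (he : e * e = e) (h0 : e ≠ 0)
    (hloc : ∀ z, e * z * e = z → z * z = z → z = 0 ∨ z = e) :
    IsIndecomposableModule A (Ideal.span {e}) := by
  refine ⟨⟨⟨⟨e, self_mem_span_singleton e⟩, 0, fun h => h0 (congrArg Subtype.val h)⟩⟩, ?_⟩
  intro N N' hN
  obtain ⟨n, hn, n', hn', hnn⟩ := Submodule.mem_sup.1
    (hN.sup_eq_top ▸ Submodule.mem_top : (⟨e, self_mem_span_singleton e⟩ : Ideal.span {e}) ∈ N ⊔ N')
  have hsum : (n : A) + n' = e := congrArg Subtype.val hnn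
  have hne : (n : A) * e = n := (mem_span_idempotent he).1 n.2
  have uniq : ∀ y ∈ N, ∀ y' ∈ N', y + y' = 0 → y = 0 := by
    intro y hy y' hy' h
    have : y ∈ N ⊓ N' := ⟨hy, by
      rw [eq_neg_of_add_eq_zero_left h]; exact N'.neg_mem hy'⟩
    rwa [hN.inf_eq_bot, Submodule.mem_bot] at this
  have key : ∀ a : A, a • n + a • n' = a • (⟨e, self_mem_span_singleton e⟩ : Ideal.span {e}) :=
    fun a => by rw [← smul_add, hnn]
  have hen : e * (n : A) = n := by
    have := uniq (e • n - n) (N.sub_mem (N.smul_mem _ hn) hn) (e • n' - n')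
      (N'.sub_mem (N'.smul_mem _ hn') hn') (by
        have h1 : e • n + e • n' = n + n' := by
          rw [key, hnn]; exact Subtype.ext he
        rw [sub_add_sub_comm, h1, sub_self])
    exact congrArg Subtype.val (sub_eq_zero.1 this)
  have hnn' : (n : A) * n = n := by
    have := uniq ((n : A) • n - n) (N.sub_mem (N.smul_mem _ hn) hn) ((n : A) • n')
      (N'.smul_mem _ hn') (by
        have h1 : (n : A) • n + (n : A) • n' = n := by
          rw [key]; exact Subtype.ext hne
        rw [sub_add_eq_add_sub, h1, sub_self])
    exact congrArg Subtype.val (sub_eq_zero.1 this)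
  have top : ∀ K : Submodule A (Ideal.span {e}), ⟨e, self_mem_span_singleton e⟩ ∈ K → K = ⊤ :=
    fun K hK => eq_top_iff.2 fun y _ => by
      have h1 : (y : A) • (⟨e, self_mem_span_singleton e⟩ : Ideal.span {e}) = y :=
        Subtype.ext ((mem_span_idempotent he).1 y.2)
      exact h1 ▸ K.smul_mem _ hK
  rcases hloc n (by rw [hen, hne]) hnn' with h | h
  · left
    have h1 : n = 0 := Subtype.ext h
    rw [h1, zero_add] at hnn
    have h2 := hN.inf_eq_bot
    rwa [top N' (hnn ▸ hn'), inf_top_eq] at h2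
  · right
    have h1 : n = ⟨e, self_mem_span_singleton e⟩ := Subtype.ext h
    have h2 := hN.inf_eq_bot
    rwa [top N (h1 ▸ hn), top_inf_eq] at h2

/-- The hypothesis `hloc` makes the corners `e i * A * e i` local, which gives indecomposability and
lets Fitting's argument run; `hgen` says that the `e i` generate `A` as a two-sided ideal, so none
of them is missing. -/
theorem isCompleteProjectiveFamily_span_idempotent {n : ℕ} (e : Fin n → A)
    (he : ∀ i, e i * e i = e i) (h0 : ∀ i, e i ≠ 0)
    (hloc : ∀ i z, e i * z * e i = z → IsNilpotent z ∨
      ∃ z', e i * z' * e i = z' ∧ z' * z = e i ∧ z * z' = e i)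
    (hiso : ∀ i j, i ≠ j → ∀ y z, e i * y * e j = y → e j * z * e i = z → y * z = e i →
      z * y = e j → False)
    {κ : Type*} [Fintype κ] (k : κ → Fin n) (y z : κ → A)
    (hgen : ∑ p, y p * e (k p) * z p = 1) :
    IsCompleteProjectiveFamily A fun i => Ideal.span {e i} where
  finite i := inferInstance
  projective i := projective_span_idempotent (he i)
  indecomposable i := by
    refine indecomposable_span_idempotent (he i) (h0 i) fun z hz hzz => ?_
    rcases hloc i z hz with ⟨m, hm⟩ | ⟨z', hz', h1, h2⟩
    · left
      have : ∀ m, z ^ (m + 1) = z := fun m => by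
        induction m with
        | zero => simp
        | succ m ih => rw [pow_succ, ih, hzz]
      rw [← this m, pow_succ, hm, zero_mul]
    · right
      calc z = e i * z := by rw [← hz, ← mul_assoc, ← mul_assoc, he]
        _ = z' * (z * z) := by rw [← mul_assoc, h1]
        _ = e i := by rw [hzz, h1]
  not_iso i j hij := by
    refine ⟨fun f => ?_⟩
    have hi := map_span_idempotent (he i) f.toLinearMap
    have hj := map_span_idempotent (he j) f.symm.toLinearMap
    simp only [LinearEquiv.coe_coe] at hi hj
    set a := f ⟨e i, self_mem_span_singleton _⟩ with ha
    set b := f.symm ⟨e j, self_mem_span_singleton _⟩ with hb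
    have ha1 : e i * (a : A) = a := congrArg Subtype.val (hi ⟨e i, self_mem_span_singleton _⟩).symm
    have hb1 : e j * (b : A) = b := congrArg Subtype.val (hj ⟨e j, self_mem_span_singleton _⟩).symm
    have ha2 := (mem_span_idempotent (he j)).1 a.2
    have hb2 := (mem_span_idempotent (he i)).1 b.2
    refine hiso i j hij a b (by rw [ha1, ha2]) (by rw [hb1, hb2]) ?_ ?_
    · have := hj a
      rw [ha, f.symm_apply_apply] at this
      exact (congrArg Subtype.val this).symm
    · have := hi b
      rw [hb, f.apply_symm_apply] at this
      exact (congrArg Subtype.val this).symm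
  complete Q _ _ hfin hproj hind := by
    have := hind.1
    -- a simple quotient of `Q`
    obtain ⟨Q', hQ', -⟩ := (eq_top_or_exists_le_coatom (⊥ : Submodule A Q)).resolve_left bot_ne_top
    have hsimple : IsSimpleModule A (Q ⧸ Q') := isSimpleModule_iff_isCoatom.2 hQ'
    have := hsimple.nontrivial
    obtain ⟨s, hs⟩ := exists_ne (0 : Q ⧸ Q')
    -- The unit is a sum of elements `y p * e (k p) * z p`, so some idempotent of the family acts
    -- nontrivially on the simple quotient, and the corresponding `A e_i` maps onto it.
    obtain ⟨p, hp⟩ : ∃ p, e (k p) • z p • s ≠ 0 := by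
      by_contra! h
      apply hs
      rw [← one_smul A s, ← hgen, Finset.sum_smul]
      exact Finset.sum_eq_zero fun p _ => by rw [mul_smul, mul_smul, h, smul_zero]
    refine ⟨k p, ?_⟩
    set i := k p
    set x := e i • z p • s with hx
    have hex : e i • x = x := by rw [hx, smul_smul, he]
    let t : Ideal.span {e i} →ₗ[A] Q ⧸ Q' :=
      (LinearMap.toSpanSingleton A _ x) ∘ₗ (Ideal.span {e i}).subtype
    have ht : ∀ y : Ideal.span {e i}, t y = (y : A) • x := fun y => rfl
    have htsurj : Function.Surjective t := by
      refine LinearMap.surjective_of_ne_zero fun h => hp ?_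
      have := LinearMap.congr_fun h ⟨e i, self_mem_span_singleton _⟩
      rw [ht, LinearMap.zero_apply] at this
      rw [← hex]
      exact this
    have := projective_span_idempotent (he i)
    -- Both `Q` and `A e_i` are projective and map onto the same simple module, so each map lifts
    -- through the other. The composite `g ∘ h` is right multiplication by an element `a` of the
    -- corner.
    obtain ⟨g, hg⟩ := Module.projective_lifting_property t Q'.mkQ htsurj
    obtain ⟨h, hh⟩ := Module.projective_lifting_property Q'.mkQ t Q'.mkQ_surjective
    set a : A := (g (h ⟨e i, self_mem_span_singleton _⟩) : A) with ha
    have hgh := map_span_idempotent (he i) (g ∘ₗ h)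
    have ha1 : a * e i = a := (mem_span_idempotent (he i)).1 (g _).2
    have ha2 : e i * a = a :=
      congrArg Subtype.val (hgh ⟨e i, self_mem_span_singleton _⟩).symm
    have hax : a • x = x := by
      have h1 : t (g (h ⟨e i, self_mem_span_singleton _⟩)) = t ⟨e i, self_mem_span_singleton _⟩ := by
        exact (LinearMap.congr_fun hg _).trans (LinearMap.congr_fun hh _)
      rw [ht, ht, hex] at h1
      exact h1
    -- Since `a` fixes the nonzero vector `x` it is not nilpotent, hence it is invertible in the
    -- corner.
    rcases hloc i a (by rw [ha2, ha1]) with ⟨m, hm⟩ | ⟨a', ha', h1, h2⟩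
    · exfalso
      have : ∀ m : ℕ, a ^ m • x = x := fun m => by
        induction m with
        | zero => simp
        | succ m ih => rw [pow_succ, mul_smul, hax, ih]
      exact hp (by rw [← this m, hm, zero_smul])
    · -- `h` is a split monomorphism, hence an isomorphism
      let g' : Q →ₗ[A] Ideal.span {e i} :=
        ((LinearMap.toSpanSingleton A A a').codRestrict (Ideal.span {e i}) fun b =>
          (mem_span_idempotent (he i)).2 (by
            change b * a' * e i = b * a'
            rw [mul_assoc, ← ha', mul_assoc, he])) ∘ₗ (Ideal.span {e i}).subtype ∘ₗ g
      have hg'h : ∀ y, g' (h y) = y := fun y => by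
        apply Subtype.ext
        change (((g ∘ₗ h) y : Ideal.span {e i}) : A) * a' = y
        rw [hgh]
        change (y : A) * a * a' = y
        rw [mul_assoc, h2, (mem_span_idempotent (he i)).1 y.2]
      have hcompl : IsCompl (LinearMap.range h) (LinearMap.ker g') := by
        constructor
        · rw [Submodule.disjoint_def]
          rintro _ ⟨y, rfl⟩ hy
          rw [LinearMap.mem_ker, hg'h] at hy
          rw [hy, map_zero]
        · rw [Submodule.codisjoint_iff_exists_add_eq]
          intro y
          exact ⟨h (g' y), y - h (g' y), ⟨_, rfl⟩, by
            rw [LinearMap.mem_ker, map_sub, hg'h, sub_self], add_sub_cancel _ _⟩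
      have hinj : Function.Injective h := Function.LeftInverse.injective hg'h
      rcases hind.2 _ _ hcompl with h3 | h3
      · exfalso
        have := LinearMap.range_eq_bot.1 h3
        have h4 := hg'h ⟨e i, self_mem_span_singleton _⟩
        rw [this, LinearMap.zero_apply, map_zero] at h4
        exact h0 i (congrArg Subtype.val h4).symm
      · have h4 : LinearMap.range h = ⊤ := by
          have := hcompl.sup_eq_top
          rwa [h3, sup_bot_eq] at this
        exact ⟨(LinearEquiv.ofBijective h ⟨hinj, LinearMap.range_eq_top.1 h4⟩).symm⟩

end Idempotents

/-! ## The endomorphism algebra of a sum of such modules -/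

section EndomorphismAlgebra

variable (R : Type u) {A : Type v} [Field R] [Ring A] [Algebra R A] {n : ℕ} (e : Fin n → A)

/-- An endomorphism of `∏ A e_i` is determined by the element `∑ i, f(e)_i` of `A`. -/
def endToAlgebra : (Module.End A (∀ i, Ideal.span {e i}))ᵐᵒᵖ →ₗ[R] A where
  toFun f := ∑ j, (f.unop (fun i => ⟨e i, self_mem_span_singleton _⟩) j : A)
  map_add' f g := by simp [Finset.sum_add_distrib]
  map_smul' r f := by simp [Finset.smul_sum]

variable {e} (he : ∀ i, e i * e i = e i) (he' : ∀ i j, i ≠ j → e i * e j = 0)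

/-- The endomorphism of `∏ A e_i` given by right multiplication by `t`. -/
def algebraToEnd : A →ₗ[R] (Module.End A (∀ i, Ideal.span {e i}))ᵐᵒᵖ where
  toFun t := MulOpposite.op
    { toFun := fun y j => ⟨(∑ i, (y i : A)) * t * e j,
        Ideal.mul_mem_left _ _ (self_mem_span_singleton _)⟩
      map_add' := fun y y' => by
        ext j; simp [Finset.sum_add_distrib, add_mul]
      map_smul' := fun a y => by
        ext j; simp [← Finset.mul_sum, mul_assoc] }
  map_add' t t' := by
    apply MulOpposite.unop_injective
    ext y j
    simp [mul_add, add_mul]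
  map_smul' r t := by
    apply MulOpposite.unop_injective
    ext y j
    simp

include he he'

theorem sum_mul_idempotent (y : ∀ i, Ideal.span {e i}) (j : Fin n) :
    (∑ i, (y i : A)) * e j = y j := by
  rw [Finset.sum_mul, Finset.sum_eq_single j]
  · exact (mem_span_idempotent (he j)).1 (y j).2
  · intro i _ hij
    rw [← (mem_span_idempotent (he i)).1 (y i).2, mul_assoc, he' i j hij, mul_zero]
  · simp

theorem eq_sum_smul (y : ∀ i, Ideal.span {e i}) :
    y = (∑ i, (y i : A)) • fun i => (⟨e i, self_mem_span_singleton _⟩ : Ideal.span {e i}) := by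
  ext j
  exact (sum_mul_idempotent he he' y j).symm

/-- An endomorphism is right multiplication by its associated element of `A`, followed by the cut
with `e j`; hence that element determines it. -/
theorem unop_apply_eq (f : (Module.End A (∀ i, Ideal.span {e i}))ᵐᵒᵖ)
    (y : ∀ i, Ideal.span {e i}) (j : Fin n) :
    (f.unop y j : A) = (∑ i, (y i : A)) * endToAlgebra R e f * e j := by
  conv_lhs => rw [eq_sum_smul he he' y, map_smul]
  rw [mul_assoc]
  exact congrArg _ (sum_mul_idempotent he he' _ j).symm

/-- In the opposite ring `f * g` applies `f` first, which is the order of successive right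
multiplications. -/
theorem endToAlgebra_mul (f g : (Module.End A (∀ i, Ideal.span {e i}))ᵐᵒᵖ) :
    endToAlgebra R e (f * g) = endToAlgebra R e f * endToAlgebra R e g := by
  change ∑ j, (g.unop (f.unop _) j : A) = _
  rw [eq_sum_smul he he' (f.unop _), map_smul]
  exact Finset.mul_sum _ _ _ |>.symm

theorem endToAlgebra_injective : Function.Injective (endToAlgebra R e) := by
  intro f g hfg
  apply MulOpposite.unop_injective
  refine LinearMap.ext fun y => funext fun j => Subtype.ext ?_
  rw [unop_apply_eq R he he', unop_apply_eq R he he', hfg]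

/-- The image of `endToAlgebra` lies in the corner `εAε` with `ε = ∑ e i`; together with
`endToAlgebra_algebraToEnd` it is the whole corner. -/
theorem sum_mul_endToAlgebra_mul_sum (f : (Module.End A (∀ i, Ideal.span {e i}))ᵐᵒᵖ) :
    (∑ i, e i) * endToAlgebra R e f * ∑ i, e i = endToAlgebra R e f := by
  rw [Finset.mul_sum]
  exact Finset.sum_congr rfl fun j _ => (unop_apply_eq R he he' f
    (fun i => ⟨e i, self_mem_span_singleton _⟩) j).symm

omit he he' in
theorem endToAlgebra_algebraToEnd (t : A) :
    endToAlgebra R e (algebraToEnd R t) = (∑ i, e i) * t * ∑ i, e i := by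
  rw [Finset.mul_sum]
  rfl

end EndomorphismAlgebra

/-! ## The dual extension of a star -/

theorem Fintype.sum_pi_single_smul {R M ι : Type*} [Semiring R] [AddCommMonoid M] [Module R M]
    [Fintype ι] [DecidableEq ι] (i : ι) (a : R) (f : ι → M) :
    ∑ s, (Pi.single i a : ι → R) s • f s = a • f i := by
  rw [Finset.sum_eq_single i]
  · rw [Pi.single_eq_same]
  · intro s _ hs
    rw [Pi.single_eq_of_ne hs, zero_smul]
  · simp

namespace StarDualExtension

variable (R : Type u) [Field R] (r : ℕ)

/-- The defining projection of the free algebra. -/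
def proj : FreeAlgebra R (Option (Fin r) ⊕ (Fin r ⊕ Fin r)) →ₐ[R] StarDualExtension R r :=
  RingQuot.mkAlgHom R _

/-- The idempotent of a vertex. -/
def vertex (p : Option (Fin r)) : StarDualExtension R r := proj R r (FreeAlgebra.ι R (Sum.inl p))

/-- The arrow `α_i : i → 0`. -/
def inArrow (i : Fin r) : StarDualExtension R r :=
  proj R r (FreeAlgebra.ι R (Sum.inr (Sum.inl i)))

/-- The arrow `β_i : 0 → i`. -/
def outArrow (i : Fin r) : StarDualExtension R r :=
  proj R r (FreeAlgebra.ι R (Sum.inr (Sum.inr i)))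

/-- The shortest path from `p` to the centre. -/
def toCentre (p : Option (Fin r)) : StarDualExtension R r :=
  p.elim (vertex R r none) (inArrow R r)

/-- The shortest path from the centre to `p`. -/
def fromCentre (p : Option (Fin r)) : StarDualExtension R r :=
  p.elim (vertex R r none) (outArrow R r)

/-- The path from `q` to `p` through the centre. -/
def throughCentre (p q : Option (Fin r)) : StarDualExtension R r :=
  fromCentre R r p * toCentre R r q

variable {R r}

theorem proj_eq {x y : FreeAlgebra R (Option (Fin r) ⊕ (Fin r ⊕ Fin r))}
    (h : PathAlgebraRel R (Sum.elim some fun _ => none) (Sum.elim (fun _ => none) some)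
      (DualExtensionRel some) x y) : proj R r x = proj R r y :=
  RingQuot.mkAlgHom_rel R h

theorem vertex_mul_vertex (p q : Option (Fin r)) :
    vertex R r p * vertex R r q = if p = q then vertex R r p else 0 := by
  simp only [vertex, ← map_mul]
  split_ifs with h
  · subst h; exact proj_eq (.idem p)
  · rw [proj_eq (.orth p q h), map_zero]

theorem sum_vertex : ∑ p, vertex R r p = 1 := by
  simp only [vertex, ← map_sum]
  rw [proj_eq .sum, map_one]

theorem vertex_none_mul_inArrow (i : Fin r) :
    vertex R r none * inArrow R r i = inArrow R r i := by
  simp only [vertex, inArrow, ← map_mul]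
  exact proj_eq (.target (Sum.inl i))

theorem inArrow_mul_vertex_some (i : Fin r) :
    inArrow R r i * vertex R r (some i) = inArrow R r i := by
  simp only [vertex, inArrow, ← map_mul]
  exact proj_eq (.source (Sum.inl i))

theorem vertex_some_mul_outArrow (i : Fin r) :
    vertex R r (some i) * outArrow R r i = outArrow R r i := by
  simp only [vertex, outArrow, ← map_mul]
  exact proj_eq (.target (Sum.inr i))

theorem outArrow_mul_vertex_none (i : Fin r) :
    outArrow R r i * vertex R r none = outArrow R r i := by
  simp only [vertex, outArrow, ← map_mul]
  exact proj_eq (.source (Sum.inr i))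

theorem inArrow_mul_outArrow (i : Fin r) : inArrow R r i * outArrow R r i = 0 := by
  simp only [inArrow, outArrow, ← map_mul]
  rw [proj_eq (.zero _ _ (.mk i i rfl)), map_zero]

theorem vertex_none_mul_toCentre (p : Option (Fin r)) :
    vertex R r none * toCentre R r p = toCentre R r p := by
  cases p with
  | none => simp [toCentre, vertex_mul_vertex]
  | some i => exact vertex_none_mul_inArrow i

theorem toCentre_mul_vertex_self (p : Option (Fin r)) :
    toCentre R r p * vertex R r p = toCentre R r p := by
  cases p with
  | none => simp [toCentre, vertex_mul_vertex]
  | some i => exact inArrow_mul_vertex_some i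

theorem vertex_self_mul_fromCentre (p : Option (Fin r)) :
    vertex R r p * fromCentre R r p = fromCentre R r p := by
  cases p with
  | none => simp [fromCentre, vertex_mul_vertex]
  | some i => exact vertex_some_mul_outArrow i

theorem fromCentre_mul_vertex_none (p : Option (Fin r)) :
    fromCentre R r p * vertex R r none = fromCentre R r p := by
  cases p with
  | none => simp [fromCentre, vertex_mul_vertex]
  | some i => exact outArrow_mul_vertex_none i

theorem toCentre_mul_vertex (p q : Option (Fin r)) :
    toCentre R r p * vertex R r q = if p = q then toCentre R r p else 0 := by
  rw [← toCentre_mul_vertex_self, mul_assoc, vertex_mul_vertex]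
  split_ifs <;> simp

theorem vertex_mul_fromCentre (p q : Option (Fin r)) :
    vertex R r p * fromCentre R r q = if p = q then fromCentre R r q else 0 := by
  rw [← vertex_self_mul_fromCentre, ← mul_assoc, vertex_mul_vertex]
  split_ifs with h <;> simp [h]

/-- A path cannot leave the centre and come back: different end points are orthogonal, and equal
ones give `α_i β_i = 0`. -/
theorem toCentre_mul_fromCentre (p q : Option (Fin r)) :
    toCentre R r p * fromCentre R r q = if p = none ∧ q = none then vertex R r none else 0 := by
  rw [← toCentre_mul_vertex_self, mul_assoc, vertex_mul_fromCentre]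
  by_cases h : p = q
  · subst h
    cases p with
    | none => simp [toCentre, fromCentre, vertex_mul_vertex]
    | some i => simp [toCentre, fromCentre, inArrow_mul_outArrow]
  · rw [if_neg h, mul_zero, if_neg]
    rintro ⟨rfl, rfl⟩
    exact h rfl

theorem induction {C : StarDualExtension R r → Prop} (scalar : ∀ a, C (algebraMap R _ a))
    (vert : ∀ p, C (vertex R r p)) (inArr : ∀ i, C (toCentre R r (some i)))
    (outArr : ∀ i, C (fromCentre R r (some i))) (add : ∀ x y, C x → C y → C (x + y))
    (mul : ∀ x y, C x → C y → C (x * y)) (x : StarDualExtension R r) : C x := by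
  obtain ⟨x, rfl⟩ := RingQuot.mkAlgHom_surjective R _ x
  change C (proj R r x)
  induction x using FreeAlgebra.induction with
  | grade0 a => rw [AlgHom.commutes]; exact scalar a
  | grade1 x =>
    rcases x with p | i | i
    exacts [vert p, inArr i, outArr i]
  | mul x y hx hy => rw [map_mul]; exact mul _ _ hx hy
  | add x y hx hy => rw [map_add]; exact add _ _ hx hy

theorem exists_mul_fromCentre (x : StarDualExtension R r) (p : Option (Fin r)) :
    ∃ c : Option (Fin r) → R, x * fromCentre R r p = ∑ s, c s • fromCentre R r s := by
  induction x using induction generalizing p with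
  | scalar a => exact ⟨Pi.single p a, by
    rw [Fintype.sum_pi_single_smul, Algebra.smul_def]⟩
  | vert q =>
    refine ⟨Pi.single p (if q = p then 1 else 0), ?_⟩
    rw [vertex_mul_fromCentre, Fintype.sum_pi_single_smul, ite_smul, one_smul, zero_smul]
  | inArr i => exact ⟨0, by simp [toCentre_mul_fromCentre]⟩
  | outArr i =>
    refine ⟨Pi.single (some i) (if p = none then 1 else 0), ?_⟩
    rw [Fintype.sum_pi_single_smul, ite_smul, one_smul, zero_smul]
    split_ifs with h
    · subst h; exact fromCentre_mul_vertex_none _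
    · rw [← fromCentre_mul_vertex_none, mul_assoc, vertex_mul_fromCentre, if_neg (Ne.symm h),
        mul_zero]
  | add x y hx hy =>
    obtain ⟨c, hc⟩ := hx p
    obtain ⟨d, hd⟩ := hy p
    exact ⟨c + d, by simp [add_mul, hc, hd, add_smul, Finset.sum_add_distrib]⟩
  | mul x y hx hy =>
    obtain ⟨d, hd⟩ := hy p
    choose c hc using hx
    refine ⟨fun s => ∑ t, d t * c t s, ?_⟩
    rw [mul_assoc, hd, Finset.mul_sum]
    simp only [mul_smul_comm, hc, Finset.smul_sum, smul_smul, Finset.sum_smul]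
    exact Finset.sum_comm

theorem exists_toCentre_mul (x : StarDualExtension R r) (p : Option (Fin r)) :
    ∃ c : Option (Fin r) → R, toCentre R r p * x = ∑ s, c s • toCentre R r s := by
  induction x using induction generalizing p with
  | scalar a =>
    exact ⟨Pi.single p a, by
      rw [Fintype.sum_pi_single_smul, Algebra.smul_def, Algebra.commutes]⟩
  | vert q =>
    refine ⟨Pi.single p (if p = q then 1 else 0), ?_⟩
    rw [toCentre_mul_vertex, Fintype.sum_pi_single_smul, ite_smul, one_smul, zero_smul]
  | outArr i => exact ⟨0, by simp [toCentre_mul_fromCentre]⟩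
  | inArr i =>
    refine ⟨Pi.single (some i) (if p = none then 1 else 0), ?_⟩
    rw [Fintype.sum_pi_single_smul, ite_smul, one_smul, zero_smul]
    split_ifs with h
    · subst h; exact vertex_none_mul_toCentre _
    · rw [← vertex_none_mul_toCentre (some i), ← mul_assoc, toCentre_mul_vertex, if_neg h, zero_mul]
  | add x y hx hy =>
    obtain ⟨c, hc⟩ := hx p
    obtain ⟨d, hd⟩ := hy p
    exact ⟨c + d, by simp [mul_add, hc, hd, add_smul, Finset.sum_add_distrib]⟩
  | mul x y hx hy =>
    obtain ⟨d, hd⟩ := hx p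
    choose c hc using hy
    refine ⟨fun s => ∑ t, d t * c t s, ?_⟩
    rw [← mul_assoc, hd, Finset.sum_mul]
    simp only [smul_mul_assoc, hc, Finset.smul_sum, smul_smul, Finset.sum_smul]
    exact Finset.sum_comm

/-- The paths that are not zero: those through the centre, and the trivial paths at the other
vertices. -/
def path (s : (Option (Fin r) × Option (Fin r)) ⊕ Fin r) : StarDualExtension R r :=
  s.elim (fun p => throughCentre R r p.1 p.2) fun i => vertex R r (some i)

/-- The span contains `1` and is stable under left multiplication by the generators, hence by every
element. -/
theorem span_path : Submodule.span R (Set.range (path (R := R) (r := r))) = ⊤ := by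
  set W := Submodule.span R (Set.range (path (R := R) (r := r)))
  have hthrough : ∀ p q, fromCentre R r p * toCentre R r q ∈ W := fun p q =>
    Submodule.subset_span ⟨Sum.inl (p, q), rfl⟩
  have hsome : ∀ i, vertex R r (some i) ∈ W := fun i => Submodule.subset_span ⟨Sum.inr i, rfl⟩
  have hnone : vertex R r none ∈ W := by
    have := hthrough none none
    simpa [fromCentre, toCentre, vertex_mul_vertex] using this
  have hin : ∀ q, toCentre R r q ∈ W := fun q => by
    have := hthrough none q
    rwa [fromCentre, Option.elim_none, vertex_none_mul_toCentre] at this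
  have hout : ∀ q, fromCentre R r q ∈ W := fun q => by
    have := hthrough q none
    rwa [toCentre, Option.elim_none, fromCentre_mul_vertex_none] at this
  have h1 : (1 : StarDualExtension R r) ∈ W := by
    rw [← sum_vertex]
    refine Submodule.sum_mem _ fun p _ => ?_
    cases p
    exacts [hnone, hsome _]
  have key : ∀ x : StarDualExtension R r, ∀ y ∈ W, x * y ∈ W := by
    -- Paths through the centre are covered by `exists_mul_fromCentre`, so stability has to be
    -- checked only on the trivial paths at the outer vertices.
    have of_vertex : ∀ x : StarDualExtension R r, (∀ i, x * vertex R r (some i) ∈ W) →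
        ∀ y ∈ W, x * y ∈ W := by
      intro x h y hy
      refine (Submodule.span_le (p := W.comap (LinearMap.mulLeft R x))).2 ?_ hy
      rintro _ ⟨⟨p, q⟩ | i, rfl⟩
      · change x * (fromCentre R r p * toCentre R r q) ∈ W
        obtain ⟨c, hc⟩ := exists_mul_fromCentre x p
        rw [← mul_assoc, hc, Finset.sum_mul]
        refine Submodule.sum_mem _ fun s _ => ?_
        rw [smul_mul_assoc]
        exact W.smul_mem _ (hthrough _ _)
      · exact h i
    intro x
    induction x using induction with
    | scalar a =>
      intro y hy
      rw [← Algebra.smul_def]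
      exact W.smul_mem a hy
    | vert p =>
      refine of_vertex _ fun i => ?_
      rw [vertex_mul_vertex]
      split_ifs with h
      exacts [h ▸ hsome i, W.zero_mem]
    | inArr j =>
      refine of_vertex _ fun i => ?_
      rw [toCentre_mul_vertex]
      split_ifs
      exacts [hin _, W.zero_mem]
    | outArr j =>
      refine of_vertex _ fun i => ?_
      rw [← fromCentre_mul_vertex_none, mul_assoc, vertex_mul_vertex, if_neg (by simp), mul_zero]
      exact W.zero_mem
    | add x y hx hy => exact fun z hz => by rw [add_mul]; exact W.add_mem (hx z hz) (hy z hz)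
    | mul x y hx hy => exact fun z hz => by rw [mul_assoc]; exact hx _ (hy z hz)
  rw [eq_top_iff]
  intro x _
  simpa using key x 1 h1

/-- The base point is the centre, whose idempotent factors every path through it. The independence
of the paths is an assumption here; `isBasicAlgebra` supplies it from a concrete algebra. -/
theorem isHeredityFamily (h : LinearIndependent R (path (R := R) (r := r))) :
    IsHeredityFamily R (throughCentre R r) none where
  linearIndependent := h.comp Sum.inl Sum.inl_injective
  mul_left x p := by
    obtain ⟨c, hc⟩ := exists_mul_fromCentre x p
    exact ⟨c, fun q => by simp only [throughCentre, ← mul_assoc, hc, Finset.sum_mul, smul_mul_assoc]⟩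
  mul_right x q := by
    obtain ⟨c, hc⟩ := exists_toCentre_mul x q
    exact ⟨c, fun p => by simp only [throughCentre, mul_assoc, hc, Finset.mul_sum, mul_smul_comm]⟩
  mul_base p q := by
    simp only [throughCentre]
    rw [mul_assoc, ← mul_assoc (toCentre R r none), toCentre_mul_fromCentre, if_pos ⟨rfl, rfl⟩,
      vertex_none_mul_toCentre]
  base_mul p q := by
    have h1 : throughCentre R r none none = vertex R r none :=
      fromCentre_mul_vertex_none none
    simp only [h1]
    simp only [throughCentre]
    rw [mul_assoc, ← mul_assoc (toCentre R r p), toCentre_mul_fromCentre]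
    split_ifs
    · exact ⟨1, by
        rw [vertex_none_mul_toCentre, one_smul]
        exact fromCentre_mul_vertex_none none⟩
    · exact ⟨0, by simp⟩

variable (R r) in
/-- The ideal generated by the idempotent of the centre. -/
def centreIdeal : Ideal (StarDualExtension R r) where
  carrier := Submodule.span R (Set.range fun s : Option (Fin r) × Option (Fin r) =>
    throughCentre R r s.1 s.2)
  add_mem' := Submodule.add_mem _
  zero_mem' := Submodule.zero_mem _
  smul_mem' x y hy := by
    refine (Submodule.span_le (p := (Submodule.span R (Set.range
      fun s : Option (Fin r) × Option (Fin r) => throughCentre R r s.1 s.2)).comap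
        (LinearMap.mulLeft R x))).2 ?_ hy
    rintro _ ⟨⟨p, q⟩, rfl⟩
    obtain ⟨c, hc⟩ := exists_mul_fromCentre x p
    change x * (fromCentre R r p * toCentre R r q) ∈ Submodule.span _ _
    rw [← mul_assoc, hc, Finset.sum_mul]
    refine Submodule.sum_mem _ fun s _ => ?_
    rw [smul_mul_assoc]
    exact Submodule.smul_mem _ _ (Submodule.subset_span ⟨(s, q), rfl⟩)

theorem mem_centreIdeal (x : StarDualExtension R r) : x ∈ centreIdeal R r ↔
    x ∈ Submodule.span R (Set.range fun s : Option (Fin r) × Option (Fin r) =>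
      throughCentre R r s.1 s.2) := Iff.rfl

/-- Modulo the paths through the centre only the outer vertices survive, so the quotient is an image
of `R^r` and hence semisimple. -/
theorem globalDimension_le (h : LinearIndependent R (path (R := R) (r := r))) :
    globalDimension (StarDualExtension R r) ≤ 2 := by
  have hf := isHeredityFamily h
  have := hf.isTwoSided mem_centreIdeal
  let π := Ideal.Quotient.mk (centreIdeal R r)
  have hπ : ∀ p q, π (throughCentre R r p q) = 0 := fun p q =>
    Ideal.Quotient.eq_zero_iff_mem.2 (hf.mem mem_centreIdeal p q)
  have hnone : π (vertex R r none) = 0 := by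
    rw [← hπ none none]
    exact congrArg π (fromCentre_mul_vertex_none none).symm
  let f : (Fin r → R) →+* StarDualExtension R r ⧸ centreIdeal R r :=
    { toFun := fun c => π (∑ i, c i • vertex R r (some i))
      map_one' := by
        have := congrArg π (sum_vertex (R := R) (r := r))
        rw [Fintype.sum_option, map_add, hnone, zero_add, map_one] at this
        simpa using this
      map_mul' := fun c d => by
        rw [← map_mul]
        congr 1
        simp [Finset.sum_mul_sum, vertex_mul_vertex, smul_smul, mul_comm]
      map_zero' := by simp
      map_add' := fun c d => by
        rw [← map_add]
        simp [add_smul, Finset.sum_add_distrib] }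
  have hf' : Function.Surjective f := by
    intro y
    obtain ⟨x, rfl⟩ := Ideal.Quotient.mk_surjective y
    have hx : x ∈ Submodule.span R (Set.range (path (R := R) (r := r))) := by
      rw [span_path]; exact Submodule.mem_top
    induction hx using Submodule.span_induction with
    | mem x hx =>
      obtain ⟨⟨p, q⟩ | i, rfl⟩ := hx
      · exact ⟨0, (map_zero f).trans (hπ p q).symm⟩
      · exact ⟨Pi.single i 1, congrArg π (by
          rw [Fintype.sum_pi_single_smul, one_smul]; rfl)⟩
    | zero => exact ⟨0, by simp⟩
    | add x y _ _ hx hy =>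
      obtain ⟨c, hc⟩ := hx
      obtain ⟨d, hd⟩ := hy
      exact ⟨c + d, by rw [map_add, map_add, hc, hd]⟩
    | smul a x _ hx =>
      obtain ⟨c, hc⟩ := hx
      refine ⟨a • c, ?_⟩
      change π _ = π _
      change π _ = π _ at hc
      rw [Algebra.smul_def a x, map_mul, ← hc, ← map_mul, ← Algebra.smul_def]
      simp [Finset.smul_sum, smul_smul]
  have := RingHom.isSemisimpleRing_of_surjective f hf'
  exact hf.globalDimension_le mem_centreIdeal

/-- An algebra with elements that satisfy the relations of the arrows and vertices of the dual
extension of a star, and in which the corner `εAε` of the sum `ε` of the vertices has the paths as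
a basis, has this dual extension as its basic algebra if the vertices generate a complete family of
projective modules. -/
theorem isBasicAlgebra {A : Type v} [Ring A] [Algebra R A] (e : Fin (r + 1) → A)
    (he : ∀ i, e i * e i = e i) (he' : ∀ i j, i ≠ j → e i * e j = 0)
    (hfam : IsCompleteProjectiveFamily A fun i => Ideal.span {e i}) (a b : Fin r → A)
    (hea : ∀ i, e 0 * a i = a i) (hae : ∀ i, a i * e i.succ = a i)
    (heb : ∀ i, e i.succ * b i = b i) (hbe : ∀ i, b i * e 0 = b i) (hab : ∀ i, a i * b i = 0)
    (B : (Option (Fin r) × Option (Fin r)) ⊕ Fin r → A)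
    (hB₁ : ∀ p q, B (Sum.inl (p, q)) = p.elim (e 0) b * q.elim (e 0) a)
    (hB₂ : ∀ i, B (Sum.inr i) = e i.succ)
    (hBli : LinearIndependent R B)
    (hBspan : ∀ t, (∑ i, e i) * t * ∑ i, e i = t → t ∈ Submodule.span R (Set.range B)) :
    IsBasicAlgebra R A (StarDualExtension R r) ∧
      LinearIndependent R (path (R := R) (r := r)) := by
  set ε := ∑ i, e i with hε
  have hεe : ∀ i, ε * e i = e i := fun i => by
    rw [hε, Finset.sum_mul, Finset.sum_eq_single i (fun j _ h => he' j i h) (by simp), he]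
  have heε : ∀ i, e i * ε = e i := fun i => by
    rw [hε, Finset.mul_sum, Finset.sum_eq_single i (fun j _ h => he' i j h.symm) (by simp), he]
  let v : Option (Fin r) → A := fun p => p.elim (e 0) fun i => e i.succ
  let g : Option (Fin r) ⊕ (Fin r ⊕ Fin r) → A := Sum.elim v (Sum.elim a b)
  have hεg : ∀ s, ε * g s = g s := by
    rintro ((_ | i) | i | i)
    · exact hεe 0
    · exact hεe _
    · change ε * a i = a i
      rw [← hea, ← mul_assoc, hεe]
    · change ε * b i = b i
      rw [← heb, ← mul_assoc, hεe]
  have hgε : ∀ s, g s * ε = g s := by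
    rintro ((_ | i) | i | i)
    · exact heε 0
    · exact heε _
    · change a i * ε = a i
      rw [← hae, mul_assoc, heε]
    · change b i * ε = b i
      rw [← hbe, mul_assoc, heε]
  let Γ := (Module.End A (∀ i, Ideal.span {e i}))ᵐᵒᵖ
  let σ := algebraToEnd R (e := e)
  let τ := endToAlgebra R e
  have hτinj : Function.Injective τ := endToAlgebra_injective R he he'
  have hτσ : ∀ s, τ (σ (g s)) = g s := fun s => by
    rw [endToAlgebra_algebraToEnd, ← hε, hεg, hgε]
  have hτmul : ∀ x y, τ (x * y) = τ x * τ y := endToAlgebra_mul R he he'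
  -- Vertices and arrows go to right multiplications by `e` and by `a`, `b`. As `τ` is injective and
  -- multiplicative, the quiver relations can be checked in `A`.
  let φ₀ : FreeAlgebra R (Option (Fin r) ⊕ (Fin r ⊕ Fin r)) →ₐ[R] Γ :=
    FreeAlgebra.lift R fun s => σ (g s)
  have hφ₀ : ∀ s, φ₀ (FreeAlgebra.ι R s) = σ (g s) := fun s => FreeAlgebra.lift_ι_apply _ _
  have hrel : ∀ ⦃x y⦄, PathAlgebraRel R (Sum.elim some fun _ => none)
      (Sum.elim (fun _ => none) some) (DualExtensionRel some) x y → φ₀ x = φ₀ y := by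
    intro x y h
    apply hτinj
    cases h with
    | idem p =>
      rw [map_mul, hφ₀, hτmul, hτσ]
      cases p
      exacts [he 0, he _]
    | orth p q h =>
      rw [map_mul, hφ₀, hφ₀, hτmul, hτσ, hτσ, map_zero, map_zero]
      rcases p with _ | i <;> rcases q with _ | j
      · exact absurd rfl h
      · exact he' _ _ (Fin.succ_ne_zero j).symm
      · exact he' _ _ (Fin.succ_ne_zero i)
      · exact he' _ _ fun h' => h (congrArg some (Fin.succ_injective _ h'))
    | sum =>
      rw [map_sum, map_sum, map_one, Fintype.sum_option]
      simp only [hφ₀, hτσ]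
      exact (Fin.sum_univ_succ e).symm
    | target a =>
      rw [map_mul, hφ₀, hφ₀, hτmul, hτσ, hτσ]
      rcases a with i | i
      exacts [hea i, heb i]
    | source a =>
      rw [map_mul, hφ₀, hφ₀, hτmul, hτσ, hτσ]
      rcases a with i | i
      exacts [hae i, hbe i]
    | zero a b h =>
      rw [map_mul, hφ₀, hφ₀, hτmul, hτσ, hτσ, map_zero, map_zero]
      obtain ⟨i, j, hij⟩ := h
      obtain rfl := Option.some_injective _ hij
      exact hab i
  let φ : StarDualExtension R r →ₐ[R] Γ := RingQuot.liftAlgHom R ⟨φ₀, hrel⟩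
  have hφ : ∀ s, τ (φ (proj R r (FreeAlgebra.ι R s))) = g s := fun s => by
    rw [← hτσ, ← hφ₀]
    exact congrArg τ (RingQuot.liftAlgHom_mkAlgHom_apply _ _ _ _)
  let ψ : StarDualExtension R r →ₗ[R] A := τ ∘ₗ φ.toLinearMap
  have hψ : ∀ s, ψ (path s) = B s := by
    rintro (⟨p, q⟩ | i)
    · change τ (φ (fromCentre R r p * toCentre R r q)) = _
      rw [map_mul, hτmul, hB₁]
      congr 1
      · cases p <;> exact hφ _
      · cases q <;> exact hφ _
    · rw [hB₂]; exact hφ _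
  -- The paths are independent because their images `B` are; no normal form in the presented algebra
  -- is needed.
  have hli : LinearIndependent R (path (R := R) (r := r)) := by
    refine LinearIndependent.of_comp ψ ?_
    rwa [show ψ ∘ path = B from funext hψ]
  refine ⟨⟨r + 1, fun i => Ideal.span {e i}, inferInstance, inferInstance, inferInstance,
    inferInstance, hfam, ⟨AlgEquiv.ofBijective φ ⟨?_, ?_⟩⟩⟩, hli⟩
  · let bas := Module.Basis.mk hli span_path.ge
    have hbas : ∀ s, bas s = path s := fun s => by simp [bas]
    have h1 : Function.Injective ψ := by
      rw [← LinearMap.ker_eq_bot]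
      refine LinearMap.ker_eq_bot'.2 fun x hx => ?_
      rw [← bas.sum_repr x, map_sum] at hx
      simp only [map_smul, hbas, hψ] at hx
      rw [← bas.sum_repr x]
      exact Finset.sum_eq_zero fun s _ => by
        rw [Fintype.linearIndependent_iff.1 hBli _ hx s, zero_smul]
    exact fun x y hxy => h1 (congrArg τ hxy)
  · intro f
    -- Surjectivity: `τ f` lies in the corner `εAε`, which is spanned by the images of the paths.
    have h1 := hBspan (τ f) (sum_mul_endToAlgebra_mul_sum R he he' f)
    have h2 : Submodule.span R (Set.range B) ≤ LinearMap.range ψ := by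
      rw [Submodule.span_le]
      rintro _ ⟨s, rfl⟩
      exact ⟨path s, hψ s⟩
    obtain ⟨x, hx⟩ := h2 h1
    exact ⟨x, hτinj hx⟩

end StarDualExtension

/-! ## Cell chains of star posets -/

namespace StarPoset

theorem pos_injective {r : ℕ} : Function.Injective (pos : StarPoset (Fin r) → Fin (r + 1)) := by
  rintro (_ | a) (_ | b) h
  · rfl
  · exact absurd h (Fin.succ_ne_zero b).symm
  · exact absurd h (Fin.succ_ne_zero a)
  · exact congrArg _ (Fin.succ_injective _ h)

theorem pos_surjective {r : ℕ} : Function.Surjective (pos : StarPoset (Fin r) → Fin (r + 1)) := by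
  intro i
  cases i using Fin.cases with
  | zero => exact ⟨(none : Option (Fin r)), rfl⟩
  | succ i => exact ⟨(some i : Option (Fin r)), rfl⟩

/-- Enumerating `0` first and the other elements in any order is a linear extension of the star
poset, so lower cells of the poset are earlier cells of the chain. -/
theorem pos_lt_pos {r : ℕ} {a b : StarPoset (Fin r)} (h : a < b) : a.pos < b.pos := by
  refine lt_of_le_of_ne ?_ fun h' => h.ne (pos_injective h')
  rcases h.le with h | h
  · rw [h]; exact Fin.zero_le _
  · rw [h]

end StarPoset

namespace IsCellDatum

variable {R A : Type*} [Field R] [Ring A] [Algebra R A] {r : ℕ} {M : StarPoset (Fin r) → Type*}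
  [∀ l, Fintype (M l)] {C : ∀ l, M l → M l → A} {t : A →ₗ[R] A}

/-- The span of the cells in front of the `i`-th one. -/
def cellSpan (R : Type*) [Field R] [Algebra R A] (C : ∀ l, M l → M l → A) (i : Fin (r + 2)) :
    Submodule R A :=
  Submodule.span R {b | ∃ l : StarPoset (Fin r), l.pos.castSucc < i ∧ ∃ p q, b = C l p q}

omit [(l : StarPoset (Fin r)) → Fintype (M l)] in
theorem mem_cellSpan {i : Fin (r + 2)} {l : StarPoset (Fin r)} (hl : l.pos.castSucc < i)
    (p q : M l) : C l p q ∈ cellSpan R C i :=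
  Submodule.subset_span ⟨l, hl, p, q, rfl⟩

omit [(l : StarPoset (Fin r)) → Fintype (M l)] in
theorem cellSpan_le {i : Fin (r + 2)} {N : Submodule R A}
    (h : ∀ l : StarPoset (Fin r), l.pos.castSucc < i → ∀ p q, C l p q ∈ N) :
    cellSpan R C i ≤ N := by
  refine Submodule.span_le.2 ?_
  rintro _ ⟨l, hl, p, q, rfl⟩
  exact h l hl p q

variable (h : IsCellDatum R C t)
include h

theorem mul_sub_mem (a : A) (l : StarPoset (Fin r)) (p : M l) : ∃ c : M l → R, ∀ q : M l,
    a * C l p q - ∑ s, c s • C l s q ∈ cellSpan R C l.pos.castSucc := by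
  obtain ⟨c, hc⟩ := h.mul_basis a l p
  refine ⟨c, fun q => Submodule.span_mono ?_ (hc q)⟩
  rintro _ ⟨m, hm, p', q', rfl⟩
  exact ⟨m, Fin.castSucc_lt_castSucc_iff.2 (StarPoset.pos_lt_pos hm), p', q', rfl⟩

theorem mul_mem (i : Fin (r + 2)) (a : A) {b : A} (hb : b ∈ cellSpan R C i) :
    a * b ∈ cellSpan R C i := by
  refine (cellSpan_le (N := (cellSpan R C i).comap (LinearMap.mulLeft R a)) ?_) hb
  intro l hl p q
  obtain ⟨c, hc⟩ := h.mul_sub_mem a l p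
  change a * C l p q ∈ cellSpan R C i
  rw [← sub_add_cancel (a * C l p q) (∑ s, c s • C l s q)]
  refine Submodule.add_mem _ (cellSpan_le (fun m hm => mem_cellSpan (hm.trans hl)) (hc q)) ?_
  exact Submodule.sum_mem _ fun s _ => Submodule.smul_mem _ _ (mem_cellSpan hl _ _)

theorem map_mem (i : Fin (r + 2)) {b : A} (hb : b ∈ cellSpan R C i) : t b ∈ cellSpan R C i := by
  refine (cellSpan_le (N := (cellSpan R C i).comap t) ?_) hb
  intro l hl p q
  rw [Submodule.mem_comap, h.map_basis]
  exact mem_cellSpan hl _ _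

/-- Cell axioms control left multiplication only; the anti-involution, which preserves every
`cellSpan`, carries the statement to the right. -/
theorem mem_mul (i : Fin (r + 2)) (a : A) {b : A} (hb : b ∈ cellSpan R C i) :
    b * a ∈ cellSpan R C i := by
  rw [← h.involutive (b * a), h.map_mul]
  exact h.map_mem i (h.mul_mem i _ (h.map_mem i hb))

theorem mul_sub_mem_right (a : A) (l : StarPoset (Fin r)) (q : M l) : ∃ c : M l → R, ∀ p : M l,
    C l p q * a - ∑ s, c s • C l p s ∈ cellSpan R C l.pos.castSucc := by
  obtain ⟨c, hc⟩ := h.mul_sub_mem (t a) l q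
  refine ⟨c, fun p => ?_⟩
  have := h.map_mem _ (hc p)
  simpa [h.map_mul, h.involutive, h.map_basis] using this

/-- The ideals of the cell chain. -/
def cellIdeal (i : Fin (r + 2)) : Ideal A where
  carrier := cellSpan R C i
  add_mem' := Submodule.add_mem _
  zero_mem' := Submodule.zero_mem _
  smul_mem' a _ hb := h.mul_mem i a hb

theorem cellIdeal_isTwoSided (i : Fin (r + 2)) : (h.cellIdeal i).IsTwoSided :=
  ⟨fun a hb => h.mem_mul i a hb⟩

theorem exists_coord (l : StarPoset (Fin r)) : ∃ f : M l × M l → A →ₗ[R] R,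
    (∀ s s', s ≠ s' → f s (C l s'.1 s'.2) = 0) ∧ (∀ s, f s (C l s.1 s.2) = 1) ∧
      ∀ s, cellSpan R C l.pos.castSucc ≤ LinearMap.ker (f s) := by
  classical
  let b := Module.Basis.mk h.linearIndependent h.span_eq_top.ge
  have hb : ∀ l p q, b ⟨l, p, q⟩ = C l p q := fun l p q => by simp [b]
  refine ⟨fun s => b.coord ⟨l, s⟩, ?_, ?_, ?_⟩
  · intro s s' hs
    rw [← hb, Module.Basis.coord_apply, Module.Basis.repr_self, Finsupp.single_eq_of_ne]
    intro h'
    exact hs (eq_of_heq (Sigma.mk.inj h').2)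
  · intro s
    rw [← hb, Module.Basis.coord_apply, Module.Basis.repr_self, Finsupp.single_eq_same]
  · intro s
    refine cellSpan_le fun m hm p q => ?_
    rw [LinearMap.mem_ker, ← hb, Module.Basis.coord_apply, Module.Basis.repr_self,
      Finsupp.single_eq_of_ne]
    intro h'
    obtain rfl := congrArg Sigma.fst h'
    exact lt_irrefl _ hm

/-- The hypothesis provides in each cell an idempotent `C l o o` through which the cell factors.
Each layer of the chain is then an `IsHeredityFamily` in the quotient by the earlier cells. -/
theorem isHeredityChain (hbase : ∀ l, ∃ o : M l, (∀ p q, C l p o * C l o q = C l p q) ∧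
    ∀ p q, ∃ c : R, C l o p * C l q o = c • C l o o) : IsHeredityChain h.cellIdeal where
  isTwoSided := h.cellIdeal_isTwoSided
  zero := by
    rw [eq_bot_iff]
    intro a ha
    exact cellSpan_le (N := ⊥) (fun l hl => absurd hl (Fin.not_lt_zero _)) ha
  last := by
    rw [eq_top_iff]
    intro a _
    change a ∈ cellSpan R C _
    have : ⊤ ≤ cellSpan R C (Fin.last (r + 1)) := by
      rw [← h.span_eq_top, Submodule.span_le]
      rintro _ ⟨⟨l, p, q⟩, rfl⟩
      exact mem_cellSpan (Fin.castSucc_lt_last _) _ _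
    exact this trivial
  strictMono := by
    refine Fin.strictMono_iff_lt_succ.2 fun i => ?_
    obtain ⟨l, rfl⟩ := StarPoset.pos_surjective i
    obtain ⟨o, -⟩ := hbase l
    obtain ⟨f, -, hf, hf'⟩ := h.exists_coord l
    refine lt_of_le_of_ne (fun a ha => cellSpan_le (fun m hm => mem_cellSpan
      (hm.trans (Fin.castSucc_lt_succ))) ha) fun heq => ?_
    have h1 : C l o o ∈ h.cellIdeal l.pos.succ := mem_cellSpan (Fin.castSucc_lt_succ) o o
    rw [← heq] at h1
    have h2 := hf' (o, o) h1
    rw [LinearMap.mem_ker, hf (o, o)] at h2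
    exact one_ne_zero h2
  heredity i := by
    obtain ⟨l, rfl⟩ := StarPoset.pos_surjective i
    have := h.cellIdeal_isTwoSided l.pos.castSucc
    obtain ⟨o, ho, ho'⟩ := hbase l
    obtain ⟨f, hf0, hf1, hf'⟩ := h.exists_coord l
    let π := Ideal.Quotient.mk (h.cellIdeal l.pos.castSucc)
    have hsmul : ∀ (c : R) (a : A), π (c • a) = c • π a := fun _ _ => rfl
    have hmul : ∀ a b : A, π (a * b) = π a * π b := fun _ _ => rfl
    have hπ : ∀ a ∈ cellSpan R C l.pos.castSucc, π a = 0 := fun a ha =>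
      Ideal.Quotient.eq_zero_iff_mem.2 ha
    have hπ' : ∀ a, π a = 0 → a ∈ cellSpan R C l.pos.castSucc := fun a ha =>
      Ideal.Quotient.eq_zero_iff_mem.1 ha
    have hfam : IsHeredityFamily R (fun p q => π (C l p q)) o := by
      constructor
      · rw [Fintype.linearIndependent_iff]
        intro c hc s
        simp only [← hsmul, ← map_sum] at hc
        have h1 := hf' s (hπ' _ hc)
        rw [LinearMap.mem_ker, map_sum, Finset.sum_eq_single s] at h1
        · simpa [hf1] using h1
        · intro s' _ hs
          rw [map_smul, hf0 _ _ hs.symm, smul_zero]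
        · simp
      · intro a p
        obtain ⟨a, rfl⟩ := Ideal.Quotient.mk_surjective a
        obtain ⟨c, hc⟩ := h.mul_sub_mem a l p
        refine ⟨c, fun q => ?_⟩
        have := hπ _ (hc q)
        rwa [map_sub, sub_eq_zero, map_sum, hmul] at this
      · intro a q
        obtain ⟨a, rfl⟩ := Ideal.Quotient.mk_surjective a
        obtain ⟨c, hc⟩ := h.mul_sub_mem_right a l q
        refine ⟨c, fun p => ?_⟩
        have := hπ _ (hc p)
        rwa [map_sub, sub_eq_zero, map_sum, hmul] at this
      · intro p q
        rw [← hmul, ho]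
      · intro p q
        obtain ⟨c, hc⟩ := ho' p q
        exact ⟨c, by rw [← hmul, hc, hsmul]⟩
    refine hfam.isHeredityIdeal fun a => ?_
    obtain ⟨a, rfl⟩ := Ideal.Quotient.mk_surjective a
    constructor
    · intro ha
      obtain ⟨b, hb, hba⟩ := (Ideal.mem_map_iff_of_surjective _ Ideal.Quotient.mk_surjective).1 ha
      rw [← hba]
      change π b ∈ _
      refine (cellSpan_le (N := (Submodule.span R (Set.range fun s : M l × M l =>
        π (C l s.1 s.2))).comap (Ideal.Quotient.mkₐ R _).toLinearMap) ?_) hb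
      intro m hm p q
      change π (C m p q) ∈ Submodule.span R _
      -- Cells strictly before `l` vanish in the quotient, so the image of the next ideal is spanned
      -- by cell `l` alone.
      rcases (Fin.le_castSucc_iff.2 hm).lt_or_eq with hlt | heq
      · rw [hπ _ (mem_cellSpan hlt p q)]
        exact Submodule.zero_mem _
      · obtain rfl := StarPoset.pos_injective (Fin.castSucc_injective _ heq)
        exact Submodule.subset_span ⟨(p, q), rfl⟩
    · intro ha
      have h1 : Submodule.span R (Set.range fun s : M l × M l => π (C l s.1 s.2)) ≤
          ((h.cellIdeal l.pos.succ).map (Ideal.Quotient.mk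
            (h.cellIdeal l.pos.castSucc))).restrictScalars R := by
        rw [Submodule.span_le]
        rintro _ ⟨s, rfl⟩
        exact Ideal.mem_map_of_mem _ (mem_cellSpan (R := R) Fin.castSucc_lt_succ s.1 s.2)
      exact h1 ha

end IsCellDatum

/-! ## Algebras with a star basis -/

theorem linearIndependent_of_dual {R V ι : Type*} [Field R] [AddCommGroup V] [Module R V]
    {v : ι → V} (f : ι → V →ₗ[R] R) (h0 : ∀ s s', s ≠ s' → f s (v s') = 0)
    (h1 : ∀ s, f s (v s) = 1) : LinearIndependent R v := by
  rw [linearIndependent_iff']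
  intro t c hc s hs
  have := congrArg (f s) hc
  rw [map_sum, map_zero, Finset.sum_eq_single s] at this
  · simpa [h1] using this
  · intro s' _ hs'
    rw [map_smul, h0 _ _ hs'.symm, smul_zero]
  · exact fun h => absurd hs h

/-- A basis of an algebra that behaves like the all-one blocks `full i j` and, for related `i` and
`j`, the permutation blocks `part i j` of a partitioned matrix algebra, with the dual basis. -/
structure StarBasis (R A N : Type*) [Field R] [Ring A] [Algebra R A] [Fintype N] [DecidableEq N]
    (same : N → N → Prop) where
  weight : N → R
  full : N → N → A
  part : N → N → A
  fullCoord : N → N → A →ₗ[R] R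
  partCoord : N → N → A →ₗ[R] R
  same_symm : ∀ i j, same i j → same j i
  same_trans : ∀ i j k, same i j → same j k → same i k
  part_eq_zero : ∀ i j, ¬ same i j → part i j = 0
  full_mul_full : ∀ i j k l, full i j * full k l = if j = k then weight j • full i l else 0
  full_mul_part : ∀ i j k l, same k l → full i j * part k l = if j = k then full i l else 0
  part_mul_full : ∀ i j k l, same i j → part i j * full k l = if j = k then full i l else 0
  part_mul_part : ∀ i j k l, same i j → same k l →
    part i j * part k l = if j = k then part i l else 0
  expand : ∀ a, a = ∑ i, ∑ j, (fullCoord i j a • full i j + partCoord i j a • part i j)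
  fullCoord_full : ∀ i j k l, fullCoord i j (full k l) = if i = k ∧ j = l then 1 else 0
  fullCoord_part : ∀ i j k l, fullCoord i j (part k l) = 0
  partCoord_full : ∀ i j k l, partCoord i j (full k l) = 0
  partCoord_part : ∀ i j k l, same k l →
    partCoord i j (part k l) = if i = k ∧ j = l then 1 else 0
  unit : N → A
  unit_thin : ∀ i, ¬ same i i → unit i = full i i
  unit_thick : ∀ i, same i i → unit i = part i i
  sum_unit : ∑ i, unit i = 1
  weight_thin : ∀ i, ¬ same i i → weight i = 1

namespace StarBasis

variable {R A N : Type*} [Field R] [Ring A] [Algebra R A] [Fintype N] [DecidableEq N]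
  {same : N → N → Prop} (D : StarBasis R A N same)

include D

theorem same_left {i j : N} (h : same i j) : same i i :=
  D.same_trans _ _ _ h (D.same_symm _ _ h)

theorem same_right {i j : N} (h : same i j) : same j j :=
  D.same_trans _ _ _ (D.same_symm _ _ h) h

theorem induction {C : A → Prop} (zero : C 0) (full : ∀ i j, C (D.full i j))
    (part : ∀ i j, same i j → C (D.part i j)) (add : ∀ a b, C a → C b → C (a + b))
    (smul : ∀ (c : R) a, C a → C (c • a)) (a : A) : C a := by
  rw [D.expand a]
  refine Finset.sum_induction _ C add zero fun i _ =>
    Finset.sum_induction _ C add zero fun j _ => add _ _ (smul _ _ (full i j)) (smul _ _ ?_)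
  by_cases h : same i j
  · exact part i j h
  · rw [D.part_eq_zero i j h]; exact zero

theorem exists_mul_full (a : A) (p : N) :
    ∃ c : N → R, ∀ q, a * D.full p q = ∑ s, c s • D.full s q := by
  induction a using D.induction with
  | zero => exact ⟨0, by simp⟩
  | full i j =>
    refine ⟨Pi.single i (if j = p then D.weight j else 0), fun q => ?_⟩
    rw [Fintype.sum_pi_single_smul, D.full_mul_full, ite_smul, zero_smul]
  | part i j h =>
    refine ⟨Pi.single i (if j = p then 1 else 0), fun q => ?_⟩
    rw [Fintype.sum_pi_single_smul, D.part_mul_full _ _ _ _ h, ite_smul, zero_smul, one_smul]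
  | add a b ha hb =>
    obtain ⟨c, hc⟩ := ha
    obtain ⟨d, hd⟩ := hb
    exact ⟨c + d, fun q => by simp [add_mul, hc, hd, add_smul, Finset.sum_add_distrib]⟩
  | smul c a ha =>
    obtain ⟨d, hd⟩ := ha
    exact ⟨c • d, fun q => by simp [hd, Finset.smul_sum, smul_smul]⟩

/-- The span of the elements `full i j`. -/
def fullSpan : Submodule R A := Submodule.span R (Set.range fun s : N × N => D.full s.1 s.2)

theorem full_mem (i j : N) : D.full i j ∈ D.fullSpan := Submodule.subset_span ⟨(i, j), rfl⟩

/-- Modulo the `full` elements, the `part` elements of one class multiply as matrix units, so the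
coefficients do not depend on `q`. -/
theorem exists_mul_part (a : A) (T : Finset N) (p : T) (hT : ∀ s q, q ∈ T → (same s q ↔ s ∈ T)) :
    ∃ c : T → R, ∀ q : T, a * D.part p q - ∑ s, c s • D.part s q ∈ D.fullSpan := by
  have hpT : ∀ q : T, same p q := fun q => (hT p q q.2).2 p.2
  induction a using D.induction with
  | zero => exact ⟨0, by simp⟩
  | full i j =>
    refine ⟨0, fun q => ?_⟩
    rw [D.full_mul_part _ _ _ _ (hpT q)]
    simp only [Pi.zero_apply, zero_smul, Finset.sum_const_zero, sub_zero]
    split_ifs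
    exacts [D.full_mem _ _, Submodule.zero_mem _]
  | part i j h =>
    by_cases hjp : j = p
    · have hi : i ∈ T := (hT i p p.2).1 (hjp ▸ h)
      refine ⟨Pi.single ⟨i, hi⟩ 1, fun q => ?_⟩
      rw [Fintype.sum_pi_single_smul, D.part_mul_part _ _ _ _ h (hpT q), if_pos hjp, one_smul,
        sub_self]
      exact Submodule.zero_mem _
    · refine ⟨0, fun q => ?_⟩
      rw [D.part_mul_part _ _ _ _ h (hpT q), if_neg hjp]
      simp
  | add a b ha hb =>
    obtain ⟨c, hc⟩ := ha
    obtain ⟨d, hd⟩ := hb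
    refine ⟨c + d, fun q => ?_⟩
    have := Submodule.add_mem _ (hc q) (hd q)
    simp only [add_mul, Pi.add_apply, add_smul, Finset.sum_add_distrib]
    rwa [add_sub_add_comm]
  | smul c a ha =>
    obtain ⟨d, hd⟩ := ha
    refine ⟨c • d, fun q => ?_⟩
    have := Submodule.smul_mem _ c (hd q)
    rwa [smul_sub, Finset.smul_sum, ← smul_mul_assoc, Finset.sum_congr rfl fun s _ =>
      (smul_smul c (d s) (D.part s q))] at this

/-! ### The cell datum -/

/-- The classes of the relation `same`, enumerated by `Fin r`. -/
structure Classes (D : StarBasis R A N same) {r : ℕ} (cls : Fin r → Finset N) : Prop where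
  nonempty : ∀ k, (cls k).Nonempty
  same_iff : ∀ k s q, q ∈ cls k → (same s q ↔ s ∈ cls k)
  exists_mem : ∀ p, same p p → ∃ k, p ∈ cls k
  eq_of_mem : ∀ p k k', p ∈ cls k → p ∈ cls k' → k = k'

omit D in
/-- The cells: the whole index set, and the classes. -/
def cell {r : ℕ} (cls : Fin r → Finset N) (l : StarPoset (Fin r)) : Finset N :=
  Option.elim l Finset.univ cls

/-- The cell basis. -/
def cellBasis {r : ℕ} (l : StarPoset (Fin r)) (p q : N) : A :=
  Option.elim l (D.full p q) fun _ => D.part p q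

variable {D} {r : ℕ} {cls : Fin r → Finset N} (hcls : Classes D cls)
include hcls

theorem Classes.same_of_mem {k : Fin r} {p q : N} (hp : p ∈ cls k) (hq : q ∈ cls k) : same p q :=
  (hcls.same_iff k p q hq).2 hp

theorem isCellDatum {t : A →ₗ[R] A} (ht : ∀ a b, t (a * b) = t b * t a) (htt : ∀ a, t (t a) = a)
    (htf : ∀ i j, t (D.full i j) = D.full j i) (htp : ∀ i j, t (D.part i j) = D.part j i) :
    IsCellDatum R (M := fun l => cell cls l) (fun l p q => D.cellBasis l p q) t where
  map_mul := ht
  involutive := htt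
  map_basis l p q := by
    rcases l with _ | k
    exacts [htf _ _, htp _ _]
  linearIndependent := by
    let f : (Σ l : StarPoset (Fin r), cell cls l × cell cls l) → A →ₗ[R] R := fun s =>
      Option.elim s.1 (D.fullCoord s.2.1 s.2.2) fun _ => D.partCoord s.2.1 s.2.2
    refine linearIndependent_of_dual f ?_ ?_
    · rintro ⟨_ | k, p, q⟩ ⟨_ | k', p', q'⟩ hs
      · refine (D.fullCoord_full _ _ _ _).trans (if_neg ?_)
        rintro ⟨h1, h2⟩
        obtain rfl := Subtype.ext h1
        obtain rfl := Subtype.ext h2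
        exact hs rfl
      · exact D.fullCoord_part _ _ _ _
      · exact D.partCoord_full _ _ _ _
      · refine (D.partCoord_part _ _ _ _ (hcls.same_of_mem p'.2 q'.2)).trans (if_neg ?_)
        rintro ⟨h1, h2⟩
        obtain rfl : k = k' := hcls.eq_of_mem p k k' p.2 (h1 ▸ p'.2)
        obtain rfl := Subtype.ext h1
        obtain rfl := Subtype.ext h2
        exact hs rfl
    · rintro ⟨_ | k, p, q⟩
      · exact (D.fullCoord_full _ _ _ _).trans (if_pos ⟨rfl, rfl⟩)
      · exact (D.partCoord_part _ _ _ _ (hcls.same_of_mem p.2 q.2)).trans (if_pos ⟨rfl, rfl⟩)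
  span_eq_top := by
    rw [eq_top_iff]
    rintro a -
    induction a using D.induction with
    | zero => exact Submodule.zero_mem _
    | full i j =>
      exact Submodule.subset_span ⟨⟨(none : Option (Fin r)), ⟨i, Finset.mem_univ _⟩,
        ⟨j, Finset.mem_univ _⟩⟩, rfl⟩
    | part i j h =>
      obtain ⟨k, hk⟩ := hcls.exists_mem j (D.same_right h)
      exact Submodule.subset_span ⟨⟨(some k : Option (Fin r)),
        ⟨i, (hcls.same_iff k i j hk).1 h⟩, ⟨j, hk⟩⟩, rfl⟩
    | add a b ha hb => exact Submodule.add_mem _ ha hb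
    | smul c a ha => exact Submodule.smul_mem _ _ ha
  mul_basis a l p := by
    rcases l with _ | k
    · obtain ⟨c, hc⟩ := D.exists_mul_full a p
      refine ⟨fun s => c s, fun q => ?_⟩
      have h1 : a * D.full p q - ∑ s : (Finset.univ : Finset N), c s • D.full s q = 0 := by
        rw [hc q, sub_eq_zero]
        exact (Finset.sum_coe_sort Finset.univ fun s => c s • D.full s q).symm
      change a * D.full p q - ∑ s : (Finset.univ : Finset N), c s • D.full s q ∈ _
      rw [h1]
      exact Submodule.zero_mem _
    · obtain ⟨c, hc⟩ := D.exists_mul_part a (cls k) p (hcls.same_iff k)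
      refine ⟨c, fun q => Submodule.span_mono ?_ (hc q)⟩
      rintro _ ⟨⟨i, j⟩, rfl⟩
      refine ⟨(none : Option (Fin r)), ?_, ⟨i, Finset.mem_univ _⟩, ⟨j, Finset.mem_univ _⟩, rfl⟩
      exact lt_of_le_of_ne (Or.inl rfl) fun h => Option.some_ne_none k h.symm

/-- In the bottom cell the thin index serves, its weight being one; in the other cells any index
does, since `part o o` is a matrix unit. -/
theorem exists_base {o : N} (ho : ¬ same o o) (l : StarPoset (Fin r)) : ∃ o : cell cls l,
    (∀ p q : cell cls l, D.cellBasis l p o * D.cellBasis l o q = D.cellBasis l p q) ∧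
      ∀ p q : cell cls l, ∃ c : R,
        D.cellBasis l o p * D.cellBasis l q o = c • D.cellBasis l o o := by
  rcases l with _ | k
  · refine ⟨⟨o, Finset.mem_univ _⟩, fun p q => ?_, fun p q =>
      ⟨if (p : N) = q then D.weight p else 0, ?_⟩⟩
    · refine (D.full_mul_full _ _ _ _).trans ?_
      rw [if_pos rfl, D.weight_thin o ho, one_smul]
      rfl
    · refine (D.full_mul_full _ _ _ _).trans ?_
      rw [ite_smul, zero_smul]
      rfl
  · obtain ⟨o, ho⟩ := hcls.nonempty k
    refine ⟨⟨o, ho⟩, fun p q => ?_, fun p q => ⟨if (p : N) = q then 1 else 0, ?_⟩⟩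
    · exact (D.part_mul_part _ _ _ _ (hcls.same_of_mem p.2 ho)
        (hcls.same_of_mem ho q.2)).trans (if_pos rfl)
    · refine (D.part_mul_part _ _ _ _ (hcls.same_of_mem ho p.2)
        (hcls.same_of_mem q.2 ho)).trans ?_
      rw [ite_smul, zero_smul, one_smul]
      rfl

end StarBasis

namespace StarBasis

variable {R : Type u} {A : Type v} {N : Type*} [Field R] [Ring A] [Algebra R A] [Fintype N]
  [DecidableEq N] {same : N → N → Prop} (D : StarBasis R A N same)

/-! ### Global dimension -/

theorem exists_full_mul (a : A) (q : N) :
    ∃ c : N → R, ∀ p, D.full p q * a = ∑ s, c s • D.full p s := by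
  induction a using D.induction with
  | zero => exact ⟨0, by simp⟩
  | full i j =>
    refine ⟨Pi.single j (if q = i then D.weight q else 0), fun p => ?_⟩
    rw [Fintype.sum_pi_single_smul, D.full_mul_full, ite_smul, zero_smul]
  | part i j h =>
    refine ⟨Pi.single j (if q = i then 1 else 0), fun p => ?_⟩
    rw [Fintype.sum_pi_single_smul, D.full_mul_part _ _ _ _ h, ite_smul, zero_smul, one_smul]
  | add a b ha hb =>
    obtain ⟨c, hc⟩ := ha
    obtain ⟨d, hd⟩ := hb
    exact ⟨c + d, fun q => by simp [mul_add, hc, hd, add_smul, Finset.sum_add_distrib]⟩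
  | smul c a ha =>
    obtain ⟨d, hd⟩ := ha
    exact ⟨c • d, fun q => by simp [hd, Finset.smul_sum, smul_smul]⟩

theorem isHeredityFamily_full {o : N} (ho : ¬ same o o) : IsHeredityFamily R D.full o where
  linearIndependent := linearIndependent_of_dual (fun s => D.fullCoord s.1 s.2)
    (fun s s' h => (D.fullCoord_full _ _ _ _).trans (if_neg fun h' => h (Prod.ext h'.1 h'.2)))
    fun s => (D.fullCoord_full _ _ _ _).trans (if_pos ⟨rfl, rfl⟩)
  mul_left := D.exists_mul_full
  mul_right := D.exists_full_mul
  mul_base p q := by rw [D.full_mul_full, if_pos rfl, D.weight_thin o ho, one_smul]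
  base_mul p q := ⟨if p = q then D.weight p else 0, by
    rw [D.full_mul_full, ite_smul, zero_smul]⟩

/-- The ideal spanned by the elements `full i j`. -/
def fullIdeal : Ideal A where
  carrier := D.fullSpan
  add_mem' := Submodule.add_mem _
  zero_mem' := Submodule.zero_mem _
  smul_mem' a b hb := by
    refine (Submodule.span_le (p := D.fullSpan.comap (LinearMap.mulLeft R a))).2 ?_ hb
    rintro _ ⟨⟨p, q⟩, rfl⟩
    obtain ⟨c, hc⟩ := D.exists_mul_full a p
    change a * D.full p q ∈ D.fullSpan
    rw [hc]
    exact Submodule.sum_mem _ fun s _ => Submodule.smul_mem _ _ (D.full_mem _ _)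

variable {D} {r : ℕ} {cls : Fin r → Finset N} (hcls : Classes D cls)
include hcls

theorem Classes.sum_sum {V : Type*} [AddCommMonoid V] (f : N → V) (hf : ∀ i, ¬ same i i → f i = 0) :
    ∑ k, ∑ p : cls k, f p = ∑ i, f i := by
  have h1 : ∀ k, ∑ p : cls k, f p = ∑ i, if i ∈ cls k then f i else 0 := fun k => by
    rw [Finset.sum_coe_sort (cls k) f, Finset.sum_ite_mem, Finset.univ_inter]
  rw [Finset.sum_congr rfl fun k _ => h1 k, Finset.sum_comm]
  refine Finset.sum_congr rfl fun i _ => ?_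
  by_cases hi : same i i
  · obtain ⟨k, hk⟩ := hcls.exists_mem i hi
    rw [Finset.sum_eq_single k, if_pos hk]
    · intro k' _ hk'
      exact if_neg fun h => hk' (hcls.eq_of_mem _ _ _ h hk)
    · simp
  · simp [hf i hi]

variable (D cls) in
omit hcls in
/-- The element of the algebra given by a family of matrices indexed by the classes. -/
def ofMatrices : (∀ k, Matrix (cls k) (cls k) R) →ₗ[R] A where
  toFun m := ∑ k, ∑ p, ∑ q, m k p q • D.part p q
  map_add' m m' := by simp [add_smul, Finset.sum_add_distrib]
  map_smul' c m := by simp [Finset.smul_sum, smul_smul]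

theorem ofMatrices_mul (m m' : ∀ k, Matrix (cls k) (cls k) R) :
    D.ofMatrices cls (m * m') = D.ofMatrices cls m * D.ofMatrices cls m' := by
  have h1 : ∀ (k k') (p q : cls k) (p' q' : cls k'), D.part p q * D.part p' q' =
      if (q : N) = p' then D.part p q' else 0 := fun k k' p q p' q' =>
    D.part_mul_part _ _ _ _ (hcls.same_of_mem p.2 q.2) (hcls.same_of_mem p'.2 q'.2)
  have h2 : ∀ k, (∑ p, ∑ q, m k p q • D.part (p : N) q) *
      (∑ p, ∑ q, m' k p q • D.part (p : N) q) =
      ∑ p, ∑ q, (m k * m' k) p q • D.part (p : N) q := by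
    intro k
    simp only [Finset.sum_mul_sum, smul_mul_smul_comm, h1, Subtype.coe_inj, Matrix.mul_apply,
      Finset.sum_smul]
    refine Finset.sum_congr rfl fun p _ => ?_
    rw [Finset.sum_comm, Finset.sum_comm (s := Finset.univ (α := cls k))
      (f := fun q s => (m k p s * m' k s q) • D.part (p : N) q)]
    refine Finset.sum_congr rfl fun q _ => ?_
    rw [Finset.sum_eq_single q]
    · simp
    · intro s _ hs
      simp [hs.symm]
    · simp
  have h3 : ∀ k k', k ≠ k' → (∑ p, ∑ q, m k p q • D.part (p : N) q) *
      (∑ p, ∑ q, m' k' p q • D.part (p : N) q) = 0 := by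
    intro k k' hk
    have : ∀ (q : cls k) (p : cls k'), (q : N) ≠ p := fun q p h =>
      hk (hcls.eq_of_mem q k k' q.2 (h ▸ p.2))
    simp only [Finset.sum_mul_sum, smul_mul_smul_comm, h1, this, if_false, smul_zero,
      Finset.sum_const_zero]
  change ∑ k, ∑ p, ∑ q, (m k * m' k) p q • D.part (p : N) q =
    (∑ k, ∑ p, ∑ q, m k p q • D.part (p : N) q) * ∑ k, ∑ p, ∑ q, m' k p q • D.part (p : N) q
  rw [Finset.sum_mul_sum]
  refine Finset.sum_congr rfl fun k _ => ?_
  rw [Finset.sum_eq_single k (fun k' _ hk' => h3 k k' hk'.symm) (by simp), h2]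

/-- Modulo the ideal of the `full` elements the algebra is an image of the product of the matrix
algebras of the classes, hence semisimple. -/
theorem globalDimension_le {o : N} (ho : ¬ same o o) : globalDimension A ≤ 2 := by
  have hf := D.isHeredityFamily_full ho
  have hJ : ∀ a, a ∈ D.fullIdeal ↔
      a ∈ Submodule.span R (Set.range fun s : N × N => D.full s.1 s.2) := fun _ => Iff.rfl
  have := hf.isTwoSided hJ
  let π := Ideal.Quotient.mk D.fullIdeal
  have hπ : ∀ p q, π (D.full p q) = 0 := fun p q =>
    Ideal.Quotient.eq_zero_iff_mem.2 (hf.mem hJ p q)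
  have hπs : ∀ (c : R) (a : A), π (c • a) = c • π a := fun _ _ => rfl
  let f : (∀ k, Matrix (cls k) (cls k) R) →+* A ⧸ D.fullIdeal :=
    { toFun := fun m => π (D.ofMatrices cls m)
      map_zero' := by rw [map_zero, map_zero]
      map_add' := fun m m' => by rw [map_add, map_add]
      map_mul' := fun m m' => by rw [ofMatrices_mul hcls, map_mul]
      map_one' := by
        have h1 : D.ofMatrices cls 1 = ∑ i, D.part i i := by
          rw [← hcls.sum_sum (fun i => D.part i i) fun i hi => D.part_eq_zero i i hi]
          change ∑ k, ∑ p, ∑ q, (1 : Matrix (cls k) (cls k) R) p q • D.part (p : N) q = _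
          refine Finset.sum_congr rfl fun k _ => Finset.sum_congr rfl fun p _ => ?_
          rw [Finset.sum_eq_single p]
          · simp
          · intro q _ hq
            simp [Matrix.one_apply_ne hq.symm]
          · simp
        -- The unit is the sum of the elements `unit i`; the thin ones are `full i i` and die in the
        -- quotient.
        rw [h1, ← map_one π, ← D.sum_unit, map_sum, map_sum]
        refine Finset.sum_congr rfl fun i _ => ?_
        by_cases hi : same i i
        · rw [D.unit_thick i hi]
        · rw [D.unit_thin i hi, hπ, D.part_eq_zero i i hi, map_zero] }
  have hf' : Function.Surjective f := by
    intro y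
    obtain ⟨a, rfl⟩ := Ideal.Quotient.mk_surjective y
    change ∃ m, π (D.ofMatrices cls m) = π a
    induction a using D.induction with
    | zero => exact ⟨0, by rw [map_zero]⟩
    | full i j => exact ⟨0, by rw [map_zero, map_zero, hπ]⟩
    | part i j h =>
      obtain ⟨k, hk⟩ := hcls.exists_mem j (D.same_right h)
      have hi := (hcls.same_iff k i j hk).1 h
      refine ⟨Pi.single k (Matrix.single ⟨i, hi⟩ ⟨j, hk⟩ 1), congrArg π ?_⟩
      change ∑ k', ∑ p, ∑ q, (Pi.single k (Matrix.single ⟨i, hi⟩ ⟨j, hk⟩ 1) :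
        ∀ k, Matrix (cls k) (cls k) R) k' p q • D.part (p : N) q = _
      rw [Finset.sum_eq_single k, Finset.sum_eq_single ⟨i, hi⟩, Finset.sum_eq_single ⟨j, hk⟩]
      · simp
      · intro q _ hq
        simp [hq.symm]
      · simp
      · intro p _ hp
        simp [hp.symm]
      · simp
      · intro k' _ hk'
        simp [Pi.single_eq_of_ne hk']
      · simp
    | add a b ha hb =>
      obtain ⟨m, hm⟩ := ha
      obtain ⟨m', hm'⟩ := hb
      exact ⟨m + m', by rw [map_add, map_add, hm, hm', map_add]⟩
    | smul c a ha =>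
      obtain ⟨m, hm⟩ := ha
      exact ⟨c • m, by rw [map_smul, hπs, hm, hπs]⟩
  have := RingHom.isSemisimpleRing_of_surjective f hf'
  exact hf.globalDimension_le hJ

end StarBasis

namespace StarBasis

variable {R : Type u} {A : Type v} {N : Type*} [Field R] [Ring A] [Algebra R A] [Fintype N]
  [DecidableEq N] {same : N → N → Prop} (D : StarBasis R A N same)

/-! ### The basic algebra -/

theorem unit_mul_full (i k l : N) : D.unit i * D.full k l = if i = k then D.full k l else 0 := by
  by_cases hi : same i i
  · rw [D.unit_thick i hi, D.part_mul_full _ _ _ _ hi]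
    split_ifs with h
    exacts [by rw [h], rfl]
  · rw [D.unit_thin i hi, D.full_mul_full, D.weight_thin i hi, one_smul]
    split_ifs with h
    exacts [by rw [h], rfl]

theorem full_mul_unit (i k l : N) : D.full k l * D.unit i = if l = i then D.full k l else 0 := by
  by_cases hi : same i i
  · rw [D.unit_thick i hi, D.full_mul_part _ _ _ _ hi]
    split_ifs with h
    exacts [by rw [h], rfl]
  · rw [D.unit_thin i hi, D.full_mul_full]
    split_ifs with h
    · rw [h, D.weight_thin i hi, one_smul]
    · rfl

theorem unit_mul_part {i k l : N} (hkl : same k l) :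
    D.unit i * D.part k l = if i = k then D.part k l else 0 := by
  by_cases hi : same i i
  · rw [D.unit_thick i hi, D.part_mul_part _ _ _ _ hi hkl]
    split_ifs with h
    exacts [by rw [h], rfl]
  · have h : i ≠ k := fun h => hi (h ▸ D.same_left hkl)
    rw [D.unit_thin i hi, D.full_mul_part _ _ _ _ hkl, if_neg h, if_neg h]

theorem part_mul_unit {i k l : N} (hkl : same k l) :
    D.part k l * D.unit i = if l = i then D.part k l else 0 := by
  by_cases hi : same i i
  · rw [D.unit_thick i hi, D.part_mul_part _ _ _ _ hkl hi]
    split_ifs with h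
    exacts [by rw [h], rfl]
  · have h : l ≠ i := fun h => hi (h ▸ D.same_right hkl)
    rw [D.unit_thin i hi, D.part_mul_full _ _ _ _ hkl, if_neg h, if_neg h]

theorem unit_mul_unit (i j : N) : D.unit i * D.unit j = if i = j then D.unit i else 0 := by
  by_cases hj : same j j
  · rw [D.unit_thick j hj, D.unit_mul_part hj]
    split_ifs with h
    exacts [by rw [h, D.unit_thick j hj], rfl]
  · rw [D.unit_thin j hj, D.unit_mul_full]
    split_ifs with h
    exacts [by rw [h, D.unit_thin j hj], rfl]

theorem full_ne_zero (i j : N) : D.full i j ≠ 0 := fun h => by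
  have := D.fullCoord_full i j i j
  rw [h, map_zero, if_pos ⟨rfl, rfl⟩] at this
  exact zero_ne_one this

theorem part_ne_zero {i j : N} (hij : same i j) : D.part i j ≠ 0 := fun h => by
  have := D.partCoord_part i j i j hij
  rw [h, map_zero, if_pos ⟨rfl, rfl⟩] at this
  exact zero_ne_one this

theorem unit_ne_zero (i : N) : D.unit i ≠ 0 := by
  by_cases hi : same i i
  · rw [D.unit_thick i hi]; exact D.part_ne_zero hi
  · rw [D.unit_thin i hi]; exact D.full_ne_zero i i

/-- The Peirce component at `(i, j)` is spanned by `full i j` and `part i j`, so every corner has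
dimension at most two. -/
theorem unit_mul_mul_unit (i j : N) (a : A) : D.unit i * a * D.unit j =
    D.fullCoord i j a • D.full i j + D.partCoord i j a • D.part i j := by
  induction a using D.induction with
  | zero => simp
  | full k l =>
    rw [D.unit_mul_full, D.fullCoord_full, D.partCoord_full, zero_smul, add_zero]
    by_cases hk : i = k
    · subst hk
      rw [if_pos rfl, D.full_mul_unit]
      by_cases hl : j = l
      · subst hl; simp
      · simp [hl, Ne.symm hl]
    · simp [hk]
  | part k l h =>
    rw [D.unit_mul_part h, D.fullCoord_part, D.partCoord_part _ _ _ _ h, zero_smul, zero_add]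
    by_cases hk : i = k
    · subst hk
      rw [if_pos rfl, D.part_mul_unit h]
      by_cases hl : j = l
      · subst hl; simp
      · simp [hl, Ne.symm hl]
    · simp [hk]
  | add a b ha hb => rw [mul_add, add_mul, ha, hb, map_add, map_add, add_smul, add_smul]; abel
  | smul c a ha =>
    rw [mul_smul_comm, smul_mul_assoc, ha, map_smul, map_smul, smul_add, smul_smul, smul_smul,
      smul_eq_mul, smul_eq_mul]

variable (hw : ∀ i, same i i → D.weight i = 0)
include hw

theorem full_mul_full_self {i : N} (hi : same i i) (k l : N) : D.full k i * D.full i l = 0 := by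
  rw [D.full_mul_full, if_pos rfl, hw i hi, zero_smul]

/-- For a thin index the corner is `R`. For a thick one it is `R[f]/(f²)` with `f = full i i`,
because the weight is zero; there `y + x f` with `y ≠ 0` has the inverse `y⁻¹ - y⁻² x f`. -/
theorem isNilpotent_or_exists_inverse (i : N) (z : A) (hz : D.unit i * z * D.unit i = z) :
    IsNilpotent z ∨ ∃ z', D.unit i * z' * D.unit i = z' ∧ z' * z = D.unit i ∧
      z * z' = D.unit i := by
  have hz' := hz.symm
  rw [D.unit_mul_mul_unit] at hz'
  set x := D.fullCoord i i z
  set y := D.partCoord i i z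
  have huu : D.unit i * D.unit i = D.unit i := by rw [D.unit_mul_unit, if_pos rfl]
  by_cases hi : same i i
  · have h1 : D.full i i * D.full i i = 0 := D.full_mul_full_self hw hi _ _
    have h2 : D.full i i * D.part i i = D.full i i := by
      rw [D.full_mul_part _ _ _ _ hi, if_pos rfl]
    have h3 : D.part i i * D.full i i = D.full i i := by
      rw [D.part_mul_full _ _ _ _ hi, if_pos rfl]
    have h4 : D.part i i * D.part i i = D.part i i := by
      rw [D.part_mul_part _ _ _ _ hi hi, if_pos rfl]
    rw [D.unit_thick i hi]
    by_cases hy : y = 0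
    · left
      refine ⟨2, ?_⟩
      rw [hz', hy, zero_smul, add_zero, pow_two, smul_mul_smul_comm, h1, smul_zero]
    · right
      refine ⟨y⁻¹ • D.part i i - (y⁻¹ * y⁻¹ * x) • D.full i i, ?_, ?_, ?_⟩
      · simp only [mul_sub, sub_mul, mul_smul_comm, smul_mul_assoc, h2, h3, h4]
      · rw [hz', sub_mul, mul_add, mul_add]
        simp only [smul_mul_smul_comm, h1, h2, h3, h4, smul_zero, zero_add]
        rw [show y⁻¹ * y⁻¹ * x * y = y⁻¹ * x by field_simp, inv_mul_cancel₀ hy, one_smul]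
        abel
      · rw [hz', mul_sub, add_mul, add_mul]
        simp only [smul_mul_smul_comm, h1, h2, h3, h4, smul_zero, zero_add]
        rw [show y * (y⁻¹ * y⁻¹ * x) = x * y⁻¹ by field_simp, mul_inv_cancel₀ hy, one_smul]
        abel
  · rw [D.part_eq_zero i i hi, smul_zero, add_zero, ← D.unit_thin i hi] at hz'
    by_cases hx : x = 0
    · left
      rw [hz', hx, zero_smul]
      exact IsNilpotent.zero
    · right
      refine ⟨x⁻¹ • D.unit i, ?_, ?_, ?_⟩
      · rw [mul_smul_comm, smul_mul_assoc, huu, huu]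
      · rw [hz', smul_mul_smul_comm, huu, inv_mul_cancel₀ hx, one_smul]
      · rw [hz', smul_mul_smul_comm, huu, mul_inv_cancel₀ hx, one_smul]

/-- Between unrelated indices only multiples of `full` exist, and a composite through a thick index
carries its weight, which is zero. -/
theorem not_iso {i j : N} (hij : ¬ same i j) (hthick : same i i ∨ same j j) (y z : A)
    (hy : D.unit i * y * D.unit j = y) (hz : D.unit j * z * D.unit i = z)
    (hyz : y * z = D.unit i) (hzy : z * y = D.unit j) : False := by
  rw [D.unit_mul_mul_unit, D.part_eq_zero i j hij, smul_zero, add_zero] at hy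
  rw [D.unit_mul_mul_unit, D.part_eq_zero j i fun h => hij (D.same_symm _ _ h), smul_zero,
    add_zero] at hz
  rcases hthick with hi | hj
  · apply D.unit_ne_zero j
    rw [← hzy, ← hy, ← hz, smul_mul_smul_comm, D.full_mul_full_self hw hi, smul_zero]
  · apply D.unit_ne_zero i
    rw [← hyz, ← hy, ← hz, smul_mul_smul_comm, D.full_mul_full_self hw hj, smul_zero]

theorem isBasicAlgebra {r : ℕ} {cls : Fin r → Finset N} (hcls : Classes D cls) {o : N}
    (ho : ¬ same o o) : IsBasicAlgebra R A (StarDualExtension R r) ∧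
      LinearIndependent R (StarDualExtension.path (R := R) (r := r)) := by
  -- The vertices of the quiver: the thin index `o` for the centre, one representative `b k` for
  -- each class.
  choose b hb using hcls.nonempty
  have hbb : ∀ k, same (b k) (b k) := fun k => hcls.same_of_mem (hb k) (hb k)
  let f : Fin (r + 1) → N := Fin.cases o b
  have hf0 : f 0 = o := rfl
  have hfs : ∀ k, f k.succ = b k := fun k => rfl
  have hinj : ∀ i j, f i = f j → i = j := by
    intro i j h
    cases i using Fin.cases with
    | zero =>
      cases j using Fin.cases with
      | zero => rfl
      | succ j => exact absurd (hbb j) (by rw [← hfs, ← h]; exact ho)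
    | succ i =>
      cases j using Fin.cases with
      | zero => exact absurd (hbb i) (by rw [← hfs, h]; exact ho)
      | succ j => rw [hcls.eq_of_mem (b i) i j (hb i) (by rw [← hfs, h]; exact hb j)]
  have hsame : ∀ i j, i ≠ j → ¬ same (f i) (f j) ∧ (same (f i) (f i) ∨ same (f j) (f j)) := by
    intro i j hij
    cases i using Fin.cases with
    | zero =>
      cases j using Fin.cases with
      | zero => exact absurd rfl hij
      | succ j => exact ⟨fun h => ho (D.same_left h), Or.inr (hbb j)⟩
    | succ i =>
      refine ⟨fun h => ?_, Or.inl (hbb i)⟩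
      cases j using Fin.cases with
      | zero => exact ho (D.same_right h)
      | succ j =>
        have := (hcls.same_iff j (b i) (b j) (hb j)).1 h
        exact hij (by rw [hcls.eq_of_mem _ _ _ (hb i) this])
  have hunit : ∀ i j, D.unit (f i) * D.unit (f j) = if i = j then D.unit (f i) else 0 := by
    intro i j
    rw [D.unit_mul_unit]
    exact if_congr ⟨hinj i j, fun h => h ▸ rfl⟩ rfl rfl
  -- Every `unit p` factors through a chosen vertex: a thick `p` through the representative of its
  -- class, a thin one through `o`.
  have hgen : ∀ p, ∃ k y z, y * D.unit (f k) * z = D.unit p := by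
    intro p
    by_cases hp : same p p
    · obtain ⟨k, hk⟩ := hcls.exists_mem p hp
      have h1 := hcls.same_of_mem hk (hb k)
      refine ⟨k.succ, D.part p (b k), D.part (b k) p, ?_⟩
      rw [hfs, D.part_mul_unit h1, if_pos rfl, D.part_mul_part _ _ _ _ h1 (D.same_symm _ _ h1),
        if_pos rfl, D.unit_thick p hp]
    · refine ⟨0, D.full p o, D.full o p, ?_⟩
      rw [hf0, D.full_mul_unit, if_pos rfl, D.full_mul_full, if_pos rfl, D.weight_thin o ho,
        one_smul, D.unit_thin p hp]
  choose k y z hkyz using hgen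
  have hfam : IsCompleteProjectiveFamily A fun i => Ideal.span {D.unit (f i)} := by
    refine isCompleteProjectiveFamily_span_idempotent (fun i => D.unit (f i))
      (fun i => by rw [hunit, if_pos rfl]) (fun i => D.unit_ne_zero _)
      (fun i z hz => D.isNilpotent_or_exists_inverse hw _ z hz)
      (fun i j hij y z hy hz hyz hzy => D.not_iso hw (hsame i j hij).1 (hsame i j hij).2 y z hy hz
        hyz hzy) k y z ?_
    rw [Finset.sum_congr rfl fun p _ => hkyz p, D.sum_unit]
  have hu0 : D.unit o = D.full o o := D.unit_thin o ho
  let v : Option (Fin r) → N := fun p => p.elim o b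
  have hvinj : Function.Injective v := by
    rintro (_ | i) (_ | j) h
    · rfl
    · exact absurd (hinj 0 j.succ h) (Fin.succ_ne_zero j).symm
    · exact absurd (hinj i.succ 0 h) (Fin.succ_ne_zero i)
    · exact congrArg some (Fin.succ_injective _ (hinj i.succ j.succ h))
  have hbinj : Function.Injective b := fun i j h => Fin.succ_injective _ (hinj i.succ j.succ h)
  have hfv : ∀ i, ∃ p, f i = v p := by
    intro i
    cases i using Fin.cases with
    | zero => exact ⟨none, rfl⟩
    | succ i => exact ⟨some i, rfl⟩
  refine StarDualExtension.isBasicAlgebra (fun i => D.unit (f i))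
    (fun i => by rw [hunit, if_pos rfl]) (fun i j hij => by rw [hunit, if_neg hij]) hfam
    (fun k => D.full o (b k)) (fun k => D.full (b k) o)
    (fun i => by rw [hf0, D.unit_mul_full, if_pos rfl])
    (fun i => by rw [hfs, D.full_mul_unit, if_pos rfl])
    (fun i => by rw [hfs, D.unit_mul_full, if_pos rfl])
    (fun i => by rw [hf0, D.full_mul_unit, if_pos rfl])
    (fun i => D.full_mul_full_self hw (hbb i) _ _)
    (Sum.elim (fun s => D.full (v s.1) (v s.2)) fun k => D.part (b k) (b k)) ?_ ?_ ?_ ?_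
  · intro p q
    have h1 : p.elim (D.unit (f 0)) (fun k => D.full (b k) o) = D.full (v p) o := by
      cases p
      exacts [hu0, rfl]
    have h2 : q.elim (D.unit (f 0)) (fun k => D.full o (b k)) = D.full o (v q) := by
      cases q
      exacts [hu0, rfl]
    rw [h1, h2, D.full_mul_full, if_pos rfl, D.weight_thin o ho, one_smul]
    rfl
  · exact fun i => (D.unit_thick _ (hbb i)).symm
  · refine linearIndependent_of_dual (Sum.elim (fun s => D.fullCoord (v s.1) (v s.2))
      fun k => D.partCoord (b k) (b k)) ?_ ?_
    · rintro (⟨p, q⟩ | i) (⟨p', q'⟩ | j) hs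
      · refine (D.fullCoord_full _ _ _ _).trans (if_neg fun h => hs ?_)
        exact congrArg Sum.inl (Prod.ext (hvinj h.1) (hvinj h.2))
      · exact D.fullCoord_part _ _ _ _
      · exact D.partCoord_full _ _ _ _
      · refine (D.partCoord_part _ _ _ _ (hbb j)).trans (if_neg fun h => hs ?_)
        rw [hbinj h.1]
    · rintro (⟨p, q⟩ | i)
      · exact (D.fullCoord_full _ _ _ _).trans (if_pos ⟨rfl, rfl⟩)
      · exact (D.partCoord_part _ _ _ _ (hbb i)).trans (if_pos ⟨rfl, rfl⟩)
  · intro t ht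
    rw [← ht, Finset.sum_mul, Finset.sum_mul]
    refine Submodule.sum_mem _ fun i _ => ?_
    rw [Finset.mul_sum]
    refine Submodule.sum_mem _ fun j _ => ?_
    rw [D.unit_mul_mul_unit]
    refine Submodule.add_mem _ (Submodule.smul_mem _ _ ?_) (Submodule.smul_mem _ _ ?_)
    · obtain ⟨p, hp⟩ := hfv i
      obtain ⟨q, hq⟩ := hfv j
      rw [hp, hq]
      exact Submodule.subset_span ⟨Sum.inl (p, q), rfl⟩
    · by_cases hij : i = j
      · subst hij
        cases i using Fin.cases with
        | zero => rw [hf0, D.part_eq_zero o o ho]; exact Submodule.zero_mem _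
        | succ i => exact Submodule.subset_span ⟨Sum.inr i, rfl⟩
      · rw [D.part_eq_zero _ _ (hsame i j hij).1]
        exact Submodule.zero_mem _

end StarBasis

namespace AssociationScheme

variable {X : Type u} (S : AssociationScheme X)

/-! ## Quasi-thin schemes seen from a point -/

/-- The index of the relation that contains a pair. -/
def color (y z : X) : Fin (S.d + 1) := (S.partition y z).choose

variable {S}

theorem rel_iff_color_eq {i : Fin (S.d + 1)} {y z : X} : S.rel i y z ↔ S.color y z = i :=
  ⟨fun h => ((S.partition y z).choose_spec.2 i h).symm,
    fun h => h ▸ (S.partition y z).choose_spec.1⟩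

theorem color_self (y : X) : S.color y y = 0 := rel_iff_color_eq.1 ((S.diag y y).2 rfl)

theorem color_ne_zero {y z : X} (h : y ≠ z) : S.color y z ≠ 0 := fun h' =>
  h ((S.diag y z).1 (rel_iff_color_eq.2 h'))

variable (S) in
/-- The (one or two) points `fst i` and `snd i` that are in relation `i` to the base point `x`. -/
structure Points (x : X) where
  fst : Fin (S.d + 1) → X
  snd : Fin (S.d + 1) → X
  color_eq_iff : ∀ i y, S.color x y = i ↔ y = fst i ∨ y = snd i
  ne_iff : ∀ i, fst i ≠ snd i ↔ S.valency i = 2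

variable [Finite X] {x : X}

/-- Regularity in the form used below: a coloured triangle over one pair can be rebuilt over any
other pair of the same colour. -/
theorem exists_of_regular {i j l : Fin (S.d + 1)} {y z u v w : X} (h : S.rel l y z)
    (h' : S.rel l u v) (h₁ : S.rel i y w) (h₂ : S.rel j w z) :
    ∃ w', S.rel i u w' ∧ S.rel j w' v := by
  have h3 := S.regular i j l y z u v h h'
  have h4 : 0 < {w' | S.rel i u w' ∧ S.rel j w' v}.ncard := by
    rw [← h3]
    exact (Set.ncard_pos (Set.toFinite _)).2 ⟨w, h₁, h₂⟩
  exact (Set.ncard_pos (Set.toFinite _)).1 h4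

omit [Finite X] in
theorem valency_eq (i : Fin (S.d + 1)) (x : X) : S.valency i = {y | S.rel i x y}.ncard := by
  rw [valency, S.interNum_eq i (S.inv i) ((S.diag x x).2 rfl)]
  congr 1
  ext y
  simp [rel_inv]

theorem valency_pos (i : Fin (S.d + 1)) : 0 < S.valency i := by
  obtain ⟨y, z, h⟩ := S.nonempty i
  rw [valency_eq i y]
  exact (Set.ncard_pos (Set.toFinite _)).2 ⟨z, h⟩

theorem IsQuasiThin.nonempty_points (hS : S.IsQuasiThin) (x : X) : Nonempty (S.Points x) := by
  have : ∀ i, ∃ s o : X, (∀ y, S.color x y = i ↔ y = s ∨ y = o) ∧ (s ≠ o ↔ S.valency i = 2) := by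
    intro i
    have h1 := valency_pos i
    have h2 := hS i
    have h3 : S.valency i = 1 ∨ S.valency i = 2 := by omega
    rcases h3 with h | h
    · have h' := h
      rw [valency_eq i x, Set.ncard_eq_one] at h'
      obtain ⟨s, hs⟩ := h'
      refine ⟨s, s, fun y => ?_, by simp [h]⟩
      rw [← rel_iff_color_eq, or_self]
      exact Set.ext_iff.1 hs y
    · have h' := h
      rw [valency_eq i x, Set.ncard_eq_two] at h'
      obtain ⟨s, o, hso, hs⟩ := h'
      refine ⟨s, o, fun y => ?_, by simp [h, hso]⟩
      rw [← rel_iff_color_eq]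
      exact Set.ext_iff.1 hs y
  choose s o h1 h2 using this
  exact ⟨⟨s, o, h1, h2⟩⟩

namespace Points

variable (P : S.Points x) {i j l m : Fin (S.d + 1)} {y z : X}

omit [Finite X] in
@[simp] theorem color_fst (i : Fin (S.d + 1)) : S.color x (P.fst i) = i :=
  (P.color_eq_iff i _).2 (Or.inl rfl)

omit [Finite X] in
@[simp] theorem color_snd (i : Fin (S.d + 1)) : S.color x (P.snd i) = i :=
  (P.color_eq_iff i _).2 (Or.inr rfl)

omit [Finite X] in
theorem eq_fst_or_eq_snd (y : X) : y = P.fst (S.color x y) ∨ y = P.snd (S.color x y) :=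
  (P.color_eq_iff _ y).1 rfl

omit [Finite X] in
theorem fst_eq_snd (h : S.valency i ≠ 2) : P.fst i = P.snd i := by
  by_contra h'
  exact h ((P.ne_iff i).1 h')

/-! ### Colour patterns of the blocks seen from the base point -/

theorem exists_color_eq_right {y y' z : X} (h : S.color x y = S.color x y') :
    ∃ z', S.color x z' = S.color x z ∧ S.color y' z' = S.color y z := by
  obtain ⟨w, h1, h2⟩ := exists_of_regular (S := S) (i := S.color x z) (j := S.inv (S.color y z))
    (l := S.color x y) (y := x) (z := y) (u := x) (v := y') (w := z) (rel_iff_color_eq.2 rfl)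
    (rel_iff_color_eq.2 h.symm) (rel_iff_color_eq.2 rfl) ((S.rel_inv _ _ _).2 (rel_iff_color_eq.2 rfl))
  exact ⟨w, rel_iff_color_eq.1 h1, rel_iff_color_eq.1 ((S.rel_inv _ _ _).1 h2)⟩

theorem exists_color_eq_left {y z z' : X} (h : S.color x z = S.color x z') :
    ∃ y', S.color x y' = S.color x y ∧ S.color y' z' = S.color y z := by
  obtain ⟨w, h1, h2⟩ := exists_of_regular (S := S) (i := S.color x y) (j := S.color y z)
    (l := S.color x z) (y := x) (z := z) (u := x) (v := z') (w := y) (rel_iff_color_eq.2 rfl)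
    (rel_iff_color_eq.2 h.symm) (rel_iff_color_eq.2 rfl) (rel_iff_color_eq.2 rfl)
  exact ⟨w, rel_iff_color_eq.1 h1, rel_iff_color_eq.1 h2⟩

include P in
theorem color_left_thin (hi : S.valency i ≠ 2) {y z z' : X} (hy : S.color x y = i)
    (hz : S.color x z = S.color x z') : S.color y z = S.color y z' := by
  obtain ⟨y', h1, h2⟩ := exists_color_eq_left (S := S) (y := y) hz
  have e1 := (P.color_eq_iff i y).1 hy
  have e2 := (P.color_eq_iff i y').1 (h1.trans hy)
  rw [← P.fst_eq_snd hi, or_self] at e1 e2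
  rw [← h2, e1, e2]

/-- By regularity the two rows of the block contain the same colours, and so do the two columns. A 2
× 2 array with this property has the form `[[a, b], [b, a]]`. -/
theorem color_snd_snd_and (i l : Fin (S.d + 1)) :
    S.color (P.snd i) (P.snd l) = S.color (P.fst i) (P.fst l) ∧
      S.color (P.snd i) (P.fst l) = S.color (P.fst i) (P.snd l) := by
  have hi : S.color x (P.fst i) = S.color x (P.snd i) := by simp
  have hl : S.color x (P.fst l) = S.color x (P.snd l) := by simp
  have right : ∀ {y y'} (z), S.color x y = S.color x y' → S.color x z = l →
      S.color y' (P.fst l) = S.color y z ∨ S.color y' (P.snd l) = S.color y z := by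
    intro y y' z hy hz
    obtain ⟨z', h1, h2⟩ := exists_color_eq_right (S := S) (z := z) hy
    rcases (P.color_eq_iff l z').1 (h1.trans hz) with rfl | rfl
    exacts [Or.inl h2, Or.inr h2]
  have left : ∀ {z z'} (y), S.color x z = S.color x z' → S.color x y = i →
      S.color (P.fst i) z' = S.color y z ∨ S.color (P.snd i) z' = S.color y z := by
    intro z z' y hz hy
    obtain ⟨y', h1, h2⟩ := exists_color_eq_left (S := S) (y := y) hz
    rcases (P.color_eq_iff i y').1 (h1.trans hy) with rfl | rfl
    exacts [Or.inl h2, Or.inr h2]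
  have r1 := right (P.fst l) hi (P.color_fst l)
  have r2 := right (P.snd l) hi (P.color_snd l)
  have r3 := right (P.fst l) hi.symm (P.color_fst l)
  have r4 := right (P.snd l) hi.symm (P.color_snd l)
  have l1 := left (P.fst i) hl (P.color_fst i)
  have l2 := left (P.snd i) hl (P.color_snd i)
  have l3 := left (P.fst i) hl.symm (P.color_fst i)
  have l4 := left (P.snd i) hl.symm (P.color_snd i)
  grind

theorem color_snd_snd (i l : Fin (S.d + 1)) :
    S.color (P.snd i) (P.snd l) = S.color (P.fst i) (P.fst l) := (P.color_snd_snd_and i l).1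

theorem color_snd_fst (i l : Fin (S.d + 1)) :
    S.color (P.snd i) (P.fst l) = S.color (P.fst i) (P.snd l) := (P.color_snd_snd_and i l).2

/-- A triangle witnessing a colour of the product can be moved so that its middle vertex is `x`. The
colour then occurs in the block of `i` and `l`, and by the symmetry of the block already in its
first row. -/
theorem complexProduct_eq (i l : Fin (S.d + 1)) : S.complexProduct (S.inv i) l =
    {S.color (P.fst i) (P.fst l), S.color (P.fst i) (P.snd l)} := by
  ext m
  simp only [complexProduct, Set.mem_ofPred_eq, Set.mem_insert_iff, Set.mem_singleton_iff]
  constructor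
  · intro h
    obtain ⟨a, b, hab⟩ := S.nonempty m
    rw [S.interNum_eq _ _ hab, Set.ncard_pos (Set.toFinite _)] at h
    obtain ⟨w, h1, h2⟩ := h
    obtain ⟨y, h3, h4⟩ := exists_of_regular (S := S) (i := i) (j := m) (l := l) (y := w) (z := b)
      (u := x) (v := P.fst l) (w := a) h2 (rel_iff_color_eq.2 (by simp)) ((S.rel_inv _ _ _).1 h1)
      hab
    rw [rel_iff_color_eq] at h3 h4
    rcases (P.color_eq_iff i y).1 h3 with rfl | rfl
    · exact Or.inl h4.symm
    · rw [color_snd_fst] at h4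
      exact Or.inr h4.symm
  · have key : ∀ z, S.color x z = l → 0 < S.interNum (S.inv i) l (S.color (P.fst i) z) := by
      intro z hz
      rw [S.interNum_eq _ _ (rel_iff_color_eq.2 rfl), Set.ncard_pos (Set.toFinite _)]
      exact ⟨x, (S.rel_inv _ _ _).2 (rel_iff_color_eq.2 (by simp)), rel_iff_color_eq.2 hz⟩
    rintro (rfl | rfl)
    exacts [key _ (by simp), key _ (by simp)]

/-- `i` and `l` have valency two, and the block of `i` and `l` contains two relations. -/
def Split (i l : Fin (S.d + 1)) : Prop :=
  S.valency i = 2 ∧ S.valency l = 2 ∧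
    S.color (P.fst i) (P.fst l) ≠ S.color (P.fst i) (P.snd l)

variable {P}

omit [Finite X] in
theorem Split.refl (hi : S.valency i = 2) : P.Split i i := by
  refine ⟨hi, hi, ?_⟩
  rw [color_self]
  exact (color_ne_zero ((P.ne_iff i).2 hi)).symm

omit [Finite X] in
theorem color_symm_iff {y z y' z' : X} :
    S.color z y = S.color z' y' ↔ S.color y z = S.color y' z' := by
  have : ∀ {y z y' z' : X}, S.color z y = S.color z' y' → S.color y z = S.color y' z' := by
    intro y z y' z' h
    have h1 : S.rel (S.inv (S.color z y)) y z := (S.rel_inv _ _ _).2 (rel_iff_color_eq.2 rfl)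
    have h2 : S.rel (S.inv (S.color z y)) y' z' :=
      (S.rel_inv _ _ _).2 (rel_iff_color_eq.2 h.symm)
    rw [rel_iff_color_eq.1 h1, rel_iff_color_eq.1 h2]
  exact ⟨this, this⟩

theorem Split.symm (h : P.Split i l) : P.Split l i := by
  refine ⟨h.2.1, h.1, fun h' => h.2.2 ?_⟩
  rw [← P.color_snd_fst]
  exact color_symm_iff.1 h'

theorem ncard_complexProduct_eq_two_iff (hi : S.valency i = 2) (hl : S.valency l = 2) :
    (S.complexProduct (S.inv i) l).ncard = 2 ↔ P.Split i l := by
  rw [P.complexProduct_eq]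
  constructor
  · intro h
    refine ⟨hi, hl, fun h' => ?_⟩
    rw [h', Set.pair_eq_singleton, Set.ncard_singleton] at h
    exact absurd h (by norm_num)
  · exact fun h => Set.ncard_pair h.2.2

theorem ncard_complexProduct_eq_one (hi : S.valency i = 2) (hl : S.valency l = 2)
    (h : ¬ P.Split i l) : (S.complexProduct (S.inv i) l).ncard = 1 := by
  rw [P.complexProduct_eq]
  have h' : S.color (P.fst i) (P.fst l) = S.color (P.fst i) (P.snd l) := by
    by_contra h'
    exact h ⟨hi, hl, h'⟩
  rw [h', Set.pair_eq_singleton, Set.ncard_singleton]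

omit [Finite X] in
theorem interNum_eq_ncard (i j l : Fin (S.d + 1)) : S.interNum i j l =
    {y | (y = P.fst i ∨ y = P.snd i) ∧ S.color y (P.fst l) = j}.ncard := by
  rw [S.interNum_eq i j (x := x) (y := P.fst l) (rel_iff_color_eq.2 (by simp))]
  congr 1
  ext y
  simp only [rel_iff_color_eq, P.color_eq_iff, Set.mem_ofPred_eq]

/-- The intersection number counts the occurrences of the colour `j` in a column of the block. A
constant block of two rows would give zero or two. -/
theorem split_of_interNum_eq_one (hi : S.valency i = 2) (hl : S.valency l = 2)
    (h : S.interNum i j l = 1) : P.Split i l := by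
  refine ⟨hi, hl, fun h' => ?_⟩
  rw [interNum_eq_ncard (P := P), Set.ncard_eq_one] at h
  obtain ⟨y, hy⟩ := h
  have h1 : P.fst i ∈ ({y} : Set X) ∧ P.snd i ∈ ({y} : Set X) := by
    have hmem : y ∈ ({y} : Set X) := rfl
    rw [← hy] at hmem ⊢
    obtain ⟨rfl | rfl, h2⟩ := hmem
    · exact ⟨⟨Or.inl rfl, h2⟩, Or.inr rfl, by rw [P.color_snd_fst, ← h', h2]⟩
    · refine ⟨⟨Or.inl rfl, ?_⟩, Or.inr rfl, h2⟩
      rw [h', ← P.color_snd_fst, h2]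
  exact (P.ne_iff i).2 hi (h1.1.trans h1.2.symm)

theorem Split.interNum_eq_one (h : P.Split i l) :
    S.interNum i (S.color (P.fst i) (P.fst l)) l = 1 := by
  rw [interNum_eq_ncard (P := P), Set.ncard_eq_one]
  refine ⟨P.fst i, ?_⟩
  ext y
  simp only [Set.mem_ofPred_eq, Set.mem_singleton_iff]
  constructor
  · rintro ⟨rfl | rfl, h1⟩
    · rfl
    · rw [P.color_snd_fst] at h1
      exact absurd h1.symm h.2.2
  · rintro rfl
    exact ⟨Or.inl rfl, rfl⟩

variable (P) in
/-- The transitive closure of `Split`. -/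
def Link : Fin (S.d + 1) → Fin (S.d + 1) → Prop := Relation.TransGen P.Split

omit [Finite X] in
theorem Link.valency_left (h : P.Link i l) : S.valency i = 2 := by
  induction h with
  | single h => exact h.1
  | tail _ _ ih => exact ih

omit [Finite X] in
theorem Link.valency_right (h : P.Link i l) : S.valency l = 2 := by
  cases h with
  | single h => exact h.2.1
  | tail _ h => exact h.2.1

omit [Finite X] in
theorem Link.refl (hi : S.valency i = 2) : P.Link i i := .single (.refl hi)

theorem Link.symm (h : P.Link i l) : P.Link l i := by
  induction h with
  | single h => exact .single h.symm
  | tail _ h ih => exact .head h.symm ih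

omit [Finite X] in
theorem Link.trans (h : P.Link i j) (h' : P.Link j l) : P.Link i l := Relation.TransGen.trans h h'

theorem Link.exists_sequence (h : P.Link i l) : ∃ (n : ℕ) (a b c : ℕ → Fin (S.d + 1)),
    a 0 = i ∧ c n = l ∧
    (∀ m ≤ n, S.valency (a m) = 2 ∧ S.valency (c m) = 2 ∧ S.interNum (a m) (b m) (c m) = 1) ∧
    ∀ m < n, c m = a (m + 1) := by
  induction h with
  | @single l h =>
    exact ⟨0, fun _ => i, fun _ => S.color (P.fst i) (P.fst l), fun _ => l, rfl, rfl,
      fun _ _ => ⟨h.1, h.2.1, h.interNum_eq_one⟩, fun _ h => absurd h (Nat.not_lt_zero _)⟩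
  | @tail j l _ h ih =>
    obtain ⟨n, a, b, c, h1, h2, h3, h4⟩ := ih
    -- The new split block is appended to the sequence as its term `n + 1`.
    refine ⟨n + 1, fun m => if m ≤ n then a m else j,
      fun m => if m ≤ n then b m else S.color (P.fst j) (P.fst l),
      fun m => if m ≤ n then c m else l, by simp [h1], by simp, fun m hm => ?_, fun m hm => ?_⟩
    · by_cases hmn : m ≤ n
      · simpa [hmn] using h3 m hmn
      · simpa [hmn] using ⟨h.1, h.2.1, h.interNum_eq_one⟩
    · have hmn : m ≤ n := Nat.lt_succ_iff.1 hm
      rcases hmn.lt_or_eq with h5 | rfl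
      · simp [hmn, Nat.succ_le_of_lt h5, h4 m h5]
      · simp [h2]

/-- Each condition `p = 1` in the sequence is a split block, so the sequence is a chain of splits.
-/
theorem link_of_isBadPair (h : S.IsBadPair i l) : P.Link i l := by
  obtain ⟨n, a, b, c, rfl, rfl, h1, -, h2⟩ := h
  have h3 : ∀ m ≤ n, P.Link (a 0) (c m) := by
    intro m
    induction m with
    | zero => exact fun hm => .single (split_of_interNum_eq_one (h1 0 hm).1 (h1 0 hm).2.1 (h1 0 hm).2.2)
    | succ m ih =>
      intro hm
      refine .tail (ih (Nat.le_of_succ_le hm)) ?_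
      rw [h2 m hm]
      exact split_of_interNum_eq_one (h1 _ hm).1 (h1 _ hm).2.1 (h1 _ hm).2.2
  exact h3 n le_rfl

variable (P)

/-! ### The relation `∼` and its classes -/

theorem sim_iff_link (a b : S.valencyTwo) : S.Sim a b ↔ P.Link a b := by
  have ha : S.valency a = 2 := (Finset.mem_filter.1 a.2).2
  have hb : S.valency b = 2 := (Finset.mem_filter.1 b.2).2
  rw [Sim, ncard_complexProduct_eq_two_iff (P := P) ha hb]
  constructor
  · rintro (h | h)
    exacts [.single h, link_of_isBadPair h]
  · intro h
    by_cases h' : P.Split a b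
    · exact Or.inl h'
    · obtain ⟨n, i, j, l, h1, h2, h3, h4⟩ := h.exists_sequence
      exact Or.inr ⟨n, i, j, l, h1, h2, h3, ncard_complexProduct_eq_one ha hb h', h4⟩

include P in
theorem equivalence_sim : Equivalence S.Sim where
  refl a := (P.sim_iff_link a a).2 (Link.refl (Finset.mem_filter.1 a.2).2)
  symm h := (P.sim_iff_link _ _).2 ((P.sim_iff_link _ _).1 h).symm
  trans h h' := (P.sim_iff_link _ _).2 (((P.sim_iff_link _ _).1 h).trans ((P.sim_iff_link _ _).1 h'))

/-- The classes are described without the subtype of indices of valency two: a link already forces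
valency two at both ends. -/
theorem exists_link_iff_of_mem_simClasses {T : Finset (Fin (S.d + 1))} (hT : T ∈ S.simClasses) :
    ∃ a, S.valency a = 2 ∧ ∀ b, b ∈ T ↔ P.Link a b := by
  classical
  obtain ⟨a, -, rfl⟩ := Finset.mem_image.1 hT
  refine ⟨a, (Finset.mem_filter.1 a.2).2, fun b => ?_⟩
  rw [Finset.mem_map]
  constructor
  · rintro ⟨c, hc, rfl⟩
    exact (P.sim_iff_link a c).1 (Finset.mem_filter.1 hc).2
  · intro h
    have hb : b ∈ S.valencyTwo := Finset.mem_filter.2 ⟨Finset.mem_univ _, h.valency_right⟩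
    exact ⟨⟨b, hb⟩, Finset.mem_filter.2 ⟨Finset.mem_univ _, (P.sim_iff_link a ⟨b, hb⟩).2 h⟩, rfl⟩

include P in
theorem exists_mem_simClasses {a : Fin (S.d + 1)} (ha : S.valency a = 2) :
    ∃ T ∈ S.simClasses, a ∈ T := by
  classical
  have ha' : a ∈ S.valencyTwo := Finset.mem_filter.2 ⟨Finset.mem_univ _, ha⟩
  refine ⟨_, Finset.mem_image_of_mem _ (Finset.mem_univ ⟨a, ha'⟩), ?_⟩
  rw [Finset.mem_map]
  exact ⟨⟨a, ha'⟩, Finset.mem_filter.2 ⟨Finset.mem_univ _, P.equivalence_sim.refl _⟩, rfl⟩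

end Points

end AssociationScheme

namespace AssociationScheme.Points

variable {X : Type u} {S : AssociationScheme X} {x : X} (P : S.Points x) (R : Type v) [Field R]
  [DecidableEq X] {i j k l : Fin (S.d + 1)}

/-! ## The standard basis of the Terwilliger algebra -/

/-- The indicator vector of the first point. -/
def fstVec (i : Fin (S.d + 1)) : X → R := Pi.single (P.fst i) 1

/-- The indicator vector of the second point, if it is different from the first one. -/
def sndVec (i : Fin (S.d + 1)) : X → R := if S.valency i = 2 then Pi.single (P.snd i) 1 else 0

omit [DecidableEq X] in
theorem fst_injective : Function.Injective P.fst := fun i j h => by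
  rw [← P.color_fst i, h, P.color_fst]

omit [DecidableEq X] in
theorem snd_injective : Function.Injective P.snd := fun i j h => by
  rw [← P.color_snd i, h, P.color_snd]

omit [DecidableEq X] in
theorem fst_ne_snd (h : S.valency j = 2) : P.fst i ≠ P.snd j := fun h' => by
  have h1 : i = j := by rw [← P.color_fst i, h', P.color_snd]
  exact (P.ne_iff j).2 h (h1 ▸ h')

theorem fstVec_fst (i j : Fin (S.d + 1)) : P.fstVec R i (P.fst j) = if i = j then 1 else 0 := by
  rw [fstVec, Pi.single_apply]
  exact if_congr ⟨fun h => (P.fst_injective h).symm, fun h => h ▸ rfl⟩ rfl rfl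

theorem fstVec_snd (h : S.valency j = 2) : P.fstVec R i (P.snd j) = 0 := by
  rw [fstVec, Pi.single_apply, if_neg (P.fst_ne_snd h).symm]

theorem sndVec_fst (i j : Fin (S.d + 1)) : P.sndVec R i (P.fst j) = 0 := by
  rw [sndVec]
  split_ifs with h
  · rw [Pi.single_apply, if_neg (P.fst_ne_snd h)]
  · rfl

theorem sndVec_snd (h : S.valency j = 2) :
    P.sndVec R i (P.snd j) = if i = j then 1 else 0 := by
  rw [sndVec]
  by_cases hij : i = j
  · subst hij
    simp [h]
  · split_ifs
    · rw [Pi.single_apply, if_neg fun h' => hij (P.snd_injective h').symm]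
    · rfl

/-- The all-one block. -/
def fullBlock (i j : Fin (S.d + 1)) : Matrix X X R :=
  Matrix.vecMulVec (P.fstVec R i + P.sndVec R i) (P.fstVec R j + P.sndVec R j)

/-- The diagonal of the block of `i` and `j`. -/
def diagBlock (i j : Fin (S.d + 1)) : Matrix X X R :=
  Matrix.vecMulVec (P.fstVec R i) (P.fstVec R j) + Matrix.vecMulVec (P.sndVec R i) (P.sndVec R j)

open Classical in
/-- The diagonal of a block that contains permutation matrices in the Terwilliger algebra. -/
def permBlock (i j : Fin (S.d + 1)) : Matrix X X R := if P.Link i j then P.diagBlock R i j else 0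

theorem permBlock_of_link (h : P.Link i j) : P.permBlock R i j = P.diagBlock R i j := if_pos h

theorem permBlock_of_not_link (h : ¬ P.Link i j) : P.permBlock R i j = 0 := if_neg h

theorem transpose_fullBlock (i j : Fin (S.d + 1)) : (P.fullBlock R i j)ᵀ = P.fullBlock R j i := by
  simp [fullBlock, Matrix.transpose_vecMulVec]

theorem transpose_permBlock [Finite X] (i j : Fin (S.d + 1)) :
    (P.permBlock R i j)ᵀ = P.permBlock R j i := by
  by_cases h : P.Link i j
  · rw [permBlock_of_link _ _ h, permBlock_of_link _ _ h.symm]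
    simp [diagBlock, Matrix.transpose_vecMulVec]
  · rw [permBlock_of_not_link _ _ h, permBlock_of_not_link _ _ fun h' => h h'.symm,
      Matrix.transpose_zero]

section Product

variable [Fintype X]

theorem fstVec_dotProduct_fstVec (i j : Fin (S.d + 1)) :
    P.fstVec R i ⬝ᵥ P.fstVec R j = if i = j then 1 else 0 := by
  rw [show P.fstVec R j = Pi.single (P.fst j) 1 from rfl, dotProduct_single, mul_one, fstVec_fst]

theorem sndVec_dotProduct_fstVec (i j : Fin (S.d + 1)) :
    P.sndVec R i ⬝ᵥ P.fstVec R j = 0 := by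
  rw [show P.fstVec R j = Pi.single (P.fst j) 1 from rfl, dotProduct_single, mul_one, sndVec_fst]

theorem fstVec_dotProduct_sndVec (i j : Fin (S.d + 1)) :
    P.fstVec R i ⬝ᵥ P.sndVec R j = 0 := by
  rw [dotProduct_comm, sndVec_dotProduct_fstVec]

theorem sndVec_dotProduct_sndVec (i j : Fin (S.d + 1)) :
    P.sndVec R i ⬝ᵥ P.sndVec R j = if i = j ∧ S.valency j = 2 then 1 else 0 := by
  by_cases h : S.valency j = 2
  · rw [show P.sndVec R j = Pi.single (P.snd j) 1 from if_pos h, dotProduct_single, mul_one,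
      sndVec_snd _ _ h]
    simp [h]
  · rw [show P.sndVec R j = 0 from if_neg h, dotProduct_zero]
    simp [h]

theorem vec_dotProduct_vec (i j : Fin (S.d + 1)) :
    (P.fstVec R i + P.sndVec R i) ⬝ᵥ (P.fstVec R j + P.sndVec R j) =
      if i = j then (if S.valency j = 2 then 2 else 1) else 0 := by
  simp only [add_dotProduct, dotProduct_add, fstVec_dotProduct_fstVec, sndVec_dotProduct_fstVec,
    fstVec_dotProduct_sndVec, sndVec_dotProduct_sndVec]
  grind

theorem fullBlock_mul_fullBlock (i j k l : Fin (S.d + 1)) :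
    P.fullBlock R i j * P.fullBlock R k l =
      if j = k then (if S.valency j = 2 then 2 else 1 : R) • P.fullBlock R i l else 0 := by
  rw [fullBlock, fullBlock, Matrix.vecMulVec_mul_vecMulVec, vec_dotProduct_vec]
  by_cases h : j = k
  · subst h
    rw [if_pos rfl, if_pos rfl, Matrix.vecMulVec_smul]
    rfl
  · rw [if_neg h, if_neg h, zero_smul, Matrix.vecMulVec_zero]

theorem fullBlock_mul_diagBlock (hk : S.valency k = 2) (i j l : Fin (S.d + 1)) :
    P.fullBlock R i j * P.diagBlock R k l = if j = k then P.fullBlock R i l else 0 := by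
  rw [fullBlock, diagBlock, mul_add, Matrix.vecMulVec_mul_vecMulVec, Matrix.vecMulVec_mul_vecMulVec]
  by_cases h : j = k
  · subst h
    simp [fstVec_dotProduct_fstVec, sndVec_dotProduct_fstVec, fstVec_dotProduct_sndVec,
        sndVec_dotProduct_sndVec, hk, fullBlock, Matrix.vecMulVec_add]
  · simp [fstVec_dotProduct_fstVec, sndVec_dotProduct_fstVec, fstVec_dotProduct_sndVec,
        sndVec_dotProduct_sndVec, h]

theorem diagBlock_mul_fullBlock (hj : S.valency j = 2) (i k l : Fin (S.d + 1)) :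
    P.diagBlock R i j * P.fullBlock R k l = if j = k then P.fullBlock R i l else 0 := by
  rw [fullBlock, diagBlock, add_mul, Matrix.vecMulVec_mul_vecMulVec, Matrix.vecMulVec_mul_vecMulVec]
  by_cases h : j = k
  · subst h
    simp [fstVec_dotProduct_fstVec, sndVec_dotProduct_fstVec, fstVec_dotProduct_sndVec,
        sndVec_dotProduct_sndVec, hj, fullBlock, Matrix.add_vecMulVec]
  · simp [fstVec_dotProduct_fstVec, sndVec_dotProduct_fstVec, fstVec_dotProduct_sndVec,
        sndVec_dotProduct_sndVec, h]

theorem diagBlock_mul_diagBlock (hk : S.valency k = 2) (i j l : Fin (S.d + 1)) :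
    P.diagBlock R i j * P.diagBlock R k l = if j = k then P.diagBlock R i l else 0 := by
  simp only [diagBlock, add_mul, mul_add, Matrix.vecMulVec_mul_vecMulVec]
  by_cases h : j = k
  · subst h
    simp [fstVec_dotProduct_fstVec, sndVec_dotProduct_fstVec, fstVec_dotProduct_sndVec,
        sndVec_dotProduct_sndVec, hk]
  · simp [fstVec_dotProduct_fstVec, sndVec_dotProduct_fstVec, fstVec_dotProduct_sndVec,
        sndVec_dotProduct_sndVec, h]

end Product

/-! ### Entries -/

omit [DecidableEq X] in
theorem eq_fst_or (y : X) :
    ∃ i, y = P.fst i ∨ S.valency i = 2 ∧ y = P.snd i := by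
  refine ⟨S.color x y, ?_⟩
  rcases P.eq_fst_or_eq_snd y with h | h
  · exact Or.inl h
  · by_cases h2 : S.valency (S.color x y) = 2
    · exact Or.inr ⟨h2, h⟩
    · exact Or.inl (h.trans (P.fst_eq_snd h2).symm)

omit [DecidableEq X] in
theorem adjMatrix_apply (i : Fin (S.d + 1)) (y z : X) :
    S.adjMatrix R i y z = if S.color y z = i then 1 else 0 := by
  simp only [adjMatrix, Matrix.of_apply, rel_iff_color_eq]

theorem dualIdempotent_apply (x : X) (i : Fin (S.d + 1)) (y z : X) :
    S.dualIdempotent R x i y z = if y = z ∧ S.color x y = i then 1 else 0 := by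
  simp only [dualIdempotent, Matrix.of_apply, rel_iff_color_eq]

theorem dualIdempotent_eq (i : Fin (S.d + 1)) : S.dualIdempotent R x i = P.diagBlock R i i := by
  ext y z
  rw [dualIdempotent_apply]
  change _ = P.fstVec R i y * P.fstVec R i z + P.sndVec R i y * P.sndVec R i z
  obtain ⟨a, rfl | ⟨ha, rfl⟩⟩ := P.eq_fst_or y <;> obtain ⟨b, rfl | ⟨hb, rfl⟩⟩ := P.eq_fst_or z
  · simp only [fstVec_fst, sndVec_fst, color_fst, P.fst_injective.eq_iff]
    grind
  · simp only [fstVec_fst, sndVec_fst, fstVec_snd _ _ hb, P.fst_ne_snd hb]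
    simp
  · simp only [fstVec_fst, sndVec_fst, fstVec_snd _ _ ha, (P.fst_ne_snd ha).symm]
    simp
  · simp only [fstVec_snd _ _ ha, fstVec_snd _ _ hb, sndVec_snd _ _ ha, sndVec_snd _ _ hb,
      color_snd, P.snd_injective.eq_iff]
    grind

theorem vec_snd (i j : Fin (S.d + 1)) :
    (P.fstVec R i + P.sndVec R i) (P.snd j) = if i = j then 1 else 0 := by
  by_cases h : S.valency j = 2
  · simp [fstVec_snd _ _ h, sndVec_snd _ _ h]
  · simp [← P.fst_eq_snd h, fstVec_fst, sndVec_fst]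

theorem vec_fst (i j : Fin (S.d + 1)) :
    (P.fstVec R i + P.sndVec R i) (P.fst j) = if i = j then 1 else 0 := by
  simp [fstVec_fst, sndVec_fst]

/-- The coordinate of an all-one block. -/
def fullCoord (i j : Fin (S.d + 1)) : Matrix X X R →ₗ[R] R where
  -- The off-diagonal entry, at which `diagBlock` vanishes for valency two. If `j` is thin then `snd
  -- j = fst j`, and this is the only entry in the row.
  toFun a := a (P.fst i) (P.snd j)
  map_add' _ _ := rfl
  map_smul' _ _ := rfl

/-- The coordinate of the diagonal of a block. -/
def permCoord (i j : Fin (S.d + 1)) : Matrix X X R →ₗ[R] R where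
  toFun a := a (P.fst i) (P.fst j) - a (P.fst i) (P.snd j)
  map_add' a b := by simp; ring
  map_smul' c a := by simp [mul_sub]

theorem fullCoord_fullBlock (i j k l : Fin (S.d + 1)) :
    P.fullCoord R i j (P.fullBlock R k l) = if i = k ∧ j = l then 1 else 0 := by
  change (P.fstVec R k + P.sndVec R k) (P.fst i) * (P.fstVec R l + P.sndVec R l) (P.snd j) = _
  rw [vec_fst, vec_snd]
  grind

theorem permCoord_fullBlock (i j k l : Fin (S.d + 1)) :
    P.permCoord R i j (P.fullBlock R k l) = 0 := by
  change (P.fstVec R k + P.sndVec R k) (P.fst i) * (P.fstVec R l + P.sndVec R l) (P.fst j) -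
    (P.fstVec R k + P.sndVec R k) (P.fst i) * (P.fstVec R l + P.sndVec R l) (P.snd j) = _
  rw [vec_fst, vec_fst, vec_snd, sub_self]

theorem fullCoord_diagBlock (hl : S.valency l = 2) (i j k : Fin (S.d + 1)) :
    P.fullCoord R i j (P.diagBlock R k l) = 0 := by
  change P.fstVec R k (P.fst i) * P.fstVec R l (P.snd j) +
    P.sndVec R k (P.fst i) * P.sndVec R l (P.snd j) = 0
  rw [sndVec_fst, zero_mul, add_zero]
  by_cases hj : S.valency j = 2
  · rw [fstVec_snd _ _ hj, mul_zero]
  · rw [← P.fst_eq_snd hj, P.fstVec_fst R l j, if_neg (fun h : l = j => hj (h ▸ hl)), mul_zero]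

theorem permCoord_diagBlock (hl : S.valency l = 2) (i j k : Fin (S.d + 1)) :
    P.permCoord R i j (P.diagBlock R k l) = if i = k ∧ j = l then 1 else 0 := by
  have h := P.fullCoord_diagBlock R hl i j k
  change P.diagBlock R k l (P.fst i) (P.fst j) - P.fullCoord R i j (P.diagBlock R k l) = _
  rw [h, sub_zero]
  change P.fstVec R k (P.fst i) * P.fstVec R l (P.fst j) +
    P.sndVec R k (P.fst i) * P.sndVec R l (P.fst j) = _
  rw [sndVec_fst, zero_mul, add_zero, fstVec_fst, fstVec_fst]
  grind

end AssociationScheme.Points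

namespace AssociationScheme.Points

variable {X : Type u} {S : AssociationScheme X} {x : X} (P : S.Points x) (R : Type v) [Field R]
  [DecidableEq X] [Fintype X] {i j k l : Fin (S.d + 1)}

omit [Fintype X] in
theorem sum_diagBlock : ∑ i, P.diagBlock R i i = 1 := by
  ext y z
  rw [Matrix.sum_apply]
  simp only [← dualIdempotent_eq, dualIdempotent_apply, Matrix.one_apply]
  by_cases h : y = z <;> simp [h]

theorem dualIdempotent_mul_mul (a : Matrix X X R) (i j : Fin (S.d + 1)) (y z : X) :
    (S.dualIdempotent R x i * a * S.dualIdempotent R x j) y z =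
      if S.color x y = i ∧ S.color x z = j then a y z else 0 := by
  have h : ∀ i, S.dualIdempotent R x i =
      Matrix.diagonal fun y => if S.color x y = i then (1 : R) else 0 := by
    intro i
    ext y z
    rw [dualIdempotent_apply, Matrix.diagonal_apply]
    split_ifs <;> simp_all
  rw [h, h, Matrix.mul_diagonal, Matrix.diagonal_mul]
  split_ifs <;> simp_all

omit [Fintype X] in
theorem fullBlock_apply (i j : Fin (S.d + 1)) (y z : X) :
    P.fullBlock R i j y z = if S.color x y = i ∧ S.color x z = j then 1 else 0 := by
  change (P.fstVec R i + P.sndVec R i) y * (P.fstVec R j + P.sndVec R j) z = _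
  obtain ⟨a, rfl | ⟨ha, rfl⟩⟩ := P.eq_fst_or y <;> obtain ⟨b, rfl | ⟨hb, rfl⟩⟩ := P.eq_fst_or z <;>
  simp only [vec_fst, vec_snd, color_fst, color_snd] <;> grind

omit [Fintype X] in
theorem diagBlock_fst_fst (i j a b : Fin (S.d + 1)) :
    P.diagBlock R i j (P.fst a) (P.fst b) = if a = i ∧ b = j then 1 else 0 := by
  change P.fstVec R i (P.fst a) * P.fstVec R j (P.fst b) +
    P.sndVec R i (P.fst a) * P.sndVec R j (P.fst b) = _
  simp only [fstVec_fst, sndVec_fst]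
  grind

omit [Fintype X] in
theorem diagBlock_fst_snd {b : Fin (S.d + 1)} (hb : S.valency b = 2) (i j a : Fin (S.d + 1)) :
    P.diagBlock R i j (P.fst a) (P.snd b) = 0 := by
  change P.fstVec R i (P.fst a) * P.fstVec R j (P.snd b) +
    P.sndVec R i (P.fst a) * P.sndVec R j (P.snd b) = _
  simp [fstVec_snd _ _ hb, sndVec_fst]

omit [Fintype X] in
theorem diagBlock_snd_fst {a : Fin (S.d + 1)} (ha : S.valency a = 2) (i j b : Fin (S.d + 1)) :
    P.diagBlock R i j (P.snd a) (P.fst b) = 0 := by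
  change P.fstVec R i (P.snd a) * P.fstVec R j (P.fst b) +
    P.sndVec R i (P.snd a) * P.sndVec R j (P.fst b) = _
  simp [fstVec_snd _ _ ha, sndVec_fst]

omit [Fintype X] in
theorem diagBlock_snd_snd {a b : Fin (S.d + 1)} (ha : S.valency a = 2) (hb : S.valency b = 2)
    (i j : Fin (S.d + 1)) :
    P.diagBlock R i j (P.snd a) (P.snd b) = if a = i ∧ b = j then 1 else 0 := by
  change P.fstVec R i (P.snd a) * P.fstVec R j (P.snd b) +
    P.sndVec R i (P.snd a) * P.sndVec R j (P.snd b) = _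
  simp only [fstVec_snd _ _ ha, sndVec_snd _ _ ha, sndVec_snd _ _ hb]
  grind

/-! ### Membership in the Terwilliger algebra -/

theorem dualIdempotent_mem (i : Fin (S.d + 1)) :
    S.dualIdempotent R x i ∈ S.terwilligerAlgebra R x :=
  Algebra.subset_adjoin (Or.inr ⟨i, rfl⟩)

theorem adjMatrix_mem (x : X) (i : Fin (S.d + 1)) :
    S.adjMatrix R i ∈ S.terwilligerAlgebra R x :=
  Algebra.subset_adjoin (Or.inl ⟨i, rfl⟩)

theorem fullBlock_mem (i j : Fin (S.d + 1)) :
    P.fullBlock R i j ∈ S.terwilligerAlgebra R x := by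
  -- The sum of all adjacency matrices is the all-one matrix, and the dual idempotents cut out its
  -- block.
  have h : P.fullBlock R i j =
      S.dualIdempotent R x i * (∑ m, S.adjMatrix R m) * S.dualIdempotent R x j := by
    ext y z
    rw [dualIdempotent_mul_mul, fullBlock_apply, Matrix.sum_apply]
    simp [adjMatrix_apply]
  rw [h]
  exact mul_mem (mul_mem (dualIdempotent_mem R i) (sum_mem fun m _ => adjMatrix_mem R x m))
    (dualIdempotent_mem R j)

theorem diagBlock_mem_of_split (h : P.Split i j) :
    P.diagBlock R i j ∈ S.terwilligerAlgebra R x := by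
  -- In a split block the colour of the pair of first points occurs exactly on the diagonal.
  have h : P.diagBlock R i j = S.dualIdempotent R x i *
      S.adjMatrix R (S.color (P.fst i) (P.fst j)) * S.dualIdempotent R x j := by
    ext y z
    rw [dualIdempotent_mul_mul, adjMatrix_apply]
    obtain ⟨a, rfl | ⟨ha, rfl⟩⟩ := P.eq_fst_or y <;> obtain ⟨b, rfl | ⟨hb, rfl⟩⟩ := P.eq_fst_or z
    · rw [diagBlock_fst_fst, color_fst, color_fst]
      grind
    · rw [diagBlock_fst_snd _ _ hb, color_fst, color_snd]
      have := h.2.2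
      grind
    · rw [diagBlock_snd_fst _ _ ha, color_fst, color_snd]
      have := h.2.2
      have := P.color_snd_fst i j
      grind
    · rw [diagBlock_snd_snd _ _ ha hb, color_snd, color_snd]
      have := P.color_snd_snd i j
      grind
  rw [h]
  exact mul_mem (mul_mem (dualIdempotent_mem R i) (adjMatrix_mem R x _)) (dualIdempotent_mem R j)

/-- The diagonals of the split blocks along a chain multiply to the diagonal of the block of its end
points, since the first and second points are labelled once for each index. -/
theorem permBlock_mem (i j : Fin (S.d + 1)) :
    P.permBlock R i j ∈ S.terwilligerAlgebra R x := by
  by_cases h : P.Link i j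
  · rw [permBlock_of_link _ _ h]
    induction h with
    | single h => exact P.diagBlock_mem_of_split R h
    | @tail k l h h' ih =>
      have := mul_mem ih (P.diagBlock_mem_of_split R h')
      rwa [diagBlock_mul_diagBlock _ _ h'.1, if_pos rfl] at this
  · rw [permBlock_of_not_link _ _ h]
    exact zero_mem _

/-! ### The blocks span the Terwilliger algebra -/

/-- The span of the blocks. -/
def blockSpan : Submodule R (Matrix X X R) :=
  Submodule.span R (Set.range (fun s : Fin (S.d + 1) × Fin (S.d + 1) => P.fullBlock R s.1 s.2) ∪
    Set.range (fun s : Fin (S.d + 1) × Fin (S.d + 1) => P.permBlock R s.1 s.2))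

omit [Fintype X] in
theorem fullBlock_mem_blockSpan (i j : Fin (S.d + 1)) : P.fullBlock R i j ∈ P.blockSpan R :=
  Submodule.subset_span (Or.inl ⟨(i, j), rfl⟩)

omit [Fintype X] in
theorem permBlock_mem_blockSpan (i j : Fin (S.d + 1)) : P.permBlock R i j ∈ P.blockSpan R :=
  Submodule.subset_span (Or.inr ⟨(i, j), rfl⟩)

theorem diagBlock_mem_blockSpan (i : Fin (S.d + 1)) : P.diagBlock R i i ∈ P.blockSpan R := by
  by_cases h : S.valency i = 2
  · rw [← permBlock_of_link _ _ (Link.refl h)]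
    exact P.permBlock_mem_blockSpan R i i
  · have : P.diagBlock R i i = P.fullBlock R i i := by
      simp [diagBlock, fullBlock, show P.sndVec R i = 0 from if_neg h]
    rw [this]
    exact P.fullBlock_mem_blockSpan R i i

omit [Fintype X] in
theorem fstVec_of_color_ne {y : X} (h : S.color x y ≠ i) : P.fstVec R i y = 0 := by
  rw [fstVec, Pi.single_apply, if_neg]
  rintro rfl
  exact h (P.color_fst i)

omit [Fintype X] in
theorem sndVec_of_color_ne {y : X} (h : S.color x y ≠ i) : P.sndVec R i y = 0 := by
  rw [sndVec]
  split_ifs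
  · rw [Pi.single_apply, if_neg]
    rintro rfl
    exact h (P.color_snd i)
  · rfl

omit [Fintype X] in
theorem permBlock_of_color_ne {y z : X} (h : ¬ (S.color x y = i ∧ S.color x z = j)) :
    P.permBlock R i j y z = 0 := by
  by_cases hl : P.Link i j
  · rw [permBlock_of_link _ _ hl]
    change P.fstVec R i y * P.fstVec R j z + P.sndVec R i y * P.sndVec R j z = 0
    rcases not_and_or.1 h with h | h
    · simp [fstVec_of_color_ne _ _ h, sndVec_of_color_ne _ _ h]
    · simp [fstVec_of_color_ne _ _ h, sndVec_of_color_ne _ _ h]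
  · rw [permBlock_of_not_link _ _ hl]
    rfl

omit [DecidableEq X] in
theorem color_fst_fst_of_not_split (h : ¬ P.Split i j) :
    S.color (P.fst i) (P.fst j) = S.color (P.fst i) (P.snd j) := by
  by_cases hi : S.valency i = 2
  · by_cases hj : S.valency j = 2
    · by_contra h'
      exact h ⟨hi, hj, h'⟩
    · rw [P.fst_eq_snd hj]
  · exact P.color_left_thin hi (P.color_fst i) (by simp)

omit [Fintype X] in
theorem sum_blocks_apply (f g : Fin (S.d + 1) → Fin (S.d + 1) → R) (y z : X) :
    (∑ i, ∑ j, (f i j • P.fullBlock R i j + g i j • P.permBlock R i j)) y z =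
      f (S.color x y) (S.color x z) + g (S.color x y) (S.color x z) *
        P.permBlock R (S.color x y) (S.color x z) y z := by
  simp only [Matrix.sum_apply]
  rw [Finset.sum_eq_single (S.color x y), Finset.sum_eq_single (S.color x z)]
  · simp [fullBlock_apply]
  · intro j _ hj
    simp [fullBlock_apply, hj.symm, permBlock_of_color_ne P R (fun h => hj h.2.symm)]
  · simp
  · intro i _ hi
    refine Finset.sum_eq_zero fun j _ => ?_
    simp [fullBlock_apply, hi.symm, permBlock_of_color_ne P R (fun h => hi h.1.symm)]
  · simp

/-- A block of `A_m` is a constant matrix or, in a split block, has the form `[[a, b], [b, a]] = b J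
+ (a - b) D`. -/
theorem adjMatrix_mem_blockSpan (m : Fin (S.d + 1)) : S.adjMatrix R m ∈ P.blockSpan R := by
  have h : S.adjMatrix R m = ∑ i, ∑ j,
      (P.fullCoord R i j (S.adjMatrix R m) • P.fullBlock R i j +
        P.permCoord R i j (S.adjMatrix R m) • P.permBlock R i j) := by
    ext y z
    rw [sum_blocks_apply]
    change _ = S.adjMatrix R m _ _ + (S.adjMatrix R m _ _ - S.adjMatrix R m _ _) * _
    simp only [adjMatrix_apply]
    obtain ⟨a, ha⟩ : ∃ a, S.color x y = a := ⟨_, rfl⟩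
    obtain ⟨b, hb⟩ : ∃ b, S.color x z = b := ⟨_, rfl⟩
    rw [ha, hb]
    by_cases hs : P.Split a b
    · rw [permBlock_of_link _ _ (Relation.TransGen.single hs)]
      rcases (P.color_eq_iff a y).1 ha with rfl | rfl <;>
        rcases (P.color_eq_iff b z).1 hb with rfl | rfl
      · simp [diagBlock_fst_fst]
      · simp [diagBlock_fst_snd _ _ hs.2.1]
      · simp [diagBlock_snd_fst _ _ hs.1, color_snd_fst]
      · simp [diagBlock_snd_snd _ _ hs.1 hs.2.1, color_snd_snd]
    · have hc := P.color_fst_fst_of_not_split hs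
      rw [hc, sub_self, zero_mul, add_zero]
      rcases (P.color_eq_iff a y).1 ha with rfl | rfl <;>
        rcases (P.color_eq_iff b z).1 hb with rfl | rfl
      · rw [hc]
      · rfl
      · rw [color_snd_fst]
      · rw [color_snd_snd, hc]
  rw [h]
  exact Submodule.sum_mem _ fun i _ => Submodule.sum_mem _ fun j _ => Submodule.add_mem _
    (Submodule.smul_mem _ _ (P.fullBlock_mem_blockSpan R i j))
    (Submodule.smul_mem _ _ (P.permBlock_mem_blockSpan R i j))

theorem mul_mem_blockSpan {a b : Matrix X X R} (ha : a ∈ P.blockSpan R) (hb : b ∈ P.blockSpan R) :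
    a * b ∈ P.blockSpan R := by
  have h0 := (P.blockSpan R).zero_mem
  have hfull := P.fullBlock_mem_blockSpan R
  induction ha, hb using Submodule.span_induction₂ with
  | mem_mem a b ha hb =>
    rcases ha with ⟨⟨i, j⟩, rfl⟩ | ⟨⟨i, j⟩, rfl⟩ <;> rcases hb with ⟨⟨k, l⟩, rfl⟩ | ⟨⟨k, l⟩, rfl⟩
    · dsimp only
      rw [fullBlock_mul_fullBlock]
      split_ifs
      exacts [Submodule.smul_mem _ _ (hfull _ _), Submodule.smul_mem _ _ (hfull _ _), h0]
    · dsimp only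
      by_cases h : P.Link k l
      · rw [permBlock_of_link _ _ h, fullBlock_mul_diagBlock _ _ h.valency_left]
        split_ifs
        exacts [hfull _ _, h0]
      · rw [permBlock_of_not_link _ _ h, mul_zero]; exact h0
    · dsimp only
      by_cases h : P.Link i j
      · rw [permBlock_of_link _ _ h, diagBlock_mul_fullBlock _ _ h.valency_right]
        split_ifs
        exacts [hfull _ _, h0]
      · rw [permBlock_of_not_link _ _ h, zero_mul]; exact h0
    · dsimp only
      by_cases h : P.Link i j
      · by_cases h' : P.Link k l
        · rw [permBlock_of_link _ _ h, permBlock_of_link _ _ h',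
            diagBlock_mul_diagBlock _ _ h'.valency_left]
          split_ifs with hjk
          · subst hjk
            rw [← permBlock_of_link _ _ (h.trans h')]
            exact P.permBlock_mem_blockSpan R _ _
          · exact h0
        · rw [permBlock_of_not_link _ _ h', mul_zero]; exact h0
      · rw [permBlock_of_not_link _ _ h, zero_mul]; exact h0
  | zero_left b _ => rw [zero_mul]; exact h0
  | zero_right a _ => rw [mul_zero]; exact h0
  | add_left a b c _ _ _ h1 h2 => rw [add_mul]; exact Submodule.add_mem _ h1 h2
  | add_right a b c _ _ _ h1 h2 => rw [mul_add]; exact Submodule.add_mem _ h1 h2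
  | smul_left r a b _ _ h => rw [smul_mul_assoc]; exact Submodule.smul_mem _ _ h
  | smul_right r a b _ _ h => rw [mul_smul_comm]; exact Submodule.smul_mem _ _ h

theorem terwilligerAlgebra_le {a : Matrix X X R} (ha : a ∈ S.terwilligerAlgebra R x) :
    a ∈ P.blockSpan R := by
  have h1 : (1 : Matrix X X R) ∈ P.blockSpan R := by
    rw [← P.sum_diagBlock R]
    exact Submodule.sum_mem _ fun i _ => P.diagBlock_mem_blockSpan R i
  induction ha using Algebra.adjoin_induction with
  | mem a ha =>
    rcases ha with ⟨i, rfl⟩ | ⟨i, rfl⟩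
    · exact P.adjMatrix_mem_blockSpan R i
    · rw [dualIdempotent_eq]; exact P.diagBlock_mem_blockSpan R i
  | algebraMap r =>
    rw [Algebra.algebraMap_eq_smul_one]
    exact Submodule.smul_mem _ _ h1
  | add a b _ _ ha hb => exact Submodule.add_mem _ ha hb
  | mul a b _ _ ha hb => exact P.mul_mem_blockSpan R ha hb

/-- Both sides are linear in `a`, so after `terwilligerAlgebra_le` the expansion has to be checked
on the blocks only. -/
theorem expand {a : Matrix X X R} (ha : a ∈ S.terwilligerAlgebra R x) :
    a = ∑ i, ∑ j, (P.fullCoord R i j a • P.fullBlock R i j +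
      P.permCoord R i j a • P.permBlock R i j) := by
  replace ha := P.terwilligerAlgebra_le R ha
  induction ha using Submodule.span_induction with
  | mem a ha =>
    rcases ha with ⟨⟨k, l⟩, rfl⟩ | ⟨⟨k, l⟩, rfl⟩
    · simp [fullCoord_fullBlock, permCoord_fullBlock, ite_and, ite_smul]
    · dsimp only
      by_cases h : P.Link k l
      · rw [permBlock_of_link _ _ h]
        simp only [fullCoord_diagBlock _ _ h.valency_right, permCoord_diagBlock _ _ h.valency_right]
        simp [ite_and, ite_smul, permBlock_of_link _ _ h]
      · rw [permBlock_of_not_link _ _ h]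
        simp
  | zero => simp
  | add a b ha hb iha ihb =>
    conv_lhs => rw [iha, ihb]
    simp only [map_add, add_smul, ← Finset.sum_add_distrib]
    refine Finset.sum_congr rfl fun i _ => Finset.sum_congr rfl fun j _ => ?_
    abel
  | smul r a ha ih =>
    conv_lhs => rw [ih]
    simp only [map_smul, smul_assoc, Finset.smul_sum, smul_add]

end AssociationScheme.Points

/-! ### The Terwilliger algebra as an algebra with a star basis -/

namespace AssociationScheme.Points

variable {X : Type u} {S : AssociationScheme X} {x : X} (P : S.Points x) (R : Type v) [Field R]
  [DecidableEq X] [Fintype X]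

/-- The block basis of the Terwilliger algebra. -/
def starBasis : StarBasis R (S.terwilligerAlgebra R x) (Fin (S.d + 1)) P.Link where
  weight i := if S.valency i = 2 then 2 else 1
  full i j := ⟨P.fullBlock R i j, P.fullBlock_mem R i j⟩
  part i j := ⟨P.permBlock R i j, P.permBlock_mem R i j⟩
  fullCoord i j := P.fullCoord R i j ∘ₗ (S.terwilligerAlgebra R x).val.toLinearMap
  partCoord i j := P.permCoord R i j ∘ₗ (S.terwilligerAlgebra R x).val.toLinearMap
  same_symm _ _ h := h.symm
  same_trans _ _ _ h h' := h.trans h'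
  part_eq_zero i j h := Subtype.ext (P.permBlock_of_not_link R h)
  full_mul_full i j k l := by
    apply Subtype.ext
    refine (P.fullBlock_mul_fullBlock R i j k l).trans ?_
    by_cases h : j = k
    · rw [if_pos h, if_pos h]; rfl
    · rw [if_neg h, if_neg h]; rfl
  full_mul_part i j k l h := by
    apply Subtype.ext
    change P.fullBlock R i j * P.permBlock R k l = _
    rw [P.permBlock_of_link R h, P.fullBlock_mul_diagBlock R h.valency_left]
    split_ifs <;> rfl
  part_mul_full i j k l h := by
    apply Subtype.ext
    change P.permBlock R i j * P.fullBlock R k l = _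
    rw [P.permBlock_of_link R h, P.diagBlock_mul_fullBlock R h.valency_right]
    split_ifs <;> rfl
  part_mul_part i j k l h h' := by
    apply Subtype.ext
    change P.permBlock R i j * P.permBlock R k l = _
    rw [P.permBlock_of_link R h, P.permBlock_of_link R h',
      P.diagBlock_mul_diagBlock R h'.valency_left]
    by_cases hjk : j = k
    · subst hjk
      rw [if_pos rfl, if_pos rfl, ← P.permBlock_of_link R (h.trans h')]
    · rw [if_neg hjk, if_neg hjk]; rfl
  expand a := by
    apply Subtype.ext
    refine (P.expand R a.2).trans ?_
    simp
  fullCoord_full := P.fullCoord_fullBlock R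
  fullCoord_part i j k l := by
    change P.fullCoord R i j (P.permBlock R k l) = 0
    by_cases h : P.Link k l
    · rw [P.permBlock_of_link R h, P.fullCoord_diagBlock R h.valency_right]
    · rw [P.permBlock_of_not_link R h, map_zero]
  partCoord_full := P.permCoord_fullBlock R
  partCoord_part i j k l h := by
    change P.permCoord R i j (P.permBlock R k l) = _
    rw [P.permBlock_of_link R h, P.permCoord_diagBlock R h.valency_right]
  unit i := ⟨S.dualIdempotent R x i, dualIdempotent_mem R i⟩
  unit_thin i h := by
    apply Subtype.ext
    change S.dualIdempotent R x i = P.fullBlock R i i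
    rw [P.dualIdempotent_eq, diagBlock, fullBlock,
      show P.sndVec R i = 0 from if_neg fun h' => h (Link.refl h')]
    simp
  unit_thick i h := by
    apply Subtype.ext
    change S.dualIdempotent R x i = P.permBlock R i i
    rw [P.dualIdempotent_eq, P.permBlock_of_link R h]
  sum_unit := by
    apply Subtype.ext
    rw [AddSubmonoidClass.coe_finsetSum]
    simp only [P.dualIdempotent_eq]
    exact P.sum_diagBlock R
  weight_thin i h := if_neg fun h' => h (Link.refl h')

theorem classes {r : ℕ} (e : Fin r ≃ S.simClasses) :
    StarBasis.Classes (P.starBasis R) fun k => (e k : Finset (Fin (S.d + 1))) where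
  nonempty k := by
    obtain ⟨a, ha, h⟩ := P.exists_link_iff_of_mem_simClasses (e k).2
    exact ⟨a, (h a).2 (Link.refl ha)⟩
  same_iff k s q hq := by
    obtain ⟨a, ha, h⟩ := P.exists_link_iff_of_mem_simClasses (e k).2
    rw [h] at hq
    rw [h]
    exact ⟨fun h' => hq.trans h'.symm, fun h' => h'.symm.trans hq⟩
  exists_mem p hp := by
    obtain ⟨T, hT, hpT⟩ := P.exists_mem_simClasses hp.valency_left
    exact ⟨e.symm ⟨T, hT⟩, by rwa [Equiv.apply_symm_apply]⟩
  eq_of_mem p k k' hp hp' := by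
    obtain ⟨a, ha, h⟩ := P.exists_link_iff_of_mem_simClasses (e k).2
    obtain ⟨a', ha', h'⟩ := P.exists_link_iff_of_mem_simClasses (e k').2
    rw [h] at hp
    rw [h'] at hp'
    refine e.injective (Subtype.ext (Finset.ext fun b => ?_))
    rw [h, h']
    exact ⟨fun hb => hp'.trans (hp.symm.trans hb), fun hb => hp.trans (hp'.symm.trans hb)⟩

-- The diagonal has valency one, so `0` is the thin index that serves as base of the bottom cell and
-- as centre of the star.
omit [DecidableEq X] in
omit [Fintype X] in
theorem not_link_zero : ¬ P.Link 0 0 := by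
  have h : ∀ y, S.color x y = 0 → y = x := fun y hy =>
    ((S.diag x y).1 (rel_iff_color_eq.2 hy)).symm
  intro h'
  exact (P.ne_iff 0).2 h'.valency_left
    ((h _ (P.color_fst 0)).trans (h _ (P.color_snd 0)).symm)

end AssociationScheme.Points

end

theorem theorem2p11 {R : Type*} [Field R] {X : Type*} [Fintype X] [DecidableEq X]
    (S : AssociationScheme X) (hS : S.IsQuasiThin) (x : X)
    (r : ℕ) (e : Fin r ≃ S.simClasses) :
    Equivalence S.Sim ∧
    (∃ C : ∀ l : StarPoset (Fin r), S.cells e l → S.cells e l → S.terwilligerAlgebra R x,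
      IsCellDatum R C (S.terwilligerTranspose R x) ∧
      ∃ J : Fin (r + 2) → Ideal (S.terwilligerAlgebra R x),
        (∀ i a, a ∈ J i ↔ a ∈ Submodule.span R
          {b | ∃ l : StarPoset (Fin r), l.pos.castSucc < i ∧ ∃ p q, b = C l p q}) ∧
        IsHeredityChain J) ∧
    IsQuasiHereditary R (S.terwilligerAlgebra R x) ∧
    (CharP R 2 →
      IsBasicAlgebra R (S.terwilligerAlgebra R x) (StarDualExtension R r) ∧
      globalDimension (StarDualExtension R r) ≤ 2 ∧
      globalDimension (S.terwilligerAlgebra R x) ≤ 2) := by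
  obtain ⟨P⟩ := hS.nonempty_points x
  have hcls := P.classes R e
  have ho := P.not_link_zero
  have hcell := StarBasis.isCellDatum hcls (t := S.terwilligerTranspose R x)
    (fun a b => Subtype.ext (Matrix.transpose_mul _ _))
    (fun a => Subtype.ext (Matrix.transpose_transpose _))
    (fun i j => Subtype.ext (P.transpose_fullBlock R i j))
    (fun i j => Subtype.ext (P.transpose_permBlock R i j))
  have hchain := hcell.isHeredityChain (StarBasis.exists_base hcls ho)
  refine ⟨P.equivalence_sim, ⟨fun l p q => (P.starBasis R).cellBasis l p q, hcell,
    hcell.cellIdeal, fun _ _ => Iff.rfl, hchain⟩, ⟨inferInstance, _, _, hchain⟩, fun hR => ?_⟩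
  -- This is where the characteristic enters: the weight of an index of valency two is `2 = 0`.
  have hw : ∀ i, P.Link i i → (P.starBasis R).weight i = 0 := fun i hi =>
    (if_pos hi.valency_left).trans (CharTwo.two_eq_zero)
  obtain ⟨h1, h2⟩ := (P.starBasis R).isBasicAlgebra hw hcls ho
  exact ⟨h1, StarDualExtension.globalDimension_le h2, StarBasis.globalDimension_le hcls ho⟩
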